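/- **Proposition 3.1 (Action).** Let $G\subset GL(n,\mathbb R)$ be a closed connected subgroup with Lie algebra $\mathfrak g$, and let $G^c\subset GL(n,\mathbb C)$ be its complexification, i.e. the subgroup generated by the matrices $\exp\zeta$, $\zeta\in\mathfrak g^c:=\mathfrak g+i\mathfrak g$. Let $|\cdot|$ be the Euclidean norm of matrices. For $\delta>0$ let $$E_\delta=\{gp:\ g\in G,\ p\in G^c,\ |p-I|<\delta,\ p=\exp\zeta \text{ for some } \zeta\in\mathfrak g^c \text{ with } |\zeta|<1\}.$$ Then there are integers $N,m,k\ge 0$, a linear isomorphism $T:\mathbb C^m\to {\rm Sym}(N,\mathbb C)\times{\rm Sym}(N,\mathbb C)$ and $\delta_0>0$ such that for every $0<\delta<\delta_0$: 1. If $G^c$ is closed in $GL(n,\mathbb C)$, then $E_\delta=\{gp: g\in G,\ p\in G^c,\ |p-I|<\delta\}$. 2. $E_\delta$ is an embedded complex submanifold of ${\rm Mat}(n,\mathbb C)$ of dimension $\dim_{\mathbb C}\mathfrak g^c$. 3. There is a domain $\Omega\subset\mathbb C^m$ of bounded type (biholomorphic to a bounded domain in $\mathbb C^m$), such that $T(\Omega)$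 lies in the product $\Sigma^+\times\Sigma^+$ of two copies of the Siegel domain $\Sigma^+=\{z\in{\rm Sym}(N,\mathbb C): {\rm Re}\,z>0\}$, and there is an action of $G$ on $\Omega$ that is holomorphic (each $g\in G$ acts by a biholomorphic map), free (all orbit maps $g\mapsto gz$ are injective), proper (it is continuous and $(g,z)\mapsto(gz,z)$, $G\times\Omega\to\Omega\times\Omega$, is a proper map), and has totally real orbits (each orbit is a real submanifold whose tangent spaces contain no complex line). 4. There is a biholomorphic map $\Phi:E_\delta\times\mathbb B^k\to\Omega$, where $\mathbb B^k\subset\mathbb C^k$ is the unit ball, that carries the action $g\cdot(h,b)=(gh,b)$ of $G$ on $E_\delta\times\mathbb B^k$ ($gh$ is the matrix product) to the action of $G$ on $\Omega$: $\Phi(gh,b)=g\cdot\Phi(h,b)$. -/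

import Mathlib

open scoped ContDiff

namespace LinearAction

/-! ### Holomorphic maps, domains and submanifolds in complex vector spaces -/

section Complex

variable {V W : Type*} [NormedAddCommGroup V] [NormedSpace ℂ V]
  [NormedAddCommGroup W] [NormedSpace ℂ W]

/-- A map between subsets `S ⊆ V` and `T ⊆ W` of complex vector spaces is holomorphic if near
every point of `S` it is the restriction of a holomorphic map defined on an open subset of `V`.
For open `S` this is plain holomorphy; for embedded complex submanifolds it is holomorphy of maps
of complex manifolds. -/
def IsHolomorphic {S : Set V} {T : Set W} (f : S → T) : Prop :=
  ∀ x : S, ∃ U : Set V, IsOpen U ∧ (x : V) ∈ U ∧ ∃ F : V → W,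
    DifferentiableOn ℂ F U ∧ ∀ y : S, (y : V) ∈ U → F y = f y

/-- Biholomorphic bijections. -/
def IsBiholomorphic {S : Set V} {T : Set W} (e : S ≃ T) : Prop :=
  IsHolomorphic e ∧ IsHolomorphic e.symm

/-- A domain: a nonempty connected open subset. -/
def IsComplexDomain (D : Set V) : Prop :=
  IsOpen D ∧ IsConnected D

/-- A domain of bounded type: a domain biholomorphic to a bounded domain of the same space. -/
def IsDomainOfBoundedType (D : Set V) : Prop :=
  IsComplexDomain D ∧
    ∃ D' : Set V, IsComplexDomain D' ∧ Bornology.IsBounded D' ∧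
      ∃ e : D ≃ D', IsBiholomorphic e

end Complex

/-- Embedded `𝕜`-smooth submanifolds of dimension `d` of a vector space, by slice charts
(real smooth ones for `𝕜 = ℝ`, complex ones for `𝕜 = ℂ`). -/
def IsSubmanifold (𝕜 : Type*) [RCLike 𝕜] {V : Type*} [NormedAddCommGroup V] [NormedSpace 𝕜 V]
    (d : ℕ) (M : Set V) : Prop :=
  ∀ x ∈ M, ∃ φ : OpenPartialHomeomorph V V, x ∈ φ.source ∧
    ContDiffOn 𝕜 ∞ φ φ.source ∧ ContDiffOn 𝕜 ∞ φ.symm φ.target ∧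
    ∃ L : Submodule 𝕜 V, Module.finrank 𝕜 L = d ∧
      ∀ y ∈ φ.source, y ∈ M ↔ φ y ∈ L

/-- The vectors tangent to `M` at `z`: velocities at `z` of curves in `M`. -/
def tangentVectors {V : Type*} [NormedAddCommGroup V] [NormedSpace ℝ V]
    (M : Set V) (z : V) : Set V :=
  {v | ∃ γ : ℝ → V, (∀ t, γ t ∈ M) ∧ γ 0 = z ∧ HasDerivAt γ v 0}

/-- `M` is a real submanifold none of whose tangent spaces contains a complex line. -/
def IsTotallyReal {V : Type*} [NormedAddCommGroup V] [NormedSpace ℂ V] (M : Set V) : Prop :=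
  (∃ d : ℕ, IsSubmanifold ℝ d M) ∧
    ∀ z ∈ M, ∀ v ∈ tangentVectors M z, Complex.I • v ∈ tangentVectors M z → v = 0

/-! ### Holomorphic, free, and totally real actions -/

section Action

variable (G : Type*) [Group G] {V : Type*} [NormedAddCommGroup V] [NormedSpace ℂ V]
  (Ω : Set V) [MulAction G Ω]

/-- Every group element acts by a biholomorphic map. -/
def IsHolomorphicAction : Prop :=
  ∀ g : G, IsBiholomorphic (MulAction.toPerm g : Ω ≃ Ω)

/-- Every orbit map is injective. -/
def IsFreeAction : Prop :=
  ∀ x : Ω, Function.Injective fun g : G => g • x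

/-- All orbits are totally real. -/
def HasTotallyRealOrbits : Prop :=
  ∀ x : Ω, IsTotallyReal (Subtype.val '' MulAction.orbit G x)

end Action

/-! ### Linear groups, their complexifications, and the neighbourhoods `E_δ` -/

/-- The Euclidean (Frobenius) norm of a complex matrix. -/
noncomputable def matNorm {n : ℕ} (A : Matrix (Fin n) (Fin n) ℂ) : ℝ :=
  Real.sqrt (∑ i, ∑ j, ‖A i j‖ ^ 2)

section Linear

variable {n : ℕ} (G : Subgroup (Matrix.GeneralLinearGroup (Fin n) ℝ))

/-- The Lie algebra of a closed linear group, as a set of real matrices. -/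
def lieAlg : Set (Matrix (Fin n) (Fin n) ℝ) :=
  {X | ∀ t : ℝ, ∃ g ∈ G, (g : Matrix (Fin n) (Fin n) ℝ) = NormedSpace.exp (t • X)}

/-- The complexified Lie algebra `𝔤 + i𝔤`: the complex span of the Lie algebra `𝔤`. -/
def complexLieAlg : Submodule ℂ (Matrix (Fin n) (Fin n) ℂ) :=
  Submodule.span ℂ ((fun X => X.map Complex.ofReal) '' lieAlg G)

/-- The complexification `G^c` of a connected closed linear group `G`: the connected complex Lie
subgroup of `GL(n, ℂ)` with Lie algebra `𝔤 + i𝔤`, that is, the subgroup generated by the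
exponentials of the elements of `𝔤 + i𝔤`. -/
def complexification : Subgroup (Matrix.GeneralLinearGroup (Fin n) ℂ) :=
  Subgroup.closure {p | ∃ ζ ∈ complexLieAlg G,
    (p : Matrix (Fin n) (Fin n) ℂ) = NormedSpace.exp ζ}

/-- A real invertible matrix, regarded as a complex matrix. -/
def toComplex (g : Matrix.GeneralLinearGroup (Fin n) ℝ) : Matrix (Fin n) (Fin n) ℂ :=
  (g : Matrix (Fin n) (Fin n) ℝ).map Complex.ofReal

/-- The set `{g p : g ∈ G, p ∈ G^c, |p - I| < δ}`. -/
def rawTube (δ : ℝ) : Set (Matrix (Fin n) (Fin n) ℂ) :=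
  {h | ∃ g ∈ G, ∃ p ∈ complexification G,
    matNorm ((p : Matrix (Fin n) (Fin n) ℂ) - 1) < δ ∧
    h = toComplex g * (p : Matrix (Fin n) (Fin n) ℂ)}

/-- The neighbourhood `E_δ = {g p : g ∈ G, p ∈ G^c, |p - I| < δ}` of `G` in `G^c`, where the
closeness of `p` to `I` is understood in the Lie group `G^c`: besides `|p - I| < δ`, the matrix `p`
lies in the exponential chart of `G^c` at `I`. (If `G^c` is closed in `GL(n, ℂ)` and `δ` is small,
this last condition is automatic. If `G^c` is not closed, it removes the other
sheets of `G^c` that accumulate at `I` in the space of matrices.) -/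
def tube (δ : ℝ) : Set (Matrix (Fin n) (Fin n) ℂ) :=
  {h | ∃ g ∈ G, ∃ p ∈ complexification G,
    (∃ ζ ∈ complexLieAlg G, matNorm ζ < 1 ∧
      (p : Matrix (Fin n) (Fin n) ℂ) = NormedSpace.exp ζ) ∧
    matNorm ((p : Matrix (Fin n) (Fin n) ℂ) - 1) < δ ∧
    h = toComplex g * (p : Matrix (Fin n) (Fin n) ℂ)}

theorem toComplex_mul_mem_tube {δ : ℝ} {g : Matrix.GeneralLinearGroup (Fin n) ℝ} (hg : g ∈ G)
    {h : Matrix (Fin n) (Fin n) ℂ} (hh : h ∈ tube G δ) : toComplex g * h ∈ tube G δ := by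
  obtain ⟨g', hg', p, hp, hζ, hδ, rfl⟩ := hh
  refine ⟨g * g', G.mul_mem hg hg', p, hp, hζ, hδ, ?_⟩
  have : toComplex (g * g') = toComplex g * toComplex g' := by
    simp only [toComplex, Units.val_mul]
    exact Matrix.map_mul (f := Complex.ofRealHom)
  rw [this, mul_assoc]

/-- The product `E_δ × 𝔹^k` with the Euclidean unit ball `𝔹^k ⊂ ℂ^k`. -/
def tubeBall (δ : ℝ) (k : ℕ) :
    Set (Matrix (Fin n) (Fin n) ℂ × EuclideanSpace ℂ (Fin k)) :=
  tube G δ ×ˢ Metric.ball 0 1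

/-- The map `(h, b) ↦ (g h, b)` of `E_δ × 𝔹^k`. -/
def translate {δ : ℝ} {k : ℕ} (g : G) (x : tubeBall G δ k) : tubeBall G δ k :=
  ⟨(toComplex (g : Matrix.GeneralLinearGroup (Fin n) ℝ) * x.1.1, x.1.2),
    toComplex_mul_mem_tube G g.2 x.2.1, x.2.2⟩

end Linear

/-! ### Siegel domains -/

/-- The space of complex symmetric `N × N` matrices. -/
def symMat (N : ℕ) : Submodule ℂ (Matrix (Fin N) (Fin N) ℂ) where
  carrier := {z | z.IsSymm}
  add_mem' := fun ha hb => Matrix.IsSymm.add ha hb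
  zero_mem' := Matrix.isSymm_zero
  smul_mem' := fun c _ hz => Matrix.IsSymm.smul hz c

/-- The Siegel domain of symmetric matrices with positive definite real part. -/
def siegel (N : ℕ) : Set (symMat N) :=
  {z | ((z : Matrix (Fin N) (Fin N) ℂ).map Complex.re).PosDef}

end LinearAction

/- Matrices as a normed space, for differentiability only: all norms on this finite-dimensional
space give the same holomorphic maps. -/
attribute [local instance] Matrix.normedAddCommGroup Matrix.normedSpace

open LinearAction

/-! The matrices $b$ act on pairs of symmetric $2n\times 2n$ matrices by $z\mapsto JzJ^T$ with
$J=b\oplus 1$. The upper right block of the first matrix of the pair is a linear map $P$ with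
$P(b\cdot z)=bP(z)$, and there is a pair $z_0$ in the Siegel product with $P(z_0)=1$. So $P$ is a
left inverse of the orbit map $b\mapsto b\cdot z_0$, and the tube $E_\delta$ embeds in the vector
space $V$ of pairs. Thickening by a small ball in a linear complement of the tangent space of this
orbit gives $\Phi(h,b)=h\cdot(z_0+\ell b)$, whose image is $\Omega$. Only these properties are used,
and `FramedRep` records them.

The main difficulty is that $\Phi$ must be injective and open on the whole tube, although $G$ is not
compact and $G^c$ may fail to be closed. If $g\exp\zeta\cdot(z_0+\kappa)$ lies near $z_0$, applying
$P$ shows that $g$ is near $1$. The closed subgroup theorem (`eventually_exists_expUnit_eq`) then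
makes $g$ the exponential of a small element of $\mathfrak g$. The local group property of
$\exp\mathfrak g^c$ (`eventually_exists_exp_mul_exp_eq`) rewrites $g\exp\zeta$ as one small
exponential, so the inverse function theorem at $z_0$ decides everything. This is
`FramedRep.exists_isChart`; translating by $G$ gives `FramedRep.exists_local_inverse`. The same
chart for left multiplication of the algebra on itself shows that $E_\delta$ is a submanifold.

The action of $G$ inherits its properties through $P$, which is equivariant from $\Omega$ to
invertible matrices with left translation by a closed group of real matrices: it is free, proper,
and has totally real orbits. Real congruences preserve the Siegel domain, so it suffices that $\Phi$
sends a neighbourhood of $(1,0)$ into the Siegel product (`FramedRep.exists_domain`). The transform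
$z\mapsto(1+z)^{-1}$ makes $\Omega$ of bounded type (`isDomainOfBoundedType_of_siegel`).

If $G^c$ is closed, it is a Baire space covered by countably many translates of a small exponential
ball, so a neighbourhood of $1$ in $G^c$ consists of small exponentials
(`exists_exp_of_mem_expGroup`). -/

namespace LinearAction

open Filter Topology NormedSpace Set

/-! ### Exponentials in Banach algebras -/

section InverseFunction

variable {𝕜 : Type*} [RCLike 𝕜] {E : Type*} [NormedAddCommGroup E] [NormedSpace 𝕜 E]
  [CompleteSpace E]

/-- The inverse function theorem for an analytic map with derivative the identity. -/
theorem exists_openPartialHomeomorph_of_hasFDerivAt_id {f : E → E} {a : E}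
    (hf : ContDiffAt 𝕜 ω f a) (hf' : HasFDerivAt f (ContinuousLinearMap.id 𝕜 E) a) :
    ∃ X : OpenPartialHomeomorph E E, (X : E → E) = f ∧ a ∈ X.source ∧
      ContDiffOn 𝕜 ω X.symm X.target := by
  have h' : HasFDerivAt f ((ContinuousLinearEquiv.refl 𝕜 E : E ≃L[𝕜] E) : E →L[𝕜] E) a := hf'
  have hn : (ω : WithTop ℕ∞) ≠ 0 := by simp
  set Y := hf.toOpenPartialHomeomorph f h' hn with hY
  have ha : a ∈ Y.source := hf.mem_toOpenPartialHomeomorph_source h' hn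
  have hYf : (Y : E → E) = f := rfl
  have hs : ContDiffAt 𝕜 ω Y.symm (f a) := hf.to_localInverse h' hn
  have hev := hs.eventually (by simp)
  obtain ⟨U, hU, hUo, haU⟩ := mem_nhds_iff.1 hev
  -- The target is cut down to an open set on which the local inverse is analytic at every point.
  refine ⟨(Y.symm.restrOpen U hUo).symm, hYf, ?_, ?_⟩
  · simp only [OpenPartialHomeomorph.symm_source, OpenPartialHomeomorph.restrOpen]
    refine ⟨?_, ?_⟩
    · simpa using ha
    · simpa [hYf] using haU
  · intro y hy
    have : y ∈ U := by
      have := hy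
      simp at this
      exact this.2
    have h2 : ContDiffAt 𝕜 ω Y.symm y := hU this
    exact h2.contDiffWithinAt

end InverseFunction

theorem exists_projection {𝕜 : Type*} [RCLike 𝕜] {E : Type*} [NormedAddCommGroup E]
    [NormedSpace 𝕜 E] [FiniteDimensional 𝕜 E] (W : Submodule 𝕜 E) :
    ∃ π : E →L[𝕜] E, (∀ a, π a ∈ W) ∧ ∀ a ∈ W, π a = a := by
  obtain ⟨m, hm⟩ := W.exists_isCompl
  refine ⟨LinearMap.toContinuousLinearMap (W.subtype ∘ₗ W.projectionOnto m hm),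
    fun a => (W.projectionOnto m hm a).2, fun a ha => ?_⟩
  have := Submodule.projectionOnto_apply_left hm ⟨a, ha⟩
  simp only [LinearMap.coe_toContinuousLinearMap', LinearMap.comp_apply]
  rw [this]; rfl

section Exp

variable {𝕜 : Type*} [RCLike 𝕜] {𝔸 : Type*} [NormedRing 𝔸] [NormedAlgebra 𝕜 𝔸] [CompleteSpace 𝔸]

variable (𝕜) in
theorem contDiff_exp : ContDiff 𝕜 ω (exp : 𝔸 → 𝔸) :=
  contDiff_iff_contDiffAt.2 fun x => (exp_analytic (𝕂 := 𝕜) x).contDiffAt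

theorem hasFDerivAt_exp_comp {E : Type*} [NormedAddCommGroup E] [NormedSpace 𝕜 E] {f : E → 𝔸}
    {f' : E →L[𝕜] 𝔸} {x : E} (hf : HasFDerivAt f f' x) (h0 : f x = 0) :
    HasFDerivAt (fun y => exp (f y)) f' x := by
  have h : HasFDerivAt exp (1 : 𝔸 →L[𝕜] 𝔸) (f x) := h0 ▸ hasFDerivAt_exp_zero
  exact h.comp x hf

variable (𝕜 𝔸) in
/-- The local logarithm. -/
theorem exists_log :
    ∃ X : OpenPartialHomeomorph 𝔸 𝔸, (X : 𝔸 → 𝔸) = exp ∧ 0 ∈ X.source ∧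
      ContDiffOn 𝕜 ω X.symm X.target :=
  exists_openPartialHomeomorph_of_hasFDerivAt_id (contDiff_exp 𝕜).contDiffAt
    (hasFDerivAt_exp_zero (𝕂 := 𝕜))

end Exp

section Real

variable {𝔸 : Type*} [NormedRing 𝔸] [NormedAlgebra ℝ 𝔸] [CompleteSpace 𝔸]

theorem exp_add_of_commute' {x y : 𝔸} (h : Commute x y) : exp (x + y) = exp x * exp y := by
  let : NormedAlgebra ℚ 𝔸 := NormedAlgebra.restrictScalars ℚ ℝ 𝔸
  exact exp_add_of_commute h

theorem continuous_exp' : Continuous (exp : 𝔸 → 𝔸) := (contDiff_exp ℝ).continuous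

/-- The exponential as a unit. -/
noncomputable def expUnit (x : 𝔸) : 𝔸ˣ where
  val := exp x
  inv := exp (-x)
  val_inv := by
    rw [← exp_add_of_commute' (Commute.neg_right rfl), add_neg_cancel, exp_zero]
  inv_val := by
    rw [← exp_add_of_commute' (Commute.neg_left rfl), neg_add_cancel, exp_zero]

@[simp] theorem val_expUnit (x : 𝔸) : (expUnit x : 𝔸) = exp x := rfl

theorem continuous_expUnit : Continuous (expUnit : 𝔸 → 𝔸ˣ) :=
  Units.continuous_iff.2 ⟨continuous_exp', continuous_exp'.comp continuous_neg⟩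

@[simp] theorem expUnit_zero : expUnit (0 : 𝔸) = 1 := Units.ext (by simp)

theorem expUnit_add {x y : 𝔸} (h : Commute x y) : expUnit (x + y) = expUnit x * expUnit y :=
  Units.ext (by simp [exp_add_of_commute' h])

theorem expUnit_neg (x : 𝔸) : expUnit (-x) = (expUnit x)⁻¹ := by
  rw [eq_inv_iff_mul_eq_one, ← expUnit_add (Commute.neg_left rfl), neg_add_cancel, expUnit_zero]

theorem expUnit_nsmul (k : ℕ) (x : 𝔸) : expUnit (k • x) = expUnit x ^ k := by
  induction k with
  | zero => simp
  | succ k ih =>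
    rw [succ_nsmul, expUnit_add (by rw [nsmul_eq_mul]; exact (Nat.cast_commute k x).mul_left rfl),
      ih, pow_succ]

theorem expUnit_zsmul (k : ℤ) (x : 𝔸) : expUnit (k • x) = expUnit x ^ k := by
  obtain ⟨n, rfl | rfl⟩ := k.eq_nat_or_neg
  · rw [natCast_zsmul, expUnit_nsmul, zpow_natCast]
  · rw [neg_smul, natCast_zsmul, expUnit_neg, expUnit_nsmul, zpow_neg, zpow_natCast]

/-! ### The Lie algebra of a closed subgroup -/

variable {G : Subgroup 𝔸ˣ}

/-- Replacing $s_j$ by its integer part changes $s_jY_j$ by less than $\|Y_j\|\to 0$ in norm.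
Integer multiples exponentiate to powers of elements of $G$, and $G$ is closed. -/
theorem expUnit_mem_of_tendsto (hG : IsClosed (G : Set 𝔸ˣ)) {Y : ℕ → 𝔸} {s : ℕ → ℝ} {Z : 𝔸}
    (hY : Tendsto Y atTop (𝓝 0)) (hs : Tendsto (fun j => s j • Y j) atTop (𝓝 Z))
    (hmem : ∀ j, expUnit (Y j) ∈ G) : expUnit Z ∈ G := by
  have h1 : Tendsto (fun j => (⌊s j⌋ : ℝ) • Y j) atTop (𝓝 Z) := by
    have h2 : Tendsto (fun j => Int.fract (s j) • Y j) atTop (𝓝 0) := by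
      refine squeeze_zero_norm (a := fun j => ‖Y j‖) (fun j => ?_) (by simpa using hY.norm)
      rw [norm_smul, Real.norm_of_nonneg (Int.fract_nonneg _)]
      exact mul_le_of_le_one_left (norm_nonneg _) (Int.fract_lt_one _).le
    have h3 := hs.sub h2
    rw [sub_zero] at h3
    refine h3.congr fun j => ?_
    rw [← sub_smul, Int.self_sub_fract]
  refine hG.mem_of_tendsto ((continuous_expUnit.tendsto Z).comp h1)
    (Eventually.of_forall fun j => ?_)
  simp only [Function.comp, Int.cast_smul_eq_zsmul, expUnit_zsmul]
  exact G.zpow_mem (hmem j) _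

theorem expUnit_smul_mem_of_tendsto (hG : IsClosed (G : Set 𝔸ˣ)) {Y : ℕ → 𝔸} {s : ℕ → ℝ} {Z : 𝔸}
    (hY : Tendsto Y atTop (𝓝 0)) (hs : Tendsto (fun j => s j • Y j) atTop (𝓝 Z))
    (hmem : ∀ j, expUnit (Y j) ∈ G) (t : ℝ) : expUnit (t • Z) ∈ G := by
  refine expUnit_mem_of_tendsto hG (s := fun j => t * s j) hY ?_ hmem
  simpa [mul_smul] using hs.const_smul t

/-- The curve $F(s)=\log(\exp(sx)\exp(sy))$ has derivative $x+y$ at $0$, so $(j+1)F(1/(j+1))\to x+y$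
while each $\exp F(1/(j+1))$ lies in $G$ for large $j$. The limit criterion above then applies. -/
theorem expUnit_smul_add_mem (hG : IsClosed (G : Set 𝔸ˣ)) {x y : 𝔸}
    (hx : ∀ t : ℝ, expUnit (t • x) ∈ G) (hy : ∀ t : ℝ, expUnit (t • y) ∈ G) (t : ℝ) :
    expUnit (t • (x + y)) ∈ G := by
  obtain ⟨X, hX, h0, hXs⟩ := exists_log ℝ 𝔸
  have hX0 : X 0 = 1 := by rw [hX, exp_zero]
  have h1t : (1 : 𝔸) ∈ X.target := hX0 ▸ X.map_source h0
  have hlog1 : X.symm 1 = 0 := by rw [← hX0, X.left_inv h0]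
  have hlog : HasFDerivAt X.symm (ContinuousLinearMap.id ℝ 𝔸) 1 := by
    have := X.hasFDerivAt_symm (f' := ContinuousLinearEquiv.refl ℝ 𝔸) h1t (by
      rw [hlog1, hX]; exact hasFDerivAt_exp_zero (𝕂 := ℝ))
    exact this
  set F : ℝ → 𝔸 := fun s => X.symm (exp (s • x) * exp (s • y)) with hF
  have hexp : ∀ z : 𝔸, HasDerivAt (fun s : ℝ => exp (s • z)) z 0 := fun z => by
    have h2 : HasDerivAt (fun s : ℝ => s • z) z 0 := by
      simpa using (hasDerivAt_id (0 : ℝ)).smul_const z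
    have h3 := hasFDerivAt_exp_comp h2.hasFDerivAt (by simp)
    simpa using h3.hasDerivAt
  have hFd : HasDerivAt F (x + y) 0 := by
    have h3 : HasDerivAt (fun s : ℝ => exp (s • x) * exp (s • y)) (x + y) 0 := by
      refine ((hexp x).mul (hexp y)).congr_deriv ?_
      simp
    have h4 := HasFDerivAt.comp_hasDerivAt (l := X.symm)
      (f := fun s : ℝ => exp (s • x) * exp (s • y)) (0 : ℝ) (by simpa using hlog) h3
    exact h4
  have hF0 : F 0 = 0 := by simp [hF, hlog1]
  have hs : Tendsto (fun j : ℕ => (1 : ℝ) / ((j : ℝ) + 1)) atTop (𝓝 0) :=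
    tendsto_one_div_add_atTop_nhds_zero_nat
  have hs' : Tendsto (fun j : ℕ => (1 : ℝ) / ((j : ℝ) + 1)) atTop (𝓝[≠] 0) :=
    tendsto_nhdsWithin_iff.2 ⟨hs, Eventually.of_forall fun j => by
      simp only [mem_compl_iff, mem_singleton_iff]; positivity⟩
  have hev : ∀ᶠ s in 𝓝 (0 : ℝ), expUnit (F s) ∈ G := by
    have hc : ContinuousAt (fun s : ℝ => exp (s • x) * exp (s • y)) 0 :=
      ((hexp x).continuousAt).mul (hexp y).continuousAt
    have : ∀ᶠ s in 𝓝 (0 : ℝ), exp (s • x) * exp (s • y) ∈ X.target :=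
      hc (by simpa using X.open_target.mem_nhds h1t)
    filter_upwards [this] with s hs
    have : expUnit (F s) = expUnit (s • x) * expUnit (s • y) := by
      refine Units.ext ?_
      rw [val_expUnit, Units.val_mul, val_expUnit, val_expUnit, ← hX, hF]
      exact (X.right_inv hs).trans (by rw [hX])
    rw [this]
    exact G.mul_mem (hx s) (hy s)
  obtain ⟨N, hN⟩ := eventually_atTop.1 (hs.eventually hev)
  have hsN : Tendsto (fun j : ℕ => (1 : ℝ) / (((j + N : ℕ) : ℝ) + 1)) atTop (𝓝 0) :=
    (tendsto_add_atTop_iff_nat N).2 hs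
  refine expUnit_smul_mem_of_tendsto hG (Y := fun j => F (1 / (((j + N : ℕ) : ℝ) + 1)))
    (s := fun j => ((j + N : ℕ) : ℝ) + 1) ?_ ?_ (fun j => hN _ (by omega)) t
  · have := hFd.continuousAt.tendsto.comp hsN
    rwa [hF0] at this
  · have h5 := hasDerivAt_iff_tendsto_slope.1 hFd
    have h6 := (tendsto_add_atTop_iff_nat N).2 (h5.comp hs')
    refine h6.congr fun j => ?_
    simp [slope, hF0, Function.comp]

/-- The Lie algebra of a closed subgroup of the units of a Banach algebra. -/
noncomputable def lie (G : Subgroup 𝔸ˣ) (hG : IsClosed (G : Set 𝔸ˣ)) : Submodule ℝ 𝔸 where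
  carrier := {x | ∀ t : ℝ, expUnit (t • x) ∈ G}
  add_mem' := fun hx hy => expUnit_smul_add_mem hG hx hy
  zero_mem' := fun t => by simp [G.one_mem]
  smul_mem' := fun c x hx t => by simpa [smul_smul] using hx (t * c)

theorem expUnit_mem_of_mem_lie {hG : IsClosed (G : Set 𝔸ˣ)} {x : 𝔸} (hx : x ∈ lie G hG) :
    expUnit x ∈ G := by simpa using hx 1

/-- **Closed subgroup theorem**: near the identity a closed subgroup consists of exponentials of
small elements of its Lie algebra. -/
theorem eventually_exists_expUnit_eq [FiniteDimensional ℝ 𝔸] (hG : IsClosed (G : Set 𝔸ˣ))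
    {U : Set 𝔸} (hU : U ∈ 𝓝 (0 : 𝔸)) :
    ∀ᶠ g in 𝓝 (1 : 𝔸ˣ), g ∈ G → ∃ x ∈ lie G hG, x ∈ U ∧ g = expUnit x := by
  obtain ⟨π, hπmem, hπid⟩ := exists_projection (lie G hG)
  -- A local diffeomorphism separating the component along the Lie algebra from the transversal one.
  set f : 𝔸 → 𝔸 := fun a => exp (π a) * exp (a - π a) with hf
  have hfc : ContDiff ℝ ω f :=
    ((contDiff_exp ℝ).comp π.contDiff).mul
      ((contDiff_exp ℝ).comp (contDiff_id.sub π.contDiff))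
  have hfd : HasFDerivAt f (ContinuousLinearMap.id ℝ 𝔸) 0 := by
    have h1 : HasFDerivAt (fun a => exp (π a)) π 0 :=
      hasFDerivAt_exp_comp π.hasFDerivAt (map_zero π)
    have h2 : HasFDerivAt (fun a => exp (a - π a)) (ContinuousLinearMap.id ℝ 𝔸 - π) 0 :=
      hasFDerivAt_exp_comp ((hasFDerivAt_id (𝕜 := ℝ) (0 : 𝔸)).sub π.hasFDerivAt) (by simp)
    have h3 := h1.mul' h2
    refine h3.congr_fderiv ?_
    ext a
    simp
  obtain ⟨X, hX, h0, -⟩ := exists_openPartialHomeomorph_of_hasFDerivAt_id hfc.contDiffAt hfd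
  have hX0 : X 0 = 1 := by simp [hX, hf]
  have h1t : (1 : 𝔸) ∈ X.target := hX0 ▸ X.map_source h0
  have hsymm1 : X.symm 1 = 0 := by rw [← hX0, X.left_inv h0]
  by_contra hcon
  rw [Filter.not_eventually] at hcon
  have : FirstCountableTopology 𝔸ˣ :=
    (Units.isOpenEmbedding_val (R := 𝔸)).isInducing.firstCountableTopology
  have hval : Tendsto (Units.val : 𝔸ˣ → 𝔸) (𝓝 1) (𝓝 1) := Units.continuous_val.tendsto 1
  have hsy : Tendsto X.symm (𝓝 1) (𝓝 0) := by
    simpa [hsymm1, ContinuousAt] using X.continuousAt_symm h1t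
  have htgt : ∀ᶠ g : 𝔸ˣ in 𝓝 1, (g : 𝔸) ∈ X.target ∧ π (X.symm g) ∈ U := by
    refine (hval.eventually (X.open_target.mem_nhds h1t)).and ?_
    have : Tendsto (fun g : 𝔸ˣ => π (X.symm g)) (𝓝 1) (𝓝 0) := by
      simpa [Function.comp_def] using (π.continuous.tendsto 0).comp (hsy.comp hval)
    exact this hU
  obtain ⟨g, hg, hgp⟩ := exists_seq_forall_of_frequently (hcon.and_eventually htgt)
  set a : ℕ → 𝔸 := fun j => X.symm (g j) with ha
  set b : ℕ → 𝔸 := fun j => a j - π (a j) with hb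
  have ha0 : Tendsto a atTop (𝓝 0) := hsy.comp (hval.comp hg)
  have hb0 : Tendsto b atTop (𝓝 0) := by
    have := ha0.sub ((π.continuous.tendsto 0).comp ha0)
    simpa using this
  have hgab : ∀ j, g j = expUnit (π (a j)) * expUnit (b j) := fun j => by
    refine Units.ext ?_
    have := X.right_inv (hgp j).2.1
    rw [hX] at this
    exact this.symm
  have hbG : ∀ j, expUnit (b j) ∈ G := fun j => by
    have h1 : g j ∈ G := by
      by_contra h; exact (hgp j).1 fun h' => absurd h' h
    have h2 := expUnit_mem_of_mem_lie (hπmem (a j))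
    rw [hgab j] at h1
    exact (G.mul_mem_cancel_left h2).1 h1
  have hbne : ∀ j, b j ≠ 0 := fun j hj => (hgp j).1 fun _ =>
    ⟨π (a j), hπmem _, (hgp j).2.2, by rw [hgab j, hj, expUnit_zero, mul_one]⟩
  have : ProperSpace 𝔸 := FiniteDimensional.proper ℝ 𝔸
  -- The transversal components `b j` are nonzero, tend to $0$ and exponentiate into $G$. A limit of
  -- their directions is a unit vector that lies in the Lie algebra, yet is killed by the projection
  -- onto it.
  obtain ⟨Z, hZ, φ, hφ, hlim⟩ := (isCompact_sphere (0 : 𝔸) 1).tendsto_subseq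
    (x := fun j => ‖b j‖⁻¹ • b j) (fun j => by
      simp [norm_smul, inv_mul_cancel₀ (norm_ne_zero_iff.2 (hbne j))])
  have hZlie : Z ∈ lie G hG := fun t =>
    expUnit_smul_mem_of_tendsto hG (hb0.comp hφ.tendsto_atTop) hlim (fun j => hbG _) t
  have hπb : ∀ j, π (b j) = 0 := fun j => by
    simp [hb, map_sub, hπid _ (hπmem (a j))]
  have hπZ : π Z = 0 := by
    refine tendsto_nhds_unique ((π.continuous.tendsto Z).comp hlim) ?_
    simp [Function.comp_def, hπb]
  rw [hπid Z hZlie] at hπZ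
  simp [hπZ] at hZ

end Real

end LinearAction

namespace LinearAction

open Filter Topology NormedSpace Set

/-! ### Norm estimates for the exponential near zero -/

section Estimates

variable {𝔸 : Type*} [NormedRing 𝔸] [NormedAlgebra ℝ 𝔸] [CompleteSpace 𝔸]

/-- Each power in the tail of the series is bounded by $\|x\|$, and the coefficients sum to
$e-2<3/4$. -/
theorem norm_exp_sub_one_sub_le {x : 𝔸} (hx : ‖x‖ ≤ 1) : ‖exp x - 1 - x‖ ≤ 3 / 4 * ‖x‖ := by
  have h1 : HasSum (fun n : ℕ => ((n + 2).factorial⁻¹ : ℝ) • x ^ (n + 2)) (exp x - 1 - x) := by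
    have := (hasSum_nat_add_iff' 2).2 (exp_series_hasSum_exp' (𝕂 := ℝ) x)
    simpa [Finset.sum_range_succ, sub_sub] using this
  have h2 : HasSum (fun n : ℕ => ((n + 2).factorial⁻¹ : ℝ)) (Real.exp 1 - 1 - 1) := by
    have := (hasSum_nat_add_iff' 2).2 (exp_series_hasSum_exp' (𝕂 := ℝ) (1 : ℝ))
    rw [← Real.exp_eq_exp_ℝ] at this
    simpa [Finset.sum_range_succ, sub_sub] using this
  have h3 := h2.mul_right ‖x‖
  have h4 : ‖exp x - 1 - x‖ ≤ (Real.exp 1 - 1 - 1) * ‖x‖ := by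
    rw [← h1.tsum_eq]
    refine tsum_of_norm_bounded h3 fun n => ?_
    rw [norm_smul, Real.norm_of_nonneg (by positivity)]
    gcongr
    calc ‖x ^ (n + 2)‖ ≤ ‖x‖ ^ (n + 2) := norm_pow_le' x (by omega)
      _ ≤ ‖x‖ ^ 1 := pow_le_pow_of_le_one (norm_nonneg _) hx (by omega)
      _ = ‖x‖ := pow_one _
  refine h4.trans (mul_le_mul_of_nonneg_right ?_ (norm_nonneg _))
  have := Real.exp_one_lt_d9
  linarith

/-- This is why the condition $|\zeta|<1$ in the tube is enough: inside the unit ball, $\exp\zeta$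
near $1$ forces $\zeta$ near $0$. -/
theorem norm_le_four_mul_norm_exp_sub_one {x : 𝔸} (hx : ‖x‖ ≤ 1) : ‖x‖ ≤ 4 * ‖exp x - 1‖ := by
  have h1 := norm_exp_sub_one_sub_le hx
  have h2 := norm_sub_norm_le x (exp x - 1)
  rw [norm_sub_rev x] at h2
  linarith

variable (𝔸) in
-- Serves to make $\{\zeta:\|\exp\zeta-1\|<\delta\}$ star-shaped near $0$. With $A=\exp(tx)-1$ and
-- $B=\exp x-1$, strict differentiability with constant $1/3$ gives $\|tB-A\|\le\frac23t(1-t)\|x\|$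
-- and $\|A\|\ge\frac23t\|x\|$. Hence $\|tB-A\|\le(1-t)\|A\|$, which yields $\|A\|\le\|B\|$.
theorem exists_norm_exp_smul_sub_one_le :
    ∃ ρ > 0, ∀ x : 𝔸, ‖x‖ < ρ → ∀ t : ℝ, 0 ≤ t → t ≤ 1 → ‖exp (t • x) - 1‖ ≤ ‖exp x - 1‖ := by
  have h := (hasStrictFDerivAt_exp_zero (𝕂 := ℝ) (𝔸 := 𝔸)).isLittleO.def
    (c := 1 / 3) (by norm_num)
  obtain ⟨ρ, hρ, hb⟩ := Metric.eventually_nhds_iff_ball.1 h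
  refine ⟨ρ, hρ, fun x hx t ht0 ht1 => ?_⟩
  have htx : ‖t • x‖ = t * ‖x‖ := by rw [norm_smul, Real.norm_of_nonneg ht0]
  have htx' : ‖t • x‖ < ρ := by
    rw [htx]; exact (mul_le_of_le_one_left (norm_nonneg _) ht1).trans_lt hx
  have h1 := hb (x, t • x) (by
    rw [← Prod.zero_eq_mk, mem_ball_zero_iff, Prod.norm_def]; exact max_lt hx htx')
  have h2 := hb (t • x, 0) (by
    rw [← Prod.zero_eq_mk, mem_ball_zero_iff, Prod.norm_def]; exact max_lt htx' (by simpa using hρ))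
  simp only [one_apply_eq_self, exp_zero, sub_zero] at h1 h2
  rw [htx] at h2
  have h3 : ‖x - t • x‖ = (1 - t) * ‖x‖ := by
    rw [show x - t • x = (1 - t) • x by rw [sub_smul, one_smul], norm_smul,
      Real.norm_of_nonneg (by linarith)]
  rw [h3] at h1
  rcases ht0.eq_or_lt with rfl | ht
  · simp
  set A := exp (t • x) - 1 with hA
  set B := exp x - 1 with hB
  have h4 : t • B - A = t • (exp x - exp (t • x) - (x - t • x)) - (1 - t) • (A - t • x) := by
    simp only [hA, hB]; module
  have h5 : ‖t • B - A‖ ≤ t * (1 / 3 * ((1 - t) * ‖x‖)) + (1 - t) * (1 / 3 * (t * ‖x‖)) := by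
    rw [h4]
    refine (norm_sub_le _ _).trans ?_
    rw [norm_smul, norm_smul, Real.norm_of_nonneg ht0, Real.norm_of_nonneg (by linarith)]
    gcongr
  have h6 : ‖A‖ ≤ t * ‖B‖ + ‖t • B - A‖ := by
    have := norm_sub_norm_le A (t • B)
    rw [norm_sub_rev A, norm_smul, Real.norm_of_nonneg ht0] at this
    linarith
  have h7 : t * ‖x‖ - ‖A‖ ≤ 1 / 3 * (t * ‖x‖) := by
    have := norm_sub_norm_le (t • x) A
    rw [norm_sub_rev (t • x), htx] at this
    linarith
  have h8 : (1 - t) * (2 / 3 * (t * ‖x‖)) ≤ (1 - t) * ‖A‖ :=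
    mul_le_mul_of_nonneg_left (by linarith) (by linarith)
  have h9 : t * ‖A‖ ≤ t * ‖B‖ := by nlinarith
  exact le_of_mul_le_mul_left h9 ht

end Estimates

/-! ### The complexified Lie algebra -/

section Complex

variable {𝔸 : Type*} [NormedRing 𝔸] [NormedAlgebra ℂ 𝔸] [CompleteSpace 𝔸] {G : Subgroup 𝔸ˣ}

/-- The complex span of the Lie algebra. -/
noncomputable def complexLie (G : Subgroup 𝔸ˣ) (hG : IsClosed (G : Set 𝔸ˣ)) : Submodule ℂ 𝔸 :=
  Submodule.span ℂ (lie G hG : Set 𝔸)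

theorem lie_subset_complexLie {hG : IsClosed (G : Set 𝔸ˣ)} {x : 𝔸} (hx : x ∈ lie G hG) :
    x ∈ complexLie G hG := Submodule.subset_span hx

theorem exists_add_I_smul_of_mem_complexLie {hG : IsClosed (G : Set 𝔸ˣ)} {ζ : 𝔸}
    (hζ : ζ ∈ complexLie G hG) : ∃ x ∈ lie G hG, ∃ y ∈ lie G hG, x + Complex.I • y = ζ := by
  induction hζ using Submodule.span_induction with
  | mem x hx => exact ⟨x, hx, 0, zero_mem _, by simp⟩
  | zero => exact ⟨0, zero_mem _, 0, zero_mem _, by simp⟩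
  | add _ _ _ _ h1 h2 =>
    obtain ⟨x, hx, y, hy, rfl⟩ := h1
    obtain ⟨x', hx', y', hy', rfl⟩ := h2
    exact ⟨x + x', add_mem hx hx', y + y', add_mem hy hy', by rw [smul_add]; abel⟩
  | smul c _ _ h =>
    obtain ⟨x, hx, y, hy, rfl⟩ := h
    refine ⟨c.re • x - c.im • y, sub_mem (Submodule.smul_mem _ _ hx) (Submodule.smul_mem _ _ hy),
      c.re • y + c.im • x, add_mem (Submodule.smul_mem _ _ hy) (Submodule.smul_mem _ _ hx), ?_⟩
    conv_rhs => rw [← Complex.re_add_im c]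
    simp only [← Complex.coe_smul]
    match_scalars
    · ring
    · linear_combination (-(c.im : ℂ)) * Complex.I_mul_I

variable [FiniteDimensional ℂ 𝔸]

/-- The sum $\mathfrak g+i\mathfrak g$ need not be direct here, so the components come from a linear
right inverse of $(x,y)\mapsto x+iy$, bounded by finite dimension. -/
theorem exists_bound_of_mem_complexLie (hG : IsClosed (G : Set 𝔸ˣ)) :
    ∃ C > 0, ∀ ζ ∈ complexLie G hG, ∃ x ∈ lie G hG, ∃ y ∈ lie G hG,
      x + Complex.I • y = ζ ∧ ‖x‖ ≤ C * ‖ζ‖ ∧ ‖y‖ ≤ C * ‖ζ‖ := by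
  have : FiniteDimensional ℝ 𝔸 := FiniteDimensional.complexToReal 𝔸
  let L : (lie G hG × lie G hG) →ₗ[ℝ] 𝔸 :=
    { toFun := fun p => (p.1 : 𝔸) + Complex.I • (p.2 : 𝔸)
      map_add' := fun p q => by simp; abel
      map_smul' := fun c p => by simp [smul_comm c Complex.I] }
  obtain ⟨ρ, hρ⟩ := L.rangeRestrict.exists_rightInverse_of_surjective L.range_rangeRestrict
  set ρ' := LinearMap.toContinuousLinearMap ρ with hρ'
  refine ⟨‖ρ'‖ + 1, by positivity, fun ζ hζ => ?_⟩
  have hr : ζ ∈ L.range := by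
    obtain ⟨x, hx, y, hy, h⟩ := exists_add_I_smul_of_mem_complexLie hζ
    exact ⟨(⟨x, hx⟩, ⟨y, hy⟩), h⟩
  have hle : ‖ρ' ⟨ζ, hr⟩‖ ≤ (‖ρ'‖ + 1) * ‖ζ‖ := by
    refine (ρ'.le_opNorm _).trans ?_
    rw [Submodule.coe_norm]
    gcongr
    linarith
  refine ⟨_, (ρ ⟨ζ, hr⟩).1.2, _, (ρ ⟨ζ, hr⟩).2.2, ?_, ?_, ?_⟩
  · have := congrArg Subtype.val (LinearMap.congr_fun hρ ⟨ζ, hr⟩)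
    exact this
  · exact (norm_fst_le (ρ' ⟨ζ, hr⟩)).trans hle
  · exact (norm_snd_le (ρ' ⟨ζ, hr⟩)).trans hle

/-- The local group property of the exponentials of the complexified Lie algebra, by analytic
continuation from the real group. -/
theorem eventually_exists_exp_mul_exp_eq (hG : IsClosed (G : Set 𝔸ˣ)) {U : Set 𝔸}
    (hU : U ∈ 𝓝 (0 : 𝔸)) :
    ∀ᶠ q : 𝔸 × 𝔸 in 𝓝 0, q.1 ∈ complexLie G hG → q.2 ∈ complexLie G hG →
      ∃ ζ ∈ complexLie G hG, ζ ∈ U ∧ exp q.1 * exp q.2 = exp ζ := by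
  have : FiniteDimensional ℝ 𝔸 := FiniteDimensional.complexToReal 𝔸
  obtain ⟨X, hX, h0, hXs⟩ := exists_log ℂ 𝔸
  obtain ⟨π, hπmem, hπid⟩ := exists_projection (complexLie G hG)
  have hX0 : X 0 = 1 := by rw [hX, exp_zero]
  have h1t : (1 : 𝔸) ∈ X.target := hX0 ▸ X.map_source h0
  have hlog1 : X.symm 1 = 0 := by rw [← hX0, X.left_inv h0]
  set m : 𝔸 × 𝔸 → 𝔸 := fun q => exp q.1 * exp q.2 with hm
  have hmd : ContDiff ℂ ω m :=
    ((contDiff_exp ℂ).comp contDiff_fst).mul ((contDiff_exp ℂ).comp contDiff_snd)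
  have hm0 : m 0 = 1 := by simp [hm]
  have hmt : Tendsto m (𝓝 0) (𝓝 1) := by simpa [hm0] using hmd.continuous.tendsto 0
  -- The part of $\log(\exp q_1\exp q_2)$ outside $\mathfrak g^c$. It vanishes for small real $q$ by
  -- the closed subgroup theorem.
  set f : 𝔸 × 𝔸 → 𝔸 := fun q => X.symm (m q) - π (X.symm (m q)) with hf
  have htgt : ∀ᶠ q in 𝓝 (0 : 𝔸 × 𝔸), m q ∈ X.target := hmt (X.open_target.mem_nhds h1t)
  have hreal : ∀ᶠ q in 𝓝 (0 : 𝔸 × 𝔸), q.1 ∈ lie G hG → q.2 ∈ lie G hG → f q = 0 := by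
    have h1 := eventually_exists_expUnit_eq hG (X.open_source.mem_nhds h0)
    have h2 : Tendsto (fun q : 𝔸 × 𝔸 => expUnit q.1 * expUnit q.2) (𝓝 0) (𝓝 1) := by
      have : Continuous (fun q : 𝔸 × 𝔸 => expUnit q.1 * expUnit q.2) :=
        (continuous_expUnit.comp continuous_fst).mul (continuous_expUnit.comp continuous_snd)
      simpa using this.tendsto 0
    filter_upwards [h2.eventually h1] with q hq h3 h4
    obtain ⟨Z, hZ, hZs, h5⟩ := hq (G.mul_mem (expUnit_mem_of_mem_lie h3)
      (expUnit_mem_of_mem_lie h4))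
    have h6 : m q = X Z := by rw [hX]; exact congrArg Units.val h5
    rw [hf]
    simp only
    rw [h6, X.left_inv hZs, hπid _ (lie_subset_complexLie hZ), sub_self]
  obtain ⟨r, hr, hb⟩ := Metric.eventually_nhds_iff_ball.1 (htgt.and hreal)
  obtain ⟨C, hC, hbd⟩ := exists_bound_of_mem_complexLie hG
  -- The factor 3 bounds $x+sy$ for $|s|<2$, with $\|x\|,\|y\|\le C\|q\|$.
  have hsmall : ∀ᶠ q in 𝓝 (0 : 𝔸 × 𝔸), ‖q‖ < r / (3 * C) := by
    have := Metric.ball_mem_nhds (0 : 𝔸 × 𝔸) (show 0 < r / (3 * C) by positivity)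
    filter_upwards [this] with q hq
    simpa using hq
  have hUs : ∀ᶠ q in 𝓝 (0 : 𝔸 × 𝔸), X.symm (m q) ∈ U := by
    have : Tendsto X.symm (𝓝 1) (𝓝 0) := by
      simpa [hlog1, ContinuousAt] using X.continuousAt_symm h1t
    exact (this.comp hmt) hU
  filter_upwards [hsmall, hUs, htgt] with q hq hqU hqt h1 h2
  obtain ⟨x₁, hx₁, y₁, hy₁, e₁, bx₁, by₁⟩ := hbd _ h1
  obtain ⟨x₂, hx₂, y₂, hy₂, e₂, bx₂, by₂⟩ := hbd _ h2
  -- A complex line with values in $\mathfrak g\times\mathfrak g$ for real $s$ and passing through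
  -- $q$ at $s=i$. The identity theorem on the disc of radius 2 carries the vanishing of `f` from
  -- the real points to $i$.
  set p : ℂ → 𝔸 × 𝔸 := fun s => (x₁ + s • y₁, x₂ + s • y₂) with hp
  have hpd : Differentiable ℂ p := by
    rw [hp]; fun_prop
  have hpb : ∀ s ∈ Metric.ball (0 : ℂ) 2, p s ∈ Metric.ball (0 : 𝔸 × 𝔸) r := by
    intro s hs
    rw [mem_ball_zero_iff] at hs ⊢
    have hq3 : 3 * (C * ‖q‖) < r := by
      rw [lt_div_iff₀ (by positivity)] at hq
      linarith
    have key : ∀ x y q' : 𝔸, ‖q'‖ ≤ ‖q‖ → ‖x‖ ≤ C * ‖q'‖ → ‖y‖ ≤ C * ‖q'‖ → ‖x + s • y‖ < r := by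
      intro x y q' hq' hx hy
      have h3 : C * ‖q'‖ ≤ C * ‖q‖ := by gcongr
      have h4 : ‖s‖ * ‖y‖ ≤ 2 * (C * ‖q‖) := by
        gcongr
        exact hy.trans h3
      calc ‖x + s • y‖ ≤ ‖x‖ + ‖s‖ * ‖y‖ := by
            refine (norm_add_le _ _).trans ?_
            rw [norm_smul]
        _ < r := by linarith
    rw [Prod.norm_def]
    exact max_lt (key _ _ _ (norm_fst_le q) bx₁ by₁) (key _ _ _ (norm_snd_le q) bx₂ by₂)
  have hfd : DifferentiableOn ℂ (fun s => f (p s)) (Metric.ball 0 2) := by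
    have h3 : DifferentiableOn ℂ (fun s => X.symm (m (p s))) (Metric.ball 0 2) :=
      ((hXs.differentiableOn (by simp)).comp
        ((hmd.differentiable (by simp)).comp hpd).differentiableOn
        fun s hs => (hb _ (hpb s hs)).1)
    exact h3.sub (π.differentiable.comp_differentiableOn h3)
  have hfa := hfd.analyticOnNhd Metric.isOpen_ball
  have hfreq : ∃ᶠ z in 𝓝[≠] (0 : ℂ), f (p z) = 0 := by
    have h3 : Tendsto (fun t : ℝ => (t : ℂ)) (𝓝[≠] 0) (𝓝[≠] 0) := by
      refine tendsto_nhdsWithin_iff.2 ⟨?_, ?_⟩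
      · have := (Complex.continuous_ofReal.tendsto 0).mono_left
          (nhdsWithin_le_nhds (s := {(0 : ℝ)}ᶜ))
        simpa using this
      · filter_upwards [self_mem_nhdsWithin] with t ht
        simpa using ht
    have h4 : ∀ᶠ t : ℝ in 𝓝[≠] 0, f (p (t : ℂ)) = 0 := by
      have : ∀ᶠ t in 𝓝[≠] (0 : ℝ), t ∈ Metric.ball (0 : ℝ) 2 :=
        nhdsWithin_le_nhds (Metric.ball_mem_nhds _ (by norm_num))
      filter_upwards [this] with t ht
      refine (hb _ (hpb t ?_)).2 ?_ ?_
      · simpa using ht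
      · simp only [hp, Complex.coe_smul]
        exact add_mem hx₁ (Submodule.smul_mem _ _ hy₁)
      · simp only [hp, Complex.coe_smul]
        exact add_mem hx₂ (Submodule.smul_mem _ _ hy₂)
    exact h3.frequently h4.frequently
  have hzero := hfa.eqOn_zero_of_preconnected_of_frequently_eq_zero
    (convex_ball _ _).isPreconnected (Metric.mem_ball_self (by norm_num)) hfreq
  have hI : f (p Complex.I) = 0 := hzero (by simp)
  have hpI : p Complex.I = q := by simp [hp, e₁, e₂]
  rw [hpI] at hI
  refine ⟨X.symm (m q), ?_, hqU, ?_⟩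
  · rw [sub_eq_zero.1 hI]
    exact hπmem _
  · rw [← hX, X.right_inv hqt, hX]

end Complex

end LinearAction

namespace LinearAction

open Filter Topology NormedSpace Set

/-! ### The group generated by the exponentials of the complexified Lie algebra -/

section Complex

variable {𝔸 : Type*} [NormedRing 𝔸] [NormedAlgebra ℂ 𝔸] [CompleteSpace 𝔸]
  [FiniteDimensional ℂ 𝔸] {G : Subgroup 𝔸ˣ}

theorem eventually_exists_expUnit_eq_val (hG : IsClosed (G : Set 𝔸ˣ)) {U : Set 𝔸}
    (hU : U ∈ 𝓝 (0 : 𝔸)) :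
    ∀ᶠ a in 𝓝 (1 : 𝔸), ∀ g ∈ G, (g : 𝔸) = a → ∃ x ∈ lie G hG, x ∈ U ∧ g = expUnit x := by
  have : FiniteDimensional ℝ 𝔸 := FiniteDimensional.complexToReal 𝔸
  have h1 := eventually_exists_expUnit_eq hG hU
  have h2 := (Units.isOpenEmbedding_val (R := 𝔸)).map_nhds_eq 1
  rw [Units.val_one] at h2
  rw [← h2, eventually_map]
  filter_upwards [h1] with g hg g' hg' he
  obtain rfl := Units.ext he
  exact hg hg'

theorem exists_radius_exp_mul_exp_eq (hG : IsClosed (G : Set 𝔸ˣ)) {ε : ℝ} (hε : 0 < ε) :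
    ∃ r > 0, ∀ ζ₁ ∈ complexLie G hG, ∀ ζ₂ ∈ complexLie G hG, ‖ζ₁‖ < r → ‖ζ₂‖ < r →
      ∃ ζ ∈ complexLie G hG, ‖ζ‖ < ε ∧ expUnit ζ₁ * expUnit ζ₂ = expUnit ζ := by
  obtain ⟨r, hr, hb⟩ := Metric.eventually_nhds_iff_ball.1
    (eventually_exists_exp_mul_exp_eq hG (Metric.ball_mem_nhds (0 : 𝔸) hε))
  refine ⟨r, hr, fun ζ₁ h₁ ζ₂ h₂ hn₁ hn₂ => ?_⟩
  obtain ⟨ζ, hζ, hζε, h⟩ := hb (ζ₁, ζ₂) (by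
    rw [mem_ball_zero_iff, Prod.norm_def]; exact max_lt hn₁ hn₂) h₁ h₂
  exact ⟨ζ, hζ, by simpa using hζε, Units.ext h⟩

/-- The subgroup generated by the exponentials of the complexified Lie algebra. -/
noncomputable def expGroup (G : Subgroup 𝔸ˣ) (hG : IsClosed (G : Set 𝔸ˣ)) : Subgroup 𝔸ˣ :=
  Subgroup.closure {p | ∃ ζ ∈ complexLie G hG, p = expUnit ζ}

/-- Four factors appear when a product of two exponentials is divided by an approximating product of
two others. -/
theorem exists_radius_four_exp (hG : IsClosed (G : Set 𝔸ˣ)) :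
    ∃ r > 0, ∀ ζ₁ ∈ complexLie G hG, ∀ ζ₂ ∈ complexLie G hG, ∀ ζ₃ ∈ complexLie G hG,
      ∀ ζ₄ ∈ complexLie G hG, ‖ζ₁‖ < r → ‖ζ₂‖ < r → ‖ζ₃‖ < r → ‖ζ₄‖ < r →
      ∃ ζ ∈ complexLie G hG, ‖ζ‖ < 1 ∧
        expUnit ζ₁ * expUnit ζ₂ * (expUnit ζ₃ * expUnit ζ₄) = expUnit ζ := by
  obtain ⟨r₁, hr₁, h₁⟩ := exists_radius_exp_mul_exp_eq hG one_pos
  obtain ⟨r₂, hr₂, h₂⟩ := exists_radius_exp_mul_exp_eq hG hr₁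
  refine ⟨r₂, hr₂, fun a ha b hb c hc d hd na nb nc nd => ?_⟩
  obtain ⟨x, hx, nx, ex⟩ := h₂ a ha b hb na nb
  obtain ⟨y, hy, ny, ey⟩ := h₂ c hc d hd nc nd
  rw [ex, ey]
  exact h₁ x hx y hy nx ny

/-- The group generated by the exponentials is a countable union of translates of any small
exponential ball. -/
theorem exists_countable_translates (hG : IsClosed (G : Set 𝔸ˣ)) {r : ℝ} (hr : 0 < r)
    (h4 : ∀ ζ₁ ∈ complexLie G hG, ∀ ζ₂ ∈ complexLie G hG, ∀ ζ₃ ∈ complexLie G hG,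
      ∀ ζ₄ ∈ complexLie G hG, ‖ζ₁‖ < r → ‖ζ₂‖ < r → ‖ζ₃‖ < r → ‖ζ₄‖ < r →
      ∃ ζ ∈ complexLie G hG, ‖ζ‖ < 1 ∧
        expUnit ζ₁ * expUnit ζ₂ * (expUnit ζ₃ * expUnit ζ₄) = expUnit ζ) :
    ∃ A : Set 𝔸ˣ, A.Countable ∧ ∀ p ∈ expGroup G hG,
      ∃ a ∈ A, ∃ ζ ∈ complexLie G hG, ‖ζ‖ < r ∧ p = a * expUnit ζ := by
  have : ProperSpace 𝔸 := FiniteDimensional.proper ℂ 𝔸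
  -- The countably many translates are the finite words in exponentials of a countable dense set.
  obtain ⟨D, hDc, hDd⟩ := TopologicalSpace.exists_countable_dense (complexLie G hG)
  have := hDc.to_subtype
  set w : List D → 𝔸ˣ := fun l => (l.map fun d => expUnit ((d : complexLie G hG) : 𝔸)).prod with hw
  have hwa : ∀ l (d : D), w (l ++ [d]) = w l * expUnit ((d : complexLie G hG) : 𝔸) := by
    intro l d
    simp [hw]
  have step : ∀ l : List D, ∀ ζ₁ ∈ complexLie G hG, ∀ ζ₂ ∈ complexLie G hG, ‖ζ₁‖ < r → ‖ζ₂‖ < r →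
      ∃ l', ∃ ζ ∈ complexLie G hG, ‖ζ‖ < r ∧
        w l * expUnit ζ₁ * expUnit ζ₂ = w l' * expUnit ζ := by
    intro l ζ₁ h₁ ζ₂ h₂ n₁ n₂
    set f : complexLie G hG × complexLie G hG → 𝔸 := fun q =>
      exp (-(q.2 : 𝔸)) * exp (-(q.1 : 𝔸)) * (exp ζ₁ * exp ζ₂) with hf
    have hfc : Continuous f := by
      have hc : Continuous (exp : 𝔸 → 𝔸) := continuous_exp'
      fun_prop
    have hf1 : f (⟨ζ₁, h₁⟩, ⟨ζ₂, h₂⟩) = 1 := by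
      have : f (⟨ζ₁, h₁⟩, ⟨ζ₂, h₂⟩) =
          ((expUnit (-ζ₂) * expUnit (-ζ₁) * (expUnit ζ₁ * expUnit ζ₂) : 𝔸ˣ) : 𝔸) := rfl
      rw [this, expUnit_neg, expUnit_neg]
      have h : (expUnit ζ₂)⁻¹ * (expUnit ζ₁)⁻¹ * (expUnit ζ₁ * expUnit ζ₂) = 1 := by group
      rw [h, Units.val_one]
    -- The remainder after division by a word from `D` is $\exp\zeta$ with $\|\zeta\|<1$. The bound
    -- $\|\zeta\|\le4\|\exp\zeta-1\|$ explains $r/4$ and returns the remainder to the ball of radius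
    -- $r$.
    set O : Set (complexLie G hG × complexLie G hG) :=
      {q | ‖f q - 1‖ < r / 4 ∧ ‖q.1‖ < r ∧ ‖q.2‖ < r} with hO
    have hOo : IsOpen O :=
      (isOpen_lt (hfc.sub continuous_const).norm continuous_const).inter
        ((isOpen_lt continuous_fst.norm continuous_const).inter
          (isOpen_lt continuous_snd.norm continuous_const))
    obtain ⟨q, hq, hqD⟩ := (hDd.prod hDd).inter_open_nonempty O hOo
      ⟨(⟨ζ₁, h₁⟩, ⟨ζ₂, h₂⟩), by rw [hf1]; simpa using hr, n₁, n₂⟩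
    obtain ⟨ζ, hζ, nζ, e⟩ := h4 (-q.2) (neg_mem q.2.2) (-q.1) (neg_mem q.1.2) ζ₁ h₁ ζ₂ h₂
      (by rw [norm_neg]; exact hq.2.2) (by rw [norm_neg]; exact hq.2.1) n₁ n₂
    refine ⟨l ++ [⟨q.1, hqD.1⟩] ++ [⟨q.2, hqD.2⟩], ζ, hζ, ?_, ?_⟩
    · have h1 := norm_le_four_mul_norm_exp_sub_one nζ.le
      have h2 : exp ζ = f q := congrArg Units.val e.symm
      rw [h2] at h1
      have := hq.1
      linarith
    · rw [hwa, hwa, ← e, expUnit_neg, expUnit_neg]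
      group
  have steps : ∀ k : ℕ, ∀ l : List D, ∀ ζ₁ ∈ complexLie G hG, ∀ ζ₂ ∈ complexLie G hG,
      ‖ζ₁‖ < r → ‖ζ₂‖ < r → ∃ l', ∃ ζ ∈ complexLie G hG, ‖ζ‖ < r ∧
        w l * expUnit ζ₁ * expUnit ζ₂ ^ k = w l' * expUnit ζ := by
    intro k
    induction k with
    | zero => exact fun l ζ₁ h₁ _ _ n₁ _ => ⟨l, ζ₁, h₁, n₁, by simp⟩
    | succ k ih =>
      intro l ζ₁ h₁ ζ₂ h₂ n₁ n₂
      obtain ⟨l', ζ, hζ, nζ, e⟩ := step l ζ₁ h₁ ζ₂ h₂ n₁ n₂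
      obtain ⟨l'', ζ', hζ', nζ', e'⟩ := ih l' ζ hζ ζ₂ h₂ nζ n₂
      exact ⟨l'', ζ', hζ', nζ', by rw [pow_succ', ← mul_assoc, e, e']⟩
  have big : ∀ l : List D, ∀ ζ₁ ∈ complexLie G hG, ∀ ζ₂ ∈ complexLie G hG, ‖ζ₁‖ < r →
      ∃ l', ∃ ζ ∈ complexLie G hG, ‖ζ‖ < r ∧
        w l * expUnit ζ₁ * expUnit ζ₂ = w l' * expUnit ζ := by
    intro l ζ₁ h₁ ζ₂ h₂ n₁
    -- An arbitrary exponential is a power of one with exponent of norm less than $r$.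
    obtain ⟨k, hk⟩ := exists_nat_gt (‖ζ₂‖ / r)
    have hk0 : (0 : ℝ) < k := lt_of_le_of_lt (by positivity) hk
    have hmem : ((k : ℝ)⁻¹ • ζ₂) ∈ complexLie G hG := by
      rw [← Complex.coe_smul]
      exact Submodule.smul_mem _ _ h₂
    have hpow : expUnit ζ₂ = expUnit ((k : ℝ)⁻¹ • ζ₂) ^ k := by
      rw [← expUnit_nsmul, ← Nat.cast_smul_eq_nsmul ℝ, smul_smul, mul_inv_cancel₀ hk0.ne',
        one_smul]
    rw [hpow]
    refine steps k l ζ₁ h₁ _ hmem n₁ ?_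
    rw [norm_smul, norm_inv, Real.norm_of_nonneg hk0.le, inv_mul_lt_iff₀ hk0]
    rwa [div_lt_iff₀ hr] at hk
  refine ⟨range w, countable_range w, fun p hp => ?_⟩
  suffices ∃ l, ∃ ζ ∈ complexLie G hG, ‖ζ‖ < r ∧ p = w l * expUnit ζ by
    obtain ⟨l, ζ, h⟩ := this
    exact ⟨w l, mem_range_self l, ζ, h⟩
  induction hp using Subgroup.closure_induction_right with
  | one => exact ⟨[], 0, zero_mem _, by simpa using hr, by simp [hw]⟩
  | mul_right x hx y hy ih =>
    obtain ⟨l, ζ₁, h₁, n₁, rfl⟩ := ih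
    obtain ⟨ζ₂, h₂, rfl⟩ := hy
    exact big l ζ₁ h₁ ζ₂ h₂ n₁
  | mul_inv_cancel x hx y hy ih =>
    obtain ⟨l, ζ₁, h₁, n₁, rfl⟩ := ih
    obtain ⟨ζ₂, h₂, rfl⟩ := hy
    rw [← expUnit_neg]
    exact big l ζ₁ h₁ _ (neg_mem h₂) n₁

/-- If the group generated by the exponentials of the complexified Lie algebra is closed, its
elements near the identity are exponentials of small elements. -/
theorem exists_exp_of_mem_expGroup (hG : IsClosed (G : Set 𝔸ˣ))
    (hcl : IsClosed (expGroup G hG : Set 𝔸ˣ)) :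
    ∃ δ > 0, ∀ p ∈ expGroup G hG, ‖(p : 𝔸) - 1‖ < δ →
      ∃ ζ ∈ complexLie G hG, ‖ζ‖ < 1 ∧ p = expUnit ζ := by
  have : ProperSpace 𝔸 := FiniteDimensional.proper ℂ 𝔸
  obtain ⟨r, hr, h4⟩ := exists_radius_four_exp hG
  have h4' : ∀ ζ₁ ∈ complexLie G hG, ∀ ζ₂ ∈ complexLie G hG, ∀ ζ₃ ∈ complexLie G hG,
      ∀ ζ₄ ∈ complexLie G hG, ‖ζ₁‖ < r / 2 → ‖ζ₂‖ < r / 2 → ‖ζ₃‖ < r / 2 → ‖ζ₄‖ < r / 2 →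
      ∃ ζ ∈ complexLie G hG, ‖ζ‖ < 1 ∧
        expUnit ζ₁ * expUnit ζ₂ * (expUnit ζ₃ * expUnit ζ₄) = expUnit ζ :=
    fun a ha b hb c hc d hd na nb nc nd =>
      h4 a ha b hb c hc d hd (by linarith) (by linarith) (by linarith) (by linarith)
  obtain ⟨A, hAc, hA⟩ := exists_countable_translates hG (half_pos hr) h4'
  have : LocallyCompactSpace 𝔸ˣ := (Units.isOpenEmbedding_val (R := 𝔸)).locallyCompactSpace
  have : LocallyCompactSpace (expGroup G hG) := hcl.isClosedEmbedding_subtypeVal.locallyCompactSpace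
  have : Countable A := hAc.to_subtype
  set K : Set 𝔸ˣ := expUnit '' ((complexLie G hG : Set 𝔸) ∩ Metric.closedBall 0 (r / 2)) with hK
  have hKc : IsCompact K :=
    ((isCompact_closedBall _ _).inter_left
      (Submodule.closed_of_finiteDimensional (complexLie G hG))).image continuous_expUnit
  have hc : ∀ a : A, IsClosed {p : expGroup G hG | (a : 𝔸ˣ)⁻¹ * p ∈ K} := fun a =>
    hKc.isClosed.preimage (continuous_const.mul continuous_subtype_val)
  have hU : ⋃ a : A, {p : expGroup G hG | (a : 𝔸ˣ)⁻¹ * p ∈ K} = univ := by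
    refine eq_univ_of_forall fun p => mem_iUnion.2 ?_
    obtain ⟨a, ha, ζ, hζ, nζ, e⟩ := hA p p.2
    refine ⟨⟨a, ha⟩, ζ, ⟨hζ, by simpa using nζ.le⟩, ?_⟩
    rw [e]
    simp
  -- Baire: some translate of the compact exponential ball has interior in the closed, hence locally
  -- compact, group.
  obtain ⟨a, ⟨p₀, hp₀⟩⟩ := nonempty_interior_of_iUnion_of_closed hc hU
  have hev : ∀ᶠ p : expGroup G hG in 𝓝 1, (a : 𝔸ˣ)⁻¹ * ((p₀ * p : expGroup G hG) : 𝔸ˣ) ∈ K := by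
    have ht : Tendsto (fun p : expGroup G hG => p₀ * p) (𝓝 1) (𝓝 p₀) := by
      have : Continuous (fun p : expGroup G hG => p₀ * p) := continuous_const.mul continuous_id
      simpa using this.tendsto 1
    exact ht (mem_interior_iff_mem_nhds.1 hp₀)
  obtain ⟨ζ₀, ⟨hζ₀, nζ₀⟩, e₀⟩ := interior_subset hp₀
  have hemb : Topology.IsInducing (fun p : expGroup G hG => ((p : 𝔸ˣ) : 𝔸)) :=
    (Units.isOpenEmbedding_val (R := 𝔸)).isInducing.comp Topology.IsInducing.subtypeVal
  rw [hemb.nhds_eq_comap, eventually_comap] at hev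
  obtain ⟨δ, hδ, hb⟩ := Metric.eventually_nhds_iff.1 hev
  refine ⟨δ, hδ, fun p hp hpδ => ?_⟩
  obtain ⟨ζ₁, ⟨hζ₁, nζ₁⟩, e₁⟩ := hb (y := (p : 𝔸)) (by simpa [dist_eq_norm] using hpδ) ⟨p, hp⟩ rfl
  rw [mem_closedBall_zero_iff] at nζ₀ nζ₁
  -- Here $p=(a^{-1}p_0)^{-1}(a^{-1}p_0p)=\exp(-\zeta_0)\exp\zeta_1$; the two other factors are
  -- padding.
  obtain ⟨ζ, hζ, nζ, e⟩ := h4 0 (zero_mem _) 0 (zero_mem _) (-ζ₀) (neg_mem hζ₀) ζ₁ hζ₁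
    (by simpa using hr) (by simpa using hr) (by rw [norm_neg]; linarith) (by linarith)
  refine ⟨ζ, hζ, nζ, ?_⟩
  rw [← e, expUnit_neg, e₀, e₁]
  simp

end Complex

end LinearAction

/-! ### Representations with an equivariant map to the algebra, and charts at the base point -/

namespace LinearAction

open Filter Topology NormedSpace Set

/-- A representation of a Banach algebra on a vector space, analytic but possibly nonlinear in the
algebra variable, with an equivariant linear map onto the algebra and a point over `1`. -/
structure FramedRep (𝔸 V : Type*) [NormedRing 𝔸] [NormedAlgebra ℂ 𝔸] [NormedAddCommGroup V]
    [NormedSpace ℂ V] where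
  /-- the operators of the representation -/
  R : 𝔸 → V →L[ℂ] V
  /-- the equivariant map -/
  P : V →L[ℂ] 𝔸
  /-- the base point -/
  z₀ : V
  R_one : ∀ v, R 1 v = v
  R_mul : ∀ a b v, R (a * b) v = R a (R b v)
  contDiff_R : ContDiff ℂ ω fun q : 𝔸 × V => R q.1 q.2
  P_R : ∀ a v, P (R a v) = a * P v
  P_z₀ : P z₀ = 1

/-- The neighbourhood of `G` consisting of the products `g exp ζ` with small `ζ` in the
complexified Lie algebra. -/
def expTube {𝔸 : Type*} [NormedRing 𝔸] [NormedAlgebra ℂ 𝔸] [CompleteSpace 𝔸] (G : Subgroup 𝔸ˣ)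
    (hG : IsClosed (G : Set 𝔸ˣ)) (δ : ℝ) : Set 𝔸 :=
  {h | ∃ g ∈ G, ∃ ζ ∈ complexLie G hG, ‖ζ‖ < 1 ∧ ‖exp ζ - 1‖ < δ ∧ h = (g : 𝔸) * exp ζ}

namespace FramedRep

variable {𝔸 V : Type*} [NormedRing 𝔸] [NormedAlgebra ℂ 𝔸] [NormedAddCommGroup V] [NormedSpace ℂ V]

variable (𝔸) in
/-- Left multiplication. -/
noncomputable def leftMul : FramedRep 𝔸 𝔸 where
  R := ContinuousLinearMap.mul ℂ 𝔸
  P := ContinuousLinearMap.id ℂ 𝔸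
  z₀ := 1
  R_one := fun v => one_mul v
  R_mul := fun a b v => mul_assoc a b v
  contDiff_R := contDiff_fst.mul contDiff_snd
  P_R := fun _ _ => rfl
  P_z₀ := rfl

variable (F : FramedRep 𝔸 V)

/-- The derivative of the orbit map of the base point. -/
noncomputable def σ : 𝔸 →L[ℂ] V := fderiv ℂ (fun a => F.R a F.z₀) 1

theorem differentiable_R : Differentiable ℂ fun q : 𝔸 × V => F.R q.1 q.2 :=
  F.contDiff_R.differentiable (by simp)

theorem continuous_R : Continuous fun q : 𝔸 × V => F.R q.1 q.2 := F.contDiff_R.continuous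

theorem hasFDerivAt_σ : HasFDerivAt (fun a => F.R a F.z₀) F.σ 1 := by
  have : Differentiable ℂ (fun a => F.R a F.z₀) :=
    F.differentiable_R.comp (differentiable_id.prodMk (differentiable_const F.z₀))
  exact (this 1).hasFDerivAt

-- Differentiate $P(R(a)z_0)=a$ at $a=1$.
@[simp] theorem P_σ (a : 𝔸) : F.P (F.σ a) = a := by
  have h1 : HasFDerivAt (fun a => F.P (F.R a F.z₀)) (F.P.comp F.σ) 1 :=
    F.P.hasFDerivAt.comp (1 : 𝔸) F.hasFDerivAt_σ
  have h2 : (fun a => F.P (F.R a F.z₀)) = id := by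
    funext a
    rw [F.P_R, F.P_z₀, mul_one, id]
  rw [h2] at h1
  have := h1.unique (hasFDerivAt_id (1 : 𝔸))
  exact DFunLike.congr_fun this a

theorem hasFDerivAt_R : HasFDerivAt (fun q : 𝔸 × V => F.R q.1 q.2)
    (F.σ.comp (ContinuousLinearMap.fst ℂ 𝔸 V) + ContinuousLinearMap.snd ℂ 𝔸 V) (1, F.z₀) := by
  have h := (F.differentiable_R (1, F.z₀)).hasFDerivAt
  refine h.congr_fderiv ?_
  refine ContinuousLinearMap.ext fun q => ?_
  set D := fderiv ℂ (fun q : 𝔸 × V => F.R q.1 q.2) (1, F.z₀) with hD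
  have h1 : ∀ a, D (a, 0) = F.σ a := fun a => by
    have h2 : HasFDerivAt (fun a : 𝔸 => (a, F.z₀)) (ContinuousLinearMap.inl ℂ 𝔸 V) 1 :=
      hasFDerivAt_prodMk_left 1 F.z₀
    have h3 : HasFDerivAt (fun a => F.R a F.z₀) (D.comp (ContinuousLinearMap.inl ℂ 𝔸 V)) 1 :=
      HasFDerivAt.comp (g := fun q : 𝔸 × V => F.R q.1 q.2) (f := fun a : 𝔸 => (a, F.z₀)) 1 h h2
    exact DFunLike.congr_fun (h3.unique F.hasFDerivAt_σ) a
  have h2 : ∀ v, D (0, v) = v := fun v => by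
    have h2 : HasFDerivAt (fun v : V => ((1 : 𝔸), v)) (ContinuousLinearMap.inr ℂ 𝔸 V) F.z₀ :=
      hasFDerivAt_prodMk_right 1 F.z₀
    have h3 := h.comp F.z₀ h2
    have h4 : ((fun q : 𝔸 × V => F.R q.1 q.2) ∘ fun v : V => ((1 : 𝔸), v)) = id := by
      funext v
      exact F.R_one v
    rw [h4] at h3
    exact DFunLike.congr_fun (h3.unique (hasFDerivAt_id F.z₀)) v
  have h3 : q = (q.1, 0) + (0, q.2) := by simp
  conv_lhs => rw [h3]
  rw [map_add, h1, h2]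
  rfl

/-- The map whose local inverse gives coordinates around the base point. -/
noncomputable def χ (π : 𝔸 →L[ℂ] 𝔸) (v : V) : V :=
  F.R (exp (π (F.P v))) (F.z₀ + (v - F.σ (π (F.P v))))

theorem P_χ (π : 𝔸 →L[ℂ] 𝔸) (v : V) :
    F.P (F.χ π v) = exp (π (F.P v)) * (1 + (F.P v - π (F.P v))) := by
  rw [χ, F.P_R, map_add, F.P_z₀, map_sub, P_σ]

/-- The map $\pi\circ P$ reads $\zeta$ off $\sigma\zeta+\kappa$. For a projection $\pi$ onto
$\mathfrak g^c$, this uses the splitting of $V$ into $\sigma(\mathfrak g^c)$ and $\ker(\pi\circ P)$.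
-/
theorem χ_σ_add {π : 𝔸 →L[ℂ] 𝔸} {ζ : 𝔸} {κ : V} (hζ : π ζ = ζ) (hκ : π (F.P κ) = 0) :
    F.χ π (F.σ ζ + κ) = F.R (exp ζ) (F.z₀ + κ) := by
  have : π (F.P (F.σ ζ + κ)) = ζ := by rw [map_add, map_add, P_σ, hζ, hκ, add_zero]
  rw [χ, this, add_sub_cancel_left]

variable [CompleteSpace 𝔸]

theorem contDiff_χ (π : 𝔸 →L[ℂ] 𝔸) : ContDiff ℂ ω (F.χ π) := by
  have h1 : ContDiff ℂ ω fun v => exp (π (F.P v)) :=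
    (contDiff_exp ℂ).comp (π.contDiff.comp F.P.contDiff)
  have h2 : ContDiff ℂ ω fun v => F.z₀ + (v - F.σ (π (F.P v))) :=
    contDiff_const.add (contDiff_id.sub (F.σ.contDiff.comp (π.contDiff.comp F.P.contDiff)))
  exact F.contDiff_R.comp (h1.prodMk h2)

/-- The derivative of the exponential factor contributes $\sigma\pi P$, which cancels the term
subtracted in the second argument. -/
theorem hasFDerivAt_χ (π : 𝔸 →L[ℂ] 𝔸) :
    HasFDerivAt (F.χ π) (ContinuousLinearMap.id ℂ V) 0 := by
  have h1 : HasFDerivAt (fun v => exp (π (F.P v))) (π.comp F.P) 0 :=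
    hasFDerivAt_exp_comp (π.comp F.P).hasFDerivAt (by simp)
  have h2 : HasFDerivAt (fun v => F.z₀ + (v - F.σ (π (F.P v))))
      (ContinuousLinearMap.id ℂ V - F.σ.comp (π.comp F.P)) 0 :=
    ((hasFDerivAt_id (𝕜 := ℂ) (0 : V)).sub (F.σ.comp (π.comp F.P)).hasFDerivAt).const_add F.z₀
  have h4 : HasFDerivAt (fun q : 𝔸 × V => F.R q.1 q.2)
      (F.σ.comp (ContinuousLinearMap.fst ℂ 𝔸 V) + ContinuousLinearMap.snd ℂ 𝔸 V)
      (exp (π (F.P 0)), F.z₀ + ((0 : V) - F.σ (π (F.P 0)))) := by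
    simpa using F.hasFDerivAt_R
  have h5 := h4.comp (0 : V) (h1.prodMk h2)
  refine h5.congr_fderiv ?_
  ext v
  simp

/-- If $R(g\exp\zeta)(z_0+\kappa)=\chi(v)$, applying $P$ and solving for $g$ gives this expression
at $(v,\exp\zeta,\kappa)$. Thus $g$ is forced to be near $1$. -/
theorem tendsto_core (π : 𝔸 →L[ℂ] 𝔸) :
    Tendsto (fun q : V × 𝔸 × V => exp (π (F.P q.1)) * (1 + (F.P q.1 - π (F.P q.1))) *
      Ring.inverse (q.2.1 * (1 + F.P q.2.2))) (𝓝 (0, 1, 0)) (𝓝 1) := by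
  have hc : Continuous (exp : 𝔸 → 𝔸) := (contDiff_exp ℂ).continuous
  have h1 : Continuous fun q : V × 𝔸 × V =>
      exp (π (F.P q.1)) * (1 + (F.P q.1 - π (F.P q.1))) := by fun_prop
  have h2 : Continuous fun q : V × 𝔸 × V => q.2.1 * (1 + F.P q.2.2) := by fun_prop
  have h3 : ContinuousAt Ring.inverse (1 : 𝔸) := NormedRing.inverse_continuousAt (1 : 𝔸ˣ)
  have h4 : Tendsto (fun q : V × 𝔸 × V => q.2.1 * (1 + F.P q.2.2)) (𝓝 (0, 1, 0)) (𝓝 1) := by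
    simpa using h2.tendsto (0, 1, 0)
  have h5 := h3.tendsto.comp h4
  have h6 := (h1.tendsto (0, 1, 0)).mul h5
  simpa using h6

variable {G : Subgroup 𝔸ˣ}

/-- Coordinates near the base point, in which the points `g exp ζ (z₀ + κ)` with `g` in the group
and `ζ`, `κ` small have coordinate `σ ζ' + κ`, where `g exp ζ = exp ζ'`. -/
structure IsChart (hG : IsClosed (G : Set 𝔸ˣ)) (π : 𝔸 →L[ℂ] 𝔸) (X : OpenPartialHomeomorph V V)
    (ρ : ℝ) : Prop where
  π_mem : ∀ a, π a ∈ complexLie G hG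
  π_id : ∀ a ∈ complexLie G hG, π a = a
  coe_eq : (X : V → V) = F.χ π
  contDiffOn_symm : ContDiffOn ℂ ω X.symm X.target
  isUnit : ∀ κ, ‖κ‖ < ρ → IsUnit (1 + F.P κ)
  mem_source : ∀ ζ ∈ complexLie G hG, ‖ζ‖ < 1 → ‖exp ζ - 1‖ < ρ → ∀ κ, ‖κ‖ < ρ →
    F.σ ζ + κ ∈ X.source
  eq_of_eq : ∀ g ∈ G, ∀ ζ ∈ complexLie G hG, ‖ζ‖ < 1 → ‖exp ζ - 1‖ < ρ →
    ∀ κ, π (F.P κ) = 0 → ‖κ‖ < ρ →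
    ∀ v ∈ X.source, F.R (g * exp ζ) (F.z₀ + κ) = X v →
      ∃ ζ' ∈ complexLie G hG, (g : 𝔸) * exp ζ = exp ζ' ∧ v = F.σ ζ' + κ

variable {F} in
theorem IsChart.mono {hG : IsClosed (G : Set 𝔸ˣ)} {π : 𝔸 →L[ℂ] 𝔸}
    {X : OpenPartialHomeomorph V V} {ρ ρ' : ℝ} (h : F.IsChart hG π X ρ) (hρ : ρ' ≤ ρ) :
    F.IsChart hG π X ρ' where
  π_mem := h.π_mem
  π_id := h.π_id
  coe_eq := h.coe_eq
  contDiffOn_symm := h.contDiffOn_symm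
  isUnit := fun κ hκ => h.isUnit κ (hκ.trans_le hρ)
  mem_source := fun ζ hζ nζ hδ κ hκ => h.mem_source ζ hζ nζ (hδ.trans_le hρ) κ (hκ.trans_le hρ)
  eq_of_eq := fun g hg ζ hζ nζ hδ κ hκ nκ =>
    h.eq_of_eq g hg ζ hζ nζ (hδ.trans_le hρ) κ hκ (nκ.trans_le hρ)

variable [FiniteDimensional ℂ 𝔸] [FiniteDimensional ℂ V]

/-- The element $g$ in `eq_of_eq` is arbitrary in $G$. Applying $P$ puts it near $1$, so it is $\exp
x$ with $x\in\mathfrak g$ small; then $g\exp\zeta=\exp\zeta'$ by the local group property, and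
injectivity of $\chi$ near $0$ identifies $v$. -/
theorem exists_isChart (hG : IsClosed (G : Set 𝔸ˣ)) {π : 𝔸 →L[ℂ] 𝔸}
    (hπ : ∀ a, π a ∈ complexLie G hG) (hπid : ∀ a ∈ complexLie G hG, π a = a) :
    ∃ X : OpenPartialHomeomorph V V, ∃ ρ > 0, F.IsChart hG π X ρ := by
  have : CompleteSpace V := FiniteDimensional.complete ℂ V
  obtain ⟨X, hX, h0, hXs⟩ := exists_openPartialHomeomorph_of_hasFDerivAt_id (𝕜 := ℂ)
    (F.contDiff_χ π).contDiffAt (F.hasFDerivAt_χ π)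
  obtain ⟨r₀, hr₀, hXr⟩ := Metric.mem_nhds_iff.1 (X.open_source.mem_nhds h0)
  have hσ : ∀ ε > 0, ∃ s > 0, ∀ ζ : 𝔸, ‖ζ‖ < s → ‖F.σ ζ‖ < ε := fun ε hε => by
    have : Tendsto F.σ (𝓝 0) (𝓝 0) := by simpa using F.σ.continuous.tendsto 0
    simpa [Metric.tendsto_nhds_nhds, dist_eq_norm] using Metric.tendsto_nhds_nhds.1 this ε hε
  obtain ⟨s, hs, hsσ⟩ := hσ (r₀ / 2) (by positivity)
  obtain ⟨r₁, hr₁, hloc⟩ := exists_radius_exp_mul_exp_eq hG hs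
  have hB : ∀ᶠ a in 𝓝 (1 : 𝔸), ∀ g ∈ G, (g : 𝔸) = a →
      ∃ x ∈ lie G hG, ‖x‖ < r₁ ∧ g = expUnit x := by
    simpa using eventually_exists_expUnit_eq_val hG (Metric.ball_mem_nhds (0 : 𝔸) hr₁)
  have hcore := (F.tendsto_core π).eventually hB
  have hunit : ∀ᶠ q : V × 𝔸 × V in 𝓝 (0, 1, 0), IsUnit (1 + F.P q.2.2) := by
    have h1 : Continuous fun q : V × 𝔸 × V => 1 + F.P q.2.2 := by fun_prop
    exact h1.continuousAt.eventually_mem (Units.isOpen.mem_nhds (by simp))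
  obtain ⟨ρ₁, hρ₁, hb⟩ := Metric.eventually_nhds_iff_ball.1 (hcore.and hunit)
  have hb' : ∀ v p κ, ‖v‖ < ρ₁ → ‖p - 1‖ < ρ₁ → ‖κ‖ < ρ₁ → (v, p, κ) ∈
      Metric.ball ((0, 1, 0) : V × 𝔸 × V) ρ₁ := fun v p κ hv hp hκ => by
    rw [mem_ball_iff_norm]
    simp only [Prod.mk_sub_mk, sub_zero, Prod.norm_def]
    exact max_lt hv (max_lt hp hκ)
  set r := min ρ₁ r₀ with hr
  have hrpos : 0 < r := lt_min hρ₁ hr₀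
  obtain ⟨s', hs', hsσ'⟩ := hσ (r / 2) (by positivity)
  -- The quarters come from $\|\zeta\|\le4\|\exp\zeta-1\|$; the half leaves room for $\sigma\zeta$
  -- and $\kappa$ in one ball.
  set ρ := min (r / 2) (min (r₁ / 4) (s' / 4)) with hρ
  have hρpos : 0 < ρ := by positivity
  have hρr : ρ ≤ r / 2 := min_le_left _ _
  have hρr₁ : ρ ≤ r₁ / 4 := (min_le_right _ _).trans (min_le_left _ _)
  have hρs' : ρ ≤ s' / 4 := (min_le_right _ _).trans (min_le_right _ _)
  have hrρ₁ : r ≤ ρ₁ := min_le_left _ _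
  have hrr₀ : r ≤ r₀ := min_le_right _ _
  refine ⟨X.restrOpen (Metric.ball 0 r) Metric.isOpen_ball, ρ, hρpos,
    hπ, hπid, hX, ?_, ?_, ?_, ?_⟩
  · refine hXs.mono fun y hy => ?_
    have := hy
    simp at this
    exact this.1
  · exact fun κ hκ => (hb _ (hb' 0 1 κ (by simpa using hρ₁) (by simpa using hρ₁)
      (by linarith))).2
  · intro ζ hζ nζ nδ κ nκ
    have h1 := norm_le_four_mul_norm_exp_sub_one nζ.le
    have h2 := hsσ' ζ (by linarith)
    have h3 : ‖F.σ ζ + κ‖ < r := (norm_add_le _ _).trans_lt (by linarith)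
    rw [OpenPartialHomeomorph.restrOpen_source]
    exact ⟨hXr (by rw [mem_ball_zero_iff]; linarith), by simpa using h3⟩
  · intro g hg ζ hζ nζ nδ κ hκ nκ v hv he
    rw [OpenPartialHomeomorph.restrOpen_source, mem_inter_iff, mem_ball_zero_iff] at hv
    replace he : F.R (g * exp ζ) (F.z₀ + κ) = X v := he
    obtain ⟨hB', hu⟩ := hb _ (hb' v (exp ζ) κ (by linarith) (by linarith) (by linarith))
    have hu' : IsUnit (exp ζ * (1 + F.P κ)) := (expUnit ζ).isUnit.mul hu
    have hP : (g : 𝔸) * (exp ζ * (1 + F.P κ)) =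
        exp (π (F.P v)) * (1 + (F.P v - π (F.P v))) := by
      rw [← F.P_χ π v, ← hX, ← he, F.P_R, map_add, F.P_z₀, mul_assoc]
    obtain ⟨x, hx, nx, hgx⟩ := hB' g hg (by
      simp only
      rw [← hP, mul_assoc, Ring.mul_inverse_cancel _ hu', mul_one])
    have nζ' := norm_le_four_mul_norm_exp_sub_one nζ.le
    obtain ⟨ζ', hζ', nζ's, e⟩ := hloc x (lie_subset_complexLie hx) ζ hζ nx (by linarith)
    have e' : (g : 𝔸) * exp ζ = exp ζ' := by
      rw [hgx]; exact congrArg Units.val e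
    refine ⟨ζ', hζ', e', ?_⟩
    -- Only membership in the unrestricted source is needed, where $\chi$ is already injective.
    have hw : F.σ ζ' + κ ∈ X.source := hXr (by
      rw [mem_ball_zero_iff]
      have := hsσ ζ' nζ's
      exact (norm_add_le _ _).trans_lt (by linarith))
    refine X.injOn hv.1 hw ?_
    rw [← he, hX, F.χ_σ_add (hπid _ hζ') hκ, e']

end FramedRep

end LinearAction

namespace LinearAction

open Filter Topology NormedSpace Set

/-! ### The tube is connected and a complex submanifold -/

section Tube

variable {𝔸 : Type*} [NormedRing 𝔸] [NormedAlgebra ℂ 𝔸] [CompleteSpace 𝔸] {G : Subgroup 𝔸ˣ}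

/-- The tube is the image of $G\times Z$ with $Z$ star-shaped about $0$. For $\delta<\rho/4$ all
elements of $Z$ have norm below $\rho$, as the monotonicity estimate requires. -/
theorem isConnected_expTube (hG : IsClosed (G : Set 𝔸ˣ)) (hconn : IsConnected (G : Set 𝔸ˣ)) :
    ∃ δ₀ > 0, ∀ δ, 0 < δ → δ < δ₀ → IsConnected (expTube G hG δ) := by
  obtain ⟨ρ, hρ, hmono⟩ := exists_norm_exp_smul_sub_one_le 𝔸
  refine ⟨ρ / 4, by positivity, fun δ hδ hδρ => ?_⟩
  set Z : Set 𝔸 := {ζ | ζ ∈ complexLie G hG ∧ ‖ζ‖ < 1 ∧ ‖exp ζ - 1‖ < δ} with hZ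
  have hstar : StarConvex ℝ 0 Z := by
    rw [starConvex_zero_iff]
    intro ζ hζ t ht0 ht1
    have h1 := norm_le_four_mul_norm_exp_sub_one hζ.2.1.le
    refine ⟨?_, ?_, ?_⟩
    · rw [← Complex.coe_smul]; exact Submodule.smul_mem _ _ hζ.1
    · rw [norm_smul, Real.norm_of_nonneg ht0]
      exact (mul_le_of_le_one_left (norm_nonneg _) ht1).trans_lt hζ.2.1
    · exact (hmono ζ (by linarith [hζ.2.2]) t ht0 ht1).trans_lt hζ.2.2
  have hZc : IsConnected Z :=
    (hstar.isPathConnected (by exact ⟨zero_mem _, by simp, by simpa using hδ⟩)).isConnected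
  have himg : expTube G hG δ = (fun q : 𝔸ˣ × 𝔸 => (q.1 : 𝔸) * exp q.2) '' ((G : Set 𝔸ˣ) ×ˢ Z) := by
    ext h
    constructor
    · rintro ⟨g, hg, ζ, h1, h2, h3, rfl⟩
      exact ⟨(g, ζ), ⟨hg, h1, h2, h3⟩, rfl⟩
    · rintro ⟨⟨g, ζ⟩, ⟨hg, h1, h2, h3⟩, rfl⟩
      exact ⟨g, hg, ζ, h1, h2, h3, rfl⟩
  rw [himg]
  refine (hconn.prod hZc).image _ (Continuous.continuousOn ?_)
  exact (Units.continuous_val.comp continuous_fst).mul (continuous_exp'.comp continuous_snd)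

theorem isUnit_of_mem_expTube {hG : IsClosed (G : Set 𝔸ˣ)} {δ : ℝ} {h : 𝔸}
    (hh : h ∈ expTube G hG δ) : IsUnit h := by
  obtain ⟨g, -, ζ, -, -, -, rfl⟩ := hh
  exact g.isUnit.mul (expUnit ζ).isUnit

theorem mul_mem_expTube {hG : IsClosed (G : Set 𝔸ˣ)} {δ : ℝ} {g : 𝔸ˣ} (hg : g ∈ G) {h : 𝔸}
    (hh : h ∈ expTube G hG δ) : (g : 𝔸) * h ∈ expTube G hG δ := by
  obtain ⟨g', hg', ζ, h1, h2, h3, rfl⟩ := hh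
  exact ⟨g * g', G.mul_mem hg hg', ζ, h1, h2, h3, by rw [Units.val_mul, mul_assoc]⟩

/-- For left multiplication $P$ and $\sigma$ are the identity, so the chart with $\kappa=0$ is a
logarithm adapted to $\mathfrak g^c$. By `eq_of_eq` no other part of the tube enters it outside
$\mathfrak g^c$; translation by $g_0$ reaches every point. -/
theorem isSubmanifold_expTube [FiniteDimensional ℂ 𝔸] (hG : IsClosed (G : Set 𝔸ˣ)) :
    ∃ δ₀ > 0, ∀ δ, δ < δ₀ →
      IsSubmanifold ℂ (Module.finrank ℂ (complexLie G hG)) (expTube G hG δ) := by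
  set F := FramedRep.leftMul 𝔸 with hF
  obtain ⟨π, hπ, hπid⟩ := exists_projection (complexLie G hG)
  obtain ⟨X, ρ, hρ, hc⟩ := F.exists_isChart hG hπ hπid
  have hσ : ∀ a, F.σ a = a := F.P_σ
  refine ⟨ρ, hρ, fun δ hδ x hx => ?_⟩
  obtain ⟨g₀, hg₀, ζ₀, hζ₀, nζ₀, dζ₀, rfl⟩ := hx
  have hXexp : ∀ ζ ∈ complexLie G hG, X ζ = exp ζ := fun ζ hζ => by
    have := F.χ_σ_add (hπid ζ hζ) (κ := 0) (by simp)
    rw [hσ, add_zero, add_zero] at this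
    rw [hc.coe_eq, this]
    exact mul_one _
  -- Makes every coordinate vector in $\mathfrak g^c$ come from a point of the tube.
  set O : Set 𝔸 := {v | ‖v‖ < 1 ∧ ‖exp v - 1‖ < δ} with hO
  have hOo : IsOpen O := (isOpen_lt continuous_norm continuous_const).inter
    (isOpen_lt (continuous_exp'.sub continuous_const).norm continuous_const)
  have hsrc : ζ₀ ∈ X.source := by
    have := hc.mem_source ζ₀ hζ₀ nζ₀ (dζ₀.trans hδ) 0 (by simpa using hρ)
    rwa [hσ, add_zero] at this
  set X₁ := X.restrOpen O hOo with hX₁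
  have hX₁s : X₁.source = X.source ∩ O := rfl
  have hX₁c : (X₁ : 𝔸 → 𝔸) = X := rfl
  have hX₁t : X₁.target ⊆ X.target := fun y hy => by
    have h1 := X₁.map_target hy
    rw [← X₁.right_inv hy]
    exact X.map_source h1.1
  have hX₁d : ContDiffOn ℂ ω X₁.symm X₁.target := hc.contDiffOn_symm.mono hX₁t
  refine ⟨(Homeomorph.smul g₀⁻¹).transOpenPartialHomeomorph X₁.symm, ?_, ?_, ?_,
    complexLie G hG, rfl, ?_⟩
  · have h1 : X₁ ζ₀ ∈ X₁.target := X₁.map_source ⟨hsrc, nζ₀, dζ₀⟩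
    rw [hX₁c, hXexp _ hζ₀] at h1
    simpa [Units.smul_def] using h1
  · refine ContDiffOn.of_le (n := ω) ?_ (by simp)
    refine hX₁d.comp (t := X₁.target) (ContDiff.contDiffOn ?_) fun y hy => by simpa using hy
    exact contDiff_const.mul contDiff_id
  · refine ContDiffOn.of_le (n := ω) ?_ (by simp)
    have h1 : ContDiff ℂ ω fun v => (g₀ : 𝔸) * X v := by
      rw [hc.coe_eq]; exact contDiff_const.mul (F.contDiff_χ π)
    refine h1.contDiffOn.congr fun v _ => ?_
    simp [Units.smul_def, hX₁c]
  · intro y hy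
    replace hy : (g₀⁻¹ : 𝔸ˣ) • y ∈ X₁.target := by simpa using hy
    change _ ↔ X₁.symm ((g₀⁻¹ : 𝔸ˣ) • y) ∈ complexLie G hG
    set v := X₁.symm ((g₀⁻¹ : 𝔸ˣ) • y) with hv
    have hvs : v ∈ X.source ∩ O := X₁.map_target hy
    have hXv : X v = ((g₀⁻¹ : 𝔸ˣ) : 𝔸) * y := X₁.right_inv hy
    constructor
    · rintro ⟨g, hg, ζ, hζ, nζ, dζ, rfl⟩
      obtain ⟨ζ', hζ', -, hvζ⟩ := hc.eq_of_eq (g₀⁻¹ * g) (G.mul_mem (G.inv_mem hg₀) hg) ζ hζ nζ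
        (dζ.trans hδ) 0 (by simp) (by simpa using hρ) v hvs.1 (by
          rw [hXv, add_zero, Units.val_mul, mul_assoc]
          exact mul_one _)
      rw [hvζ, hσ, add_zero]
      exact hζ'
    · intro hvL
      refine ⟨g₀, hg₀, v, hvL, hvs.2.1, hvs.2.2, ?_⟩
      rw [← hXexp v hvL, hXv, Units.mul_inv_cancel_left]

end Tube

/-! ### The model map from the product of tube and ball -/

namespace FramedRep

variable {𝔸 V B : Type*} [NormedRing 𝔸] [NormedAlgebra ℂ 𝔸] [NormedAddCommGroup V]
  [NormedSpace ℂ V] [NormedAddCommGroup B] [NormedSpace ℂ B] (F : FramedRep 𝔸 V)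

/-- The equivariant map parametrizing a neighbourhood of the orbit of the base point. -/
noncomputable def model (ℓ : B →L[ℂ] V) (q : 𝔸 × B) : V := F.R q.1 (F.z₀ + ℓ q.2)

theorem differentiable_model (ℓ : B →L[ℂ] V) : Differentiable ℂ (F.model ℓ) :=
  F.differentiable_R.comp (differentiable_fst.prodMk
    ((ℓ.differentiable.comp differentiable_snd).const_add _))

theorem model_mul (ℓ : B →L[ℂ] V) (a h : 𝔸) (b : B) :
    F.model ℓ (a * h, b) = F.R a (F.model ℓ (h, b)) := F.R_mul _ _ _

theorem P_model (ℓ : B →L[ℂ] V) (q : 𝔸 × B) : F.P (F.model ℓ q) = q.1 * (1 + F.P (ℓ q.2)) := by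
  rw [model, F.P_R, map_add, F.P_z₀]

/-- Linear coordinates on a small ball of a complement. -/
structure IsSlice (π : 𝔸 →L[ℂ] 𝔸) (ρ : ℝ) (ℓ : B →L[ℂ] V) (ℓ' : V →L[ℂ] B) : Prop where
  left_inv : ∀ b, ℓ' (ℓ b) = b
  π_P : ∀ b, π (F.P (ℓ b)) = 0
  right_inv : ∀ κ, π (F.P κ) = 0 → ℓ (ℓ' κ) = κ
  norm_lt : ∀ b, ‖b‖ < 1 → ‖ℓ b‖ < ρ

variable {F} [CompleteSpace 𝔸] {G : Subgroup 𝔸ˣ} {hG : IsClosed (G : Set 𝔸ˣ)}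
  {π : 𝔸 →L[ℂ] 𝔸} {X : OpenPartialHomeomorph V V} {ρ δ : ℝ} {ℓ : B →L[ℂ] V} {ℓ' : V →L[ℂ] B}

theorem isUnit_P_model (hc : F.IsChart hG π X ρ) (hs : F.IsSlice π ρ ℓ ℓ') {q : 𝔸 × B}
    (hq : q ∈ expTube G hG δ ×ˢ Metric.ball 0 1) : IsUnit (F.P (F.model ℓ q)) := by
  rw [P_model]
  exact (isUnit_of_mem_expTube hq.1).mul
    (hc.isUnit _ (hs.norm_lt _ (by simpa using hq.2)))

/-- The local inverses of the model map. -/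
theorem exists_local_inverse (hc : F.IsChart hG π X ρ) (hs : F.IsSlice π ρ ℓ ℓ') (hδ : δ ≤ ρ)
    {q₀ : 𝔸 × B} (hq₀ : q₀ ∈ expTube G hG δ ×ˢ Metric.ball 0 1) :
    ∃ U : Set V, IsOpen U ∧ F.model ℓ q₀ ∈ U ∧ ∃ inv : V → 𝔸 × B, DifferentiableOn ℂ inv U ∧
      (∀ q ∈ expTube G hG δ ×ˢ Metric.ball 0 1, F.model ℓ q ∈ U → inv (F.model ℓ q) = q) ∧
      F.model ℓ '' (expTube G hG δ ×ˢ Metric.ball 0 1) ∈ 𝓝 (F.model ℓ q₀) := by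
  obtain ⟨h₀, b₀⟩ := q₀
  obtain ⟨⟨g₀, hg₀, ζ₀, hζ₀, nζ₀, dζ₀, rfl⟩, hb₀⟩ := hq₀
  simp only [mem_ball_zero_iff] at hb₀
  set A : V →L[ℂ] V := F.R ((g₀⁻¹ : 𝔸ˣ) : 𝔸) with hA
  set A' : V →L[ℂ] V := F.R (g₀ : 𝔸) with hA'
  have hAA' : ∀ v, A' (A v) = v := fun v => by
    rw [hA, hA', ← F.R_mul, Units.mul_inv, F.R_one]
  have hA'A : ∀ v, A (A' v) = v := fun v => by
    rw [hA, hA', ← F.R_mul, Units.inv_mul, F.R_one]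
  set U : Set V := A ⁻¹' X.target with hU
  have hUo : IsOpen U := X.open_target.preimage A.continuous
  -- Undo $g_0$ and take chart coordinates: the component along $\sigma(\mathfrak g^c)$ gives the
  -- tube factor, the remainder in $\ker(\pi\circ P)$ the ball factor.
  set inv : V → 𝔸 × B := fun y =>
    ((g₀ : 𝔸) * exp (π (F.P (X.symm (A y)))),
      ℓ' (X.symm (A y) - F.σ (π (F.P (X.symm (A y)))))) with hinv
  have hsd : DifferentiableOn ℂ (fun y => X.symm (A y)) U :=
    (hc.contDiffOn_symm.differentiableOn (by simp)).comp A.differentiable.differentiableOn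
      fun y hy => hy
  have hexp : Differentiable ℂ (exp : 𝔸 → 𝔸) := (contDiff_exp ℂ).differentiable (by simp)
  have hd : DifferentiableOn ℂ inv U := by
    have h1 : DifferentiableOn ℂ (fun y => exp (π (F.P (X.symm (A y))))) U :=
      hexp.comp_differentiableOn ((π.comp F.P).differentiable.comp_differentiableOn hsd)
    have h2 : DifferentiableOn ℂ (fun y => F.σ (π (F.P (X.symm (A y))))) U :=
      (F.σ.comp (π.comp F.P)).differentiable.comp_differentiableOn hsd
    exact ((differentiable_const (g₀ : 𝔸)).differentiableOn.mul h1).prodMk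
      (ℓ'.differentiable.comp_differentiableOn (hsd.sub h2))
  have hπσ : ∀ ζ ∈ complexLie G hG, ∀ b, π (F.P (F.σ ζ + ℓ b)) = ζ := fun ζ hζ b => by
    rw [map_add, map_add, F.P_σ, hc.π_id ζ hζ, hs.π_P, add_zero]
  have hleft : ∀ q ∈ expTube G hG δ ×ˢ Metric.ball (0 : B) 1, F.model ℓ q ∈ U →
      inv (F.model ℓ q) = q := by
    rintro ⟨h, b⟩ ⟨⟨g, hg, ζ, hζ, nζ, dζ, rfl⟩, hb⟩ hqU
    simp only [mem_ball_zero_iff] at hb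
    set v := X.symm (A (F.model ℓ ((g : 𝔸) * exp ζ, b))) with hv
    have hvs : v ∈ X.source := X.map_target hqU
    have hXv : X v = A (F.model ℓ ((g : 𝔸) * exp ζ, b)) := X.right_inv hqU
    obtain ⟨ζ', hζ', e, hvζ⟩ := hc.eq_of_eq (g₀⁻¹ * g) (G.mul_mem (G.inv_mem hg₀) hg) ζ hζ nζ
      (dζ.trans_le hδ) (ℓ b) (hs.π_P b) (hs.norm_lt b hb) v hvs (by
        rw [hXv, hA, ← F.model_mul, model, Units.val_mul, mul_assoc])
    simp only [hinv]
    rw [← hv, hvζ, hπσ ζ' hζ' b, add_sub_cancel_left, hs.left_inv, ← e, Units.val_mul, mul_assoc,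
      Units.mul_inv_cancel_left]
  have hv₀ : F.σ ζ₀ + ℓ b₀ ∈ X.source :=
    hc.mem_source ζ₀ hζ₀ nζ₀ (dζ₀.trans_le hδ) _ (hs.norm_lt b₀ hb₀)
  have hXv₀ : X (F.σ ζ₀ + ℓ b₀) = A (F.model ℓ ((g₀ : 𝔸) * exp ζ₀, b₀)) := by
    rw [hc.coe_eq, F.χ_σ_add (hc.π_id _ hζ₀) (hs.π_P b₀), model_mul, ← hA', hA'A, model]
  have hmemU : F.model ℓ ((g₀ : 𝔸) * exp ζ₀, b₀) ∈ U := by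
    rw [hU, mem_preimage, ← hXv₀]
    exact X.map_source hv₀
  refine ⟨U, hUo, hmemU, inv, hd, hleft, ?_⟩
  have hcont : ContinuousAt (fun y => X.symm (A y)) (F.model ℓ ((g₀ : 𝔸) * exp ζ₀, b₀)) :=
    hsd.continuousOn.continuousAt (hUo.mem_nhds hmemU)
  have hval : X.symm (A (F.model ℓ ((g₀ : 𝔸) * exp ζ₀, b₀))) = F.σ ζ₀ + ℓ b₀ := by
    rw [← hXv₀, X.left_inv hv₀]
  -- Open conditions under which the candidate preimage lies in tube times ball; they make the image
  -- a neighbourhood.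
  set O : Set V := {v | ‖π (F.P v)‖ < 1 ∧ ‖exp (π (F.P v)) - 1‖ < δ ∧
    ‖ℓ' (v - F.σ (π (F.P v)))‖ < 1} with hO
  have hOo : IsOpen O := by
    have hec := hexp.continuous
    have h1 : Continuous fun v => ‖π (F.P v)‖ := by fun_prop
    have h2 : Continuous fun v => ‖exp (π (F.P v)) - 1‖ := by fun_prop
    have h3 : Continuous fun v => ‖ℓ' (v - F.σ (π (F.P v)))‖ := by fun_prop
    exact (isOpen_lt h1 continuous_const).inter
      ((isOpen_lt h2 continuous_const).inter (isOpen_lt h3 continuous_const))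
  have hO₀ : F.σ ζ₀ + ℓ b₀ ∈ O := by
    refine ⟨?_, ?_, ?_⟩
    · rwa [hπσ ζ₀ hζ₀]
    · rwa [hπσ ζ₀ hζ₀]
    · rwa [hπσ ζ₀ hζ₀, add_sub_cancel_left, hs.left_inv]
  have hev : ∀ᶠ y in 𝓝 (F.model ℓ ((g₀ : 𝔸) * exp ζ₀, b₀)), X.symm (A y) ∈ O :=
    hcont.eventually_mem (by rw [hval]; exact hOo.mem_nhds hO₀)
  filter_upwards [hev, hUo.mem_nhds hmemU] with y hyO hyU
  set v := X.symm (A y) with hv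
  have hXv : X v = A y := X.right_inv hyU
  refine ⟨((g₀ : 𝔸) * exp (π (F.P v)), ℓ' (v - F.σ (π (F.P v)))), ⟨⟨g₀, hg₀, _, hc.π_mem _, hyO.1,
    hyO.2.1, rfl⟩, by simpa using hyO.2.2⟩, ?_⟩
  have hker : π (F.P (v - F.σ (π (F.P v)))) = 0 := by
    rw [map_sub, map_sub, F.P_σ, hc.π_id _ (hc.π_mem _), sub_self]
  rw [model_mul, model, hs.right_inv _ hker, ← hA']
  have : F.R (exp (π (F.P v))) (F.z₀ + (v - F.σ (π (F.P v)))) = X v := by rw [hc.coe_eq]; rfl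
  rw [this, hXv, hAA']

/-- The local inverse at $q$ recovers every point of the product whose image falls in its domain,
even one far from $q$, so injectivity is global. -/
theorem injOn_model (hc : F.IsChart hG π X ρ) (hs : F.IsSlice π ρ ℓ ℓ') (hδ : δ ≤ ρ) :
    InjOn (F.model ℓ) (expTube G hG δ ×ˢ Metric.ball 0 1) := by
  intro q hq q' hq' h
  obtain ⟨U, -, hU, inv, -, hinv, -⟩ := exists_local_inverse hc hs hδ hq
  rw [← hinv q hq hU, h, hinv q' hq' (h ▸ hU)]

theorem isOpen_image_model (hc : F.IsChart hG π X ρ) (hs : F.IsSlice π ρ ℓ ℓ') (hδ : δ ≤ ρ) :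
    IsOpen (F.model ℓ '' (expTube G hG δ ×ˢ Metric.ball 0 1)) := by
  refine isOpen_iff_mem_nhds.2 ?_
  rintro _ ⟨q, hq, rfl⟩
  obtain ⟨U, -, -, inv, -, -, h⟩ := exists_local_inverse hc hs hδ hq
  exact h

/-- The model map as a bijection onto its image. -/
noncomputable def modelEquiv (hc : F.IsChart hG π X ρ) (hs : F.IsSlice π ρ ℓ ℓ') (hδ : δ ≤ ρ) :
    (expTube G hG δ ×ˢ Metric.ball (0 : B) 1 : Set (𝔸 × B)) ≃
      F.model ℓ '' (expTube G hG δ ×ˢ Metric.ball 0 1) :=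
  Equiv.Set.imageOfInjOn _ _ (injOn_model hc hs hδ)

theorem isBiholomorphic_modelEquiv (hc : F.IsChart hG π X ρ) (hs : F.IsSlice π ρ ℓ ℓ')
    (hδ : δ ≤ ρ) : IsBiholomorphic (modelEquiv hc hs hδ) := by
  refine ⟨fun x => ⟨univ, isOpen_univ, mem_univ _, F.model ℓ,
    (F.differentiable_model ℓ).differentiableOn, fun y _ => rfl⟩, ?_⟩
  rintro ⟨_, q, hq, rfl⟩
  obtain ⟨U, hUo, hU, inv, hd, hinv, -⟩ := exists_local_inverse hc hs hδ hq
  refine ⟨U, hUo, hU, inv, hd, ?_⟩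
  intro y hy
  obtain ⟨x, rfl⟩ := (modelEquiv hc hs hδ).surjective y
  rw [Equiv.symm_apply_apply]
  exact hinv x x.2 hy

end FramedRep

end LinearAction

/-! ### Orbits and properties of the restricted action -/

namespace LinearAction

open Filter Topology NormedSpace Set

theorem mem_of_hasDerivAt {E : Type*} [NormedAddCommGroup E] [NormedSpace ℝ E]
    [FiniteDimensional ℝ E] {S : Submodule ℝ E} {f : ℝ → E} {f' : E} {t : ℝ}
    (hf : HasDerivAt f f' t) (hS : ∀ s, f s ∈ S) : f' ∈ S := by
  obtain ⟨q, hq, hqid⟩ := exists_projection S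
  have h1 := q.hasFDerivAt.comp_hasDerivAt t hf
  have h2 : (q ∘ f) = f := funext fun s => hqid _ (hS s)
  rw [h2] at h1
  rw [hf.unique h1]
  exact hq _

namespace FramedRep

variable {𝔸 V : Type*} [NormedRing 𝔸] [NormedAlgebra ℂ 𝔸] [NormedAddCommGroup V] [NormedSpace ℂ V]
  (F : FramedRep 𝔸 V)

theorem R_units_cancel (g : 𝔸ˣ) (v : V) : F.R ((g⁻¹ : 𝔸ˣ) : 𝔸) (F.R (g : 𝔸) v) = v := by
  rw [← F.R_mul, Units.inv_mul, F.R_one]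

theorem R_units_cancel' (g : 𝔸ˣ) (v : V) : F.R (g : 𝔸) (F.R ((g⁻¹ : 𝔸ˣ) : 𝔸) v) = v := by
  rw [← F.R_mul, Units.mul_inv, F.R_one]

variable [CompleteSpace 𝔸]

/-- The orbit of a point under a group of units. -/
def orbit (G : Subgroup 𝔸ˣ) (z : V) : Set V := {y | ∃ g ∈ G, y = F.R (g : 𝔸) z}

theorem orbit_eq_of_mem {G : Subgroup 𝔸ˣ} {y z : V} (hy : y ∈ F.orbit G z) :
    F.orbit G z = F.orbit G y := by
  obtain ⟨g, hg, rfl⟩ := hy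
  ext x
  constructor
  · rintro ⟨g', hg', rfl⟩
    refine ⟨g' * g⁻¹, G.mul_mem hg' (G.inv_mem hg), ?_⟩
    rw [Units.val_mul, F.R_mul, R_units_cancel]
  · rintro ⟨g', hg', rfl⟩
    exact ⟨g' * g, G.mul_mem hg' hg, by rw [Units.val_mul, F.R_mul]⟩

/-- A slice chart of an orbit. -/
theorem exists_orbit_chart [FiniteDimensional ℂ 𝔸] {G : Subgroup 𝔸ˣ}
    (hG : IsClosed (G : Set 𝔸ˣ)) {z : V} (hz : IsUnit (F.P z)) :
    ∃ φ : OpenPartialHomeomorph V V, z ∈ φ.source ∧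
      ContDiffOn ℝ ∞ φ φ.source ∧ ContDiffOn ℝ ∞ φ.symm φ.target ∧
      ∀ y ∈ φ.source, y ∈ F.orbit G z ↔
        φ y ∈ (lie G hG).map ((F.σ : 𝔸 →ₗ[ℂ] V).restrictScalars ℝ) := by
  obtain ⟨u, hu⟩ := hz
  set w : 𝔸 := ((u⁻¹ : 𝔸ˣ) : 𝔸) with hw
  have hzw : F.P z * w = 1 := by rw [← hu, hw, Units.mul_inv]
  have hwz : w * F.P z = 1 := by rw [← hu, hw, Units.inv_mul]
  obtain ⟨X, hX, h0, hXs⟩ := exists_log ℂ 𝔸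
  obtain ⟨N, hN, hNo, h1N⟩ := mem_nhds_iff.1
    (eventually_exists_expUnit_eq_val hG (X.open_source.mem_nhds h0))
  set Y := X.restrOpen (exp ⁻¹' N) (hNo.preimage continuous_exp') with hY
  have hYs : Y.source = X.source ∩ exp ⁻¹' N := rfl
  have hYc : (Y : 𝔸 → 𝔸) = exp := hX
  have hYt : Y.target ⊆ X.target := fun y hy => by
    rw [← Y.right_inv hy]
    exact X.map_source (Y.map_target hy).1
  have h0Y : (0 : 𝔸) ∈ Y.source := ⟨h0, by simpa using h1N⟩
  have h1Y : (1 : 𝔸) ∈ Y.target := by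
    have := Y.map_source h0Y
    rwa [hYc, exp_zero] at this
  have hYd : ContDiffOn ℝ ω Y.symm Y.target := (hXs.mono hYt).restrict_scalars ℝ
  have hYexp : ∀ a ∈ Y.target, exp (Y.symm a) = a := fun a ha => by
    rw [← hYc]; exact Y.right_inv ha
  have hYlie : ∀ g ∈ G, (g : 𝔸) ∈ Y.target → Y.symm g ∈ lie G hG := fun g hg hgt => by
    have hgN : (g : 𝔸) ∈ N := by
      rw [← hYexp g hgt]; exact (Y.map_target hgt).2
    obtain ⟨x, hx, hxs, rfl⟩ := hN hgN g hg rfl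
    have : Y.symm (exp x) = x := by
      rw [← hX]; exact X.left_inv hxs
    rwa [val_expUnit, this]
  have hPd : ContDiff ℝ ω F.P := F.P.contDiff.restrict_scalars ℝ
  have hσd : ContDiff ℝ ω F.σ := F.σ.contDiff.restrict_scalars ℝ
  have hRd : ContDiff ℝ ω fun q : 𝔸 × V => F.R q.1 q.2 := F.contDiff_R.restrict_scalars ℝ
  have hEd : ContDiff ℝ ω (exp : 𝔸 → 𝔸) := (contDiff_exp ℂ).restrict_scalars ℝ
  set S : Set V := {y | F.P y * w ∈ Y.target} with hS
  set T : Set V := {v | F.P v ∈ Y.source} with hT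
  -- With $a=\log(P(y)P(z)^{-1})$, the point $y$ is pulled back by $\exp(-a)$; the displacement from
  -- $z$ then lies in $\ker P$. So $Pf(y)=a$, and orbit points are those with zero displacement and
  -- $a\in\mathfrak g$.
  set f : V → V := fun y => F.σ (Y.symm (F.P y * w)) +
    (F.R (exp (-Y.symm (F.P y * w))) y - z) with hf
  set k : V → V := fun v => F.R (exp (F.P v)) (v - F.σ (F.P v) + z) with hk
  have hPf : ∀ y ∈ S, F.P (f y) = Y.symm (F.P y * w) := fun y hy => by
    have h1 : F.P y = exp (Y.symm (F.P y * w)) * F.P z := by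
      rw [hYexp _ hy, mul_assoc, hwz, mul_one]
    set a := Y.symm (F.P y * w) with ha
    have h2 : exp (-a) * exp a = 1 := (expUnit a).inv_mul
    simp only [hf]
    rw [← ha, map_add, F.P_σ, map_sub, F.P_R, h1, ← mul_assoc, h2, one_mul, sub_self, add_zero]
  have hPk : ∀ v, F.P (k v) * w = exp (F.P v) := fun v => by
    simp only [hk]
    rw [F.P_R, map_add, map_sub, F.P_σ, sub_self, zero_add, mul_assoc, hzw, mul_one]
  have hfd : ContDiffOn ℝ ω f S := by
    have h1 : ContDiffOn ℝ ω (fun y => Y.symm (F.P y * w)) S :=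
      hYd.comp (hPd.mul contDiff_const).contDiffOn fun y hy => hy
    exact (hσd.comp_contDiffOn h1).add
      ((hRd.comp_contDiffOn ((hEd.comp_contDiffOn h1.neg).prodMk contDiffOn_id)).sub
        contDiffOn_const)
  have hkd : ContDiff ℝ ω k :=
    hRd.comp ((hEd.comp hPd).prodMk ((contDiff_id.sub (hσd.comp hPd)).add contDiff_const))
  let φ : OpenPartialHomeomorph V V :=
    { toFun := f
      invFun := k
      source := S
      target := T
      map_source' := fun y hy => by
        rw [hT, mem_ofPred_eq, hPf y hy]
        exact Y.map_target hy
      map_target' := fun v hv => by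
        rw [hS, mem_ofPred_eq, hPk v, ← hYc]
        exact Y.map_source hv
      left_inv' := fun y hy => by
        simp only [hk]
        rw [hPf y hy]
        simp only [hf]
        rw [add_sub_cancel_left, sub_add_cancel]
        exact F.R_units_cancel' (expUnit _) y
      right_inv' := fun v hv => by
        simp only [hf]
        rw [hPk v, ← hYc, Y.left_inv hv]
        simp only [hk]
        rw [hYc, show F.R (exp (-F.P v)) (F.R (exp (F.P v)) (v - F.σ (F.P v) + z)) =
          v - F.σ (F.P v) + z from F.R_units_cancel (expUnit _) _]
        abel
      open_source := Y.open_target.preimage (hPd.continuous.mul continuous_const)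
      open_target := Y.open_source.preimage hPd.continuous
      continuousOn_toFun := hfd.continuousOn
      continuousOn_invFun := hkd.continuous.continuousOn }
  refine ⟨φ, ?_, hfd.of_le (by simp), hkd.contDiffOn.of_le (by simp), fun y hy => ⟨?_, ?_⟩⟩
  · change F.P z * w ∈ Y.target
    rwa [hzw]
  · rintro ⟨g, hg, rfl⟩
    have hgt : F.P (F.R (g : 𝔸) z) * w = g := by rw [F.P_R, mul_assoc, hzw, mul_one]
    have hgY : (g : 𝔸) ∈ Y.target := by rw [← hgt]; exact hy
    refine ⟨Y.symm g, hYlie g hg hgY, ?_⟩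
    change F.σ (Y.symm g) = f (F.R (g : 𝔸) z)
    simp only [hf]
    rw [hgt]
    have : F.R (exp (-Y.symm (g : 𝔸))) (F.R (g : 𝔸) z) = z := by
      have h1 := F.R_units_cancel (expUnit (Y.symm (g : 𝔸))) z
      rw [val_expUnit, hYexp _ hgY, ← expUnit_neg] at h1
      exact h1
    rw [this, sub_self, add_zero]
  · rintro ⟨a, ha, hay⟩
    have h1 : F.σ a = f y := hay
    have h2 : a = Y.symm (F.P y * w) := by rw [← hPf y hy, ← h1, F.P_σ]
    refine ⟨expUnit a, expUnit_mem_of_mem_lie ha, ?_⟩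
    have h3 : F.R (exp (-a)) y - z = 0 := by
      simp only [hf] at h1
      rw [← h2] at h1
      exact (add_eq_left.1 h1.symm)
    rw [← sub_eq_zero.1 h3]
    exact (F.R_units_cancel' (expUnit a) y).symm

theorem isSubmanifold_orbit [FiniteDimensional ℂ 𝔸] {G : Subgroup 𝔸ˣ}
    (hG : IsClosed (G : Set 𝔸ˣ)) {z : V} (hz : IsUnit (F.P z)) :
    ∃ d : ℕ, IsSubmanifold ℝ d (F.orbit G z) := by
  refine ⟨Module.finrank ℝ ((lie G hG).map ((F.σ : 𝔸 →ₗ[ℂ] V).restrictScalars ℝ)),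
    fun y hy => ?_⟩
  rw [F.orbit_eq_of_mem hy]
  have hy' : IsUnit (F.P y) := by
    obtain ⟨g, -, rfl⟩ := hy
    rw [F.P_R]
    exact g.isUnit.mul hz
  obtain ⟨φ, h1, h2, h3, h4⟩ := F.exists_orbit_chart hG hy'
  exact ⟨φ, h1, h2, h3, _, rfl, h4⟩

/-- For a curve $\gamma$ in the orbit of $y$, $P(\gamma)P(y)^{-1}$ runs in $G\subset S$, so
$P(v)P(y)^{-1}\in S$ for its velocity $v$. If $iv$ is also tangent, this element is zero, and
$\gamma=R(P(\gamma)P(y)^{-1})y$ gives $v=0$ by the chain rule. -/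
theorem isTotallyReal_orbit [FiniteDimensional ℂ 𝔸] {G : Subgroup 𝔸ˣ}
    (hG : IsClosed (G : Set 𝔸ˣ)) {S : Submodule ℝ 𝔸} (hGS : ∀ g ∈ G, (g : 𝔸) ∈ S)
    (hS : ∀ x ∈ S, Complex.I • x ∈ S → x = 0) {z : V} (hz : IsUnit (F.P z)) :
    IsTotallyReal (F.orbit G z) := by
  have : FiniteDimensional ℝ 𝔸 := FiniteDimensional.complexToReal 𝔸
  refine ⟨F.isSubmanifold_orbit hG hz, fun y hy => ?_⟩
  rw [F.orbit_eq_of_mem hy]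
  have hy' : IsUnit (F.P y) := by
    obtain ⟨g, -, rfl⟩ := hy
    rw [F.P_R]
    exact g.isUnit.mul hz
  obtain ⟨u, hu⟩ := hy'
  set w : 𝔸 := ((u⁻¹ : 𝔸ˣ) : 𝔸) with hw
  have hyw : F.P y * w = 1 := by rw [← hu, hw, Units.mul_inv]
  have hcurve : ∀ (γ : ℝ → V) (v : V), (∀ t, γ t ∈ F.orbit G y) → HasDerivAt γ v 0 →
      HasDerivAt (fun t => F.P (γ t) * w) (F.P v * w) 0 ∧ F.P v * w ∈ S ∧
        ∀ t, γ t = F.R (F.P (γ t) * w) y := by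
    intro γ v hγ hd
    have h1 : HasDerivAt (fun t => F.P (γ t) * w) (F.P v * w) 0 :=
      ((F.P.restrictScalars ℝ).hasFDerivAt.comp_hasDerivAt 0 hd).mul_const w
    have h2 : ∀ t, ∃ g ∈ G, γ t = F.R (g : 𝔸) y ∧ F.P (γ t) * w = g := fun t => by
      obtain ⟨g, hg, h⟩ := hγ t
      exact ⟨g, hg, h, by rw [h, F.P_R, mul_assoc, hyw, mul_one]⟩
    refine ⟨h1, mem_of_hasDerivAt h1 fun t => ?_, fun t => ?_⟩
    · obtain ⟨g, hg, -, h⟩ := h2 t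
      rw [h]
      exact hGS g hg
    · obtain ⟨g, hg, h, h'⟩ := h2 t
      rw [h', h]
  rintro v ⟨γ, hγ, hγ0, hd⟩ ⟨γ', hγ', hγ'0, hd'⟩
  obtain ⟨h1, h2, h3⟩ := hcurve γ v hγ hd
  obtain ⟨-, h4, -⟩ := hcurve γ' _ hγ' hd'
  rw [map_smul, smul_mul_assoc] at h4
  have h5 := hS _ h2 h4
  rw [h5] at h1
  have hRd : DifferentiableAt ℝ (fun a : 𝔸 => F.R a y) (F.P (γ 0) * w) :=
    ((F.differentiable_R.comp
      (differentiable_id.prodMk (differentiable_const y))).restrictScalars ℝ) _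
  have h6 := hRd.hasFDerivAt.comp_hasDerivAt (0 : ℝ) h1
  rw [map_zero] at h6
  have h7 : (fun a : 𝔸 => F.R a y) ∘ (fun t => F.P (γ t) * w) = γ := funext fun t => (h3 t).symm
  rw [h7] at h6
  exact hd.unique h6

section Action

variable {Γ : Type*} [Group Γ] (c : Γ →* 𝔸ˣ) {Ω : Set V}

/-- The restriction of a representation to an invariant subset. -/
@[reducible] noncomputable def mulAction (hΩ : ∀ g, ∀ x ∈ Ω, F.R (c g : 𝔸) x ∈ Ω) :
    MulAction Γ Ω where
  smul g x := ⟨F.R (c g : 𝔸) x, hΩ g x x.2⟩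
  one_smul x := Subtype.ext (by
    change F.R (c 1 : 𝔸) x = x
    rw [map_one, Units.val_one, F.R_one])
  mul_smul g g' x := Subtype.ext (by
    change F.R (c (g * g') : 𝔸) x = F.R (c g : 𝔸) (F.R (c g' : 𝔸) x)
    rw [map_mul, Units.val_mul, F.R_mul])

variable {c} (hΩ : ∀ g, ∀ x ∈ Ω, F.R (c g : 𝔸) x ∈ Ω)

theorem isHolomorphicAction_mulAction :
    letI := F.mulAction c hΩ
    IsHolomorphicAction Γ Ω := by
  let := F.mulAction c hΩ
  have h : ∀ g : Γ, IsHolomorphic (fun x : Ω => g • x) := fun g x =>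
    ⟨univ, isOpen_univ, mem_univ _, F.R (c g : 𝔸), (F.R (c g : 𝔸)).differentiable.differentiableOn,
      fun y _ => rfl⟩
  exact fun g => ⟨h g, h g⁻¹⟩

theorem isFreeAction_mulAction (hu : ∀ x ∈ Ω, IsUnit (F.P x)) (hc : Function.Injective c) :
    letI := F.mulAction c hΩ
    IsFreeAction Γ Ω := by
  let := F.mulAction c hΩ
  intro x g g' h
  have h1 : F.R (c g : 𝔸) x = F.R (c g' : 𝔸) x := congrArg Subtype.val h
  have h2 := congrArg F.P h1
  rw [F.P_R, F.P_R] at h2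
  exact hc (Units.ext ((hu x x.2).mul_right_cancel h2))

/-- Following $(g,x)\mapsto(gx,x)$ by $(y,x)\mapsto(P(y)P(x)^{-1},x)$ gives `c` times the identity,
which is proper because `c` is a closed embedding. The first map of a proper composition is proper
in this Hausdorff setting. -/
theorem properSMul_mulAction [TopologicalSpace Γ] (hu : ∀ x ∈ Ω, IsUnit (F.P x))
    (hc : Topology.IsClosedEmbedding c) :
    letI := F.mulAction c hΩ
    ProperSMul Γ Ω := by
  let := F.mulAction c hΩ
  set u : Ω → 𝔸ˣ := fun x => (hu x x.2).unit with huu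
  have huc : Continuous u := by
    rw [(Units.isOpenEmbedding_val (R := 𝔸)).isInducing.continuous_iff]
    exact F.P.continuous.comp continuous_subtype_val
  have hcont : Continuous (fun q : Γ × Ω => (q.1 • q.2, q.2)) := by
    refine Continuous.prodMk (Continuous.subtype_mk ?_ _) continuous_snd
    exact F.continuous_R.comp (
      (Units.continuous_val.comp (hc.continuous.comp continuous_fst)).prodMk
      (continuous_subtype_val.comp continuous_snd))
  refine ⟨isProperMap_of_comp_of_t2 (g := fun q : Ω × Ω => (u q.1 * (u q.2)⁻¹, q.2)) hcont
    (((huc.comp continuous_fst).mul (huc.comp continuous_snd).inv).prodMk continuous_snd) ?_⟩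
  have : (fun q : Ω × Ω => (u q.1 * (u q.2)⁻¹, q.2)) ∘ (fun q : Γ × Ω => (q.1 • q.2, q.2)) =
      Prod.map c id := by
    funext q
    refine Prod.ext ?_ rfl
    change u (q.1 • q.2) * (u q.2)⁻¹ = c q.1
    rw [mul_inv_eq_iff_eq_mul]
    exact Units.ext (F.P_R _ _)
  rw [this]
  exact hc.isProperMap.prodMap isProperMap_id

theorem hasTotallyRealOrbits_mulAction [FiniteDimensional ℂ 𝔸]
    (hu : ∀ x ∈ Ω, IsUnit (F.P x)) (hG : IsClosed (c.range : Set 𝔸ˣ))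
    {S : Submodule ℝ 𝔸} (hGS : ∀ g, (c g : 𝔸) ∈ S)
    (hS : ∀ x ∈ S, Complex.I • x ∈ S → x = 0) :
    letI := F.mulAction c hΩ
    HasTotallyRealOrbits Γ Ω := by
  let := F.mulAction c hΩ
  intro x
  have h1 : Subtype.val '' MulAction.orbit Γ x = F.orbit c.range (x : V) := by
    ext y
    constructor
    · rintro ⟨_, ⟨g, rfl⟩, rfl⟩
      exact ⟨c g, ⟨g, rfl⟩, rfl⟩
    · rintro ⟨_, ⟨g, rfl⟩, rfl⟩
      exact ⟨g • x, ⟨g, rfl⟩, rfl⟩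
  rw [h1]
  exact F.isTotallyReal_orbit hG (by rintro _ ⟨g, rfl⟩; exact hGS g) hS (hu x x.2)

end Action

end FramedRep

end LinearAction

/-! ### Matrices with a submultiplicative norm -/

namespace LinearAction

open Filter Topology Set Matrix

/-- Square matrices with the Frobenius norm, a Banach algebra. -/
def FMat (𝕜 : Type*) (n : ℕ) := Matrix (Fin n) (Fin n) 𝕜

namespace FMat

variable (𝕜 : Type*) [RCLike 𝕜] (n : ℕ)

noncomputable instance : NormedRing (FMat 𝕜 n) := Matrix.frobeniusNormedRing (m := Fin n) (α := 𝕜)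

noncomputable instance : NormedAlgebra 𝕜 (FMat 𝕜 n) :=
  Matrix.frobeniusNormedAlgebra (R := 𝕜) (m := Fin n) (α := 𝕜)

instance : FiniteDimensional 𝕜 (FMat 𝕜 n) :=
  inferInstanceAs (FiniteDimensional 𝕜 (Matrix (Fin n) (Fin n) 𝕜))

instance : CompleteSpace (FMat 𝕜 n) := FiniteDimensional.complete 𝕜 _

end FMat

/-! ### Siegel domains and bounded type -/

section Siegel

variable {N : ℕ}

/-- Entrywise errors below $1/(N+1)$ change the quadratic form by at most $\frac N{N+1}\sum x_i^2$,
which is strictly less than the lower bound for `M`. -/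
theorem posDef_of_forall_norm_sub_lt {A M : Matrix (Fin N) (Fin N) ℝ} (hA : A.IsSymm)
    (hM : ∀ x : Fin N → ℝ, ∑ i, x i ^ 2 ≤ x ⬝ᵥ (M *ᵥ x))
    (h : ∀ i j, |A i j - M i j| < 1 / (N + 1)) : A.PosDef := by
  refine PosDef.of_dotProduct_mulVec_pos
    (by rw [IsHermitian, conjTranspose_eq_transpose_of_trivial]; exact hA) fun x hx => ?_
  have h1 : x ⬝ᵥ (A *ᵥ x) = x ⬝ᵥ (M *ᵥ x) + x ⬝ᵥ ((A - M) *ᵥ x) := by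
    rw [sub_mulVec, dotProduct_sub]; ring
  have h2 : |x ⬝ᵥ ((A - M) *ᵥ x)| ≤ N / (N + 1) * ∑ i, x i ^ 2 := by
    have h3 : x ⬝ᵥ ((A - M) *ᵥ x) = ∑ i, ∑ j, x i * (A i j - M i j) * x j := by
      simp only [dotProduct, mulVec, Finset.mul_sum, Matrix.sub_apply, mul_assoc]
    have h4 : ∀ i j, |x i * (A i j - M i j) * x j| ≤ 1 / (N + 1) * ((x i ^ 2 + x j ^ 2) / 2) := by
      intro i j
      have h5 : |x i| * |x j| ≤ (x i ^ 2 + x j ^ 2) / 2 := by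
        have := two_mul_le_add_sq |x i| |x j|
        rw [sq_abs, sq_abs] at this
        linarith
      calc |x i * (A i j - M i j) * x j| = |A i j - M i j| * (|x i| * |x j|) := by
            rw [abs_mul, abs_mul]; ring
        _ ≤ _ := mul_le_mul (h i j).le h5 (by positivity) (by positivity)
    rw [h3]
    calc |∑ i, ∑ j, x i * (A i j - M i j) * x j|
        ≤ ∑ i, ∑ j, 1 / ((N : ℝ) + 1) * ((x i ^ 2 + x j ^ 2) / 2) :=
          (Finset.abs_sum_le_sum_abs _ _).trans (Finset.sum_le_sum fun i _ =>
            (Finset.abs_sum_le_sum_abs _ _).trans (Finset.sum_le_sum fun j _ => h4 i j))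
      _ = N / (N + 1) * ∑ i, x i ^ 2 := by
          simp only [← Finset.mul_sum, ← Finset.sum_div, Finset.sum_add_distrib, Finset.sum_const,
            Finset.card_univ, Fintype.card_fin, nsmul_eq_mul]
          ring
  have h3 : 0 < ∑ i, x i ^ 2 := by
    obtain ⟨i, hi⟩ := Function.ne_iff.1 hx
    exact Finset.sum_pos' (fun _ _ => sq_nonneg _) ⟨i, Finset.mem_univ _, by
      have : x i ≠ 0 := hi
      positivity⟩
  have h4 := (abs_le.1 h2).1
  have h5 : (N : ℝ) / (N + 1) * ∑ i, x i ^ 2 < ∑ i, x i ^ 2 := by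
    refine mul_lt_of_lt_one_left h3 ?_
    rw [div_lt_one (by positivity)]
    linarith
  rw [star_trivial, h1]
  linarith [hM x]

theorem siegel_mem_nhds {z : symMat N}
    (hz : ∀ x : Fin N → ℝ, ∑ i, x i ^ 2 ≤ x ⬝ᵥ ((z : Matrix (Fin N) (Fin N) ℂ).map Complex.re *ᵥ x)) :
    siegel N ∈ 𝓝 z := by
  have hent : ∀ i j, ∀ᶠ w : symMat N in 𝓝 z, |((w : Matrix (Fin N) (Fin N) ℂ).map Complex.re) i j -
      ((z : Matrix (Fin N) (Fin N) ℂ).map Complex.re) i j| < 1 / (N + 1) := by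
    intro i j
    have h1 : Continuous fun w : symMat N => |((w : Matrix (Fin N) (Fin N) ℂ) i j).re -
      ((z : Matrix (Fin N) (Fin N) ℂ) i j).re| := by
      have h2 : Continuous fun w : symMat N => (w : Matrix (Fin N) (Fin N) ℂ) i j :=
        continuous_subtype_val.matrix_elem i j
      exact ((Complex.continuous_re.comp h2).sub continuous_const).abs
    have h3 := h1.tendsto z
    rw [sub_self, abs_zero] at h3
    exact h3.eventually_lt_const (by positivity)
  have hall : ∀ᶠ w : symMat N in 𝓝 z, ∀ i j, |((w : Matrix (Fin N) (Fin N) ℂ).map Complex.re) i j -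
      ((z : Matrix (Fin N) (Fin N) ℂ).map Complex.re) i j| < 1 / (N + 1) :=
    eventually_all.2 fun i => eventually_all.2 fun j => hent i j
  filter_upwards [hall] with w hw
  refine posDef_of_forall_norm_sub_lt ?_ hz hw
  have : (w : Matrix (Fin N) (Fin N) ℂ).IsSymm := w.2
  exact this.map Complex.re

/-- The two contributions of $\mathrm{Im}\,z$ cancel by symmetry. -/
theorem re_star_dotProduct_mulVec {z : Matrix (Fin N) (Fin N) ℂ} (hz : z.IsSymm) (v : Fin N → ℂ) :
    (star v ⬝ᵥ (z *ᵥ v)).re =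
      (fun i => (v i).re) ⬝ᵥ (z.map Complex.re *ᵥ fun i => (v i).re) +
      (fun i => (v i).im) ⬝ᵥ (z.map Complex.re *ᵥ fun i => (v i).im) := by
  have h1 : ∀ a b : Fin N → ℝ, a ⬝ᵥ (z.map Complex.re *ᵥ b) =
      ∑ i, ∑ j, a i * ((z i j).re * b j) := fun a b => by
    simp only [dotProduct, mulVec, Finset.mul_sum, map_apply]
  have h2 : (star v ⬝ᵥ (z *ᵥ v)).re = ∑ i, ∑ j, ((v i).re * ((z i j).re * (v j).re) +
      (v i).im * ((z i j).re * (v j).im)) +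
      (∑ i, ∑ j, (v i).im * (z i j).im * (v j).re - ∑ i, ∑ j, (v i).re * (z i j).im * (v j).im) := by
    simp only [dotProduct, mulVec, Finset.mul_sum, Complex.re_sum, ← Finset.sum_add_distrib,
      ← Finset.sum_sub_distrib]
    refine Finset.sum_congr rfl fun i _ => Finset.sum_congr rfl fun j _ => ?_
    simp [Complex.mul_re, Complex.mul_im]
    ring
  have h3 : ∑ i, ∑ j, (v i).im * (z i j).im * (v j).re =
      ∑ i, ∑ j, (v i).re * (z i j).im * (v j).im := by
    rw [Finset.sum_comm]
    refine Finset.sum_congr rfl fun i _ => Finset.sum_congr rfl fun j _ => ?_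
    rw [hz.apply i j]
    ring
  rw [h2, h3, sub_self, add_zero, h1, h1]
  simp only [Finset.sum_add_distrib]

theorem sum_norm_sq_le_of_posDef {z : Matrix (Fin N) (Fin N) ℂ} (hz : z.IsSymm)
    (hp : (z.map Complex.re).PosDef) (v : Fin N → ℂ) :
    ∑ i, ‖v i‖ ^ 2 ≤ (star v ⬝ᵥ ((1 + z) *ᵥ v)).re := by
  have h1 := hp.posSemidef.dotProduct_mulVec_nonneg fun i => (v i).re
  have h2 := hp.posSemidef.dotProduct_mulVec_nonneg fun i => (v i).im
  rw [star_trivial] at h1 h2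
  rw [add_mulVec, one_mulVec, dotProduct_add, Complex.add_re, re_star_dotProduct_mulVec hz]
  have h3 : (star v ⬝ᵥ v).re = ∑ i, ‖v i‖ ^ 2 := by
    simp only [dotProduct, Complex.re_sum]
    refine Finset.sum_congr rfl fun i _ => ?_
    rw [← Complex.normSq_eq_norm_sq, Complex.normSq_apply]
    simp
  linarith

theorem isUnit_one_add_of_posDef {z : Matrix (Fin N) (Fin N) ℂ} (hz : z.IsSymm)
    (hp : (z.map Complex.re).PosDef) : IsUnit (1 + z) := by
  rw [isUnit_iff_isUnit_det, isUnit_iff_ne_zero]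
  intro h
  obtain ⟨v, hv, hv0⟩ := exists_mulVec_eq_zero_iff.2 h
  have h1 := sum_norm_sq_le_of_posDef hz hp v
  rw [hv0, dotProduct_zero, Complex.zero_re] at h1
  refine hv (funext fun i => ?_)
  have h2 := (Finset.sum_eq_zero_iff_of_nonneg fun i _ => sq_nonneg ‖v i‖).1
    (le_antisymm h1 (Finset.sum_nonneg fun i _ => sq_nonneg _)) i (Finset.mem_univ i)
  simpa using h2

/-- A column $v$ of the inverse solves $(1+z)v=e_j$. Coercivity gives
$\sum|v_i|^2\le\mathrm{Re}\,\bar v_j\le|v_j|$, hence first $|v_j|\le1$, then all entries. -/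
theorem norm_inv_one_add_apply_le {z : Matrix (Fin N) (Fin N) ℂ} (hz : z.IsSymm)
    (hp : (z.map Complex.re).PosDef) (i j : Fin N) : ‖(1 + z)⁻¹ i j‖ ≤ 1 := by
  have hdet := (isUnit_iff_isUnit_det _).1 (isUnit_one_add_of_posDef hz hp)
  set v : Fin N → ℂ := (1 + z)⁻¹ *ᵥ Pi.single j 1 with hv
  have hvi : ∀ i, v i = (1 + z)⁻¹ i j := fun i => by simp [hv]
  have h1 := sum_norm_sq_le_of_posDef hz hp v
  have h2 : (1 + z) *ᵥ v = Pi.single j 1 := by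
    rw [hv, mulVec_mulVec, mul_nonsing_inv _ hdet, one_mulVec]
  rw [h2, dotProduct_single, mul_one, Pi.star_apply] at h1
  have h3 : (star (v j)).re ≤ ‖v j‖ := (Complex.re_le_norm _).trans (by simp)
  have h4 : ∀ k, ‖v k‖ ^ 2 ≤ ∑ i, ‖v i‖ ^ 2 := fun k =>
    Finset.single_le_sum (f := fun i => ‖v i‖ ^ 2) (fun _ _ => sq_nonneg _) (Finset.mem_univ k)
  have h5 : ‖v j‖ ≤ 1 := by
    have := h4 j
    nlinarith [norm_nonneg (v j)]
  rw [← hvi]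
  have := h4 i
  nlinarith [norm_nonneg (v i)]

theorem differentiableAt_matrix_inv {A : Matrix (Fin N) (Fin N) ℂ} (hA : IsUnit A) :
    DifferentiableAt ℂ (fun B : Matrix (Fin N) (Fin N) ℂ => B⁻¹) A := by
  have h : (fun B : Matrix (Fin N) (Fin N) ℂ => B⁻¹) = Ring.inverse :=
    funext fun B => nonsing_inv_eq_ringInverse B
  rw [h]
  exact differentiableAt_inverse (𝕜 := ℂ) (R := FMat ℂ N) hA

/-- The symmetric part of a matrix. -/
noncomputable def symPart (N : ℕ) : Matrix (Fin N) (Fin N) ℂ →ₗ[ℂ] symMat N where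
  toFun A := ⟨(1 / 2 : ℂ) • (A + Aᵀ), by
    change ((1 / 2 : ℂ) • (A + Aᵀ))ᵀ = _
    rw [transpose_smul, transpose_add, transpose_transpose, add_comm]⟩
  map_add' A B := Subtype.ext (by
    change (1 / 2 : ℂ) • (A + B + (A + B)ᵀ) = (1 / 2 : ℂ) • (A + Aᵀ) + (1 / 2 : ℂ) • (B + Bᵀ)
    rw [transpose_add]; module)
  map_smul' c A := Subtype.ext (by
    change (1 / 2 : ℂ) • (c • A + (c • A)ᵀ) = c • ((1 / 2 : ℂ) • (A + Aᵀ))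
    rw [transpose_smul]; module)

theorem symPart_of_isSymm {A : Matrix (Fin N) (Fin N) ℂ} (hA : A.IsSymm) :
    (symPart N A : Matrix (Fin N) (Fin N) ℂ) = A := by
  change (1 / 2 : ℂ) • (A + Aᵀ) = A
  rw [hA.eq]; module

/-- The Cayley-type transform `z ↦ (1 + z)⁻¹` of symmetric matrices. -/
noncomputable def cayley (z : symMat N) : symMat N :=
  symPart N (1 + (z : Matrix (Fin N) (Fin N) ℂ))⁻¹

/-- The inverse `w ↦ w⁻¹ - 1` of the transform `z ↦ (1 + z)⁻¹`. -/
noncomputable def cayleyInv (w : symMat N) : symMat N :=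
  symPart N ((w : Matrix (Fin N) (Fin N) ℂ)⁻¹ - 1)

theorem coe_cayley (z : symMat N) :
    (cayley z : Matrix (Fin N) (Fin N) ℂ) = (1 + (z : Matrix (Fin N) (Fin N) ℂ))⁻¹ := by
  refine symPart_of_isSymm ?_
  have : (z : Matrix (Fin N) (Fin N) ℂ).IsSymm := z.2
  rw [IsSymm, transpose_nonsing_inv, transpose_add, transpose_one, this.eq]

theorem coe_cayleyInv (w : symMat N) :
    (cayleyInv w : Matrix (Fin N) (Fin N) ℂ) = (w : Matrix (Fin N) (Fin N) ℂ)⁻¹ - 1 := by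
  refine symPart_of_isSymm ?_
  have : (w : Matrix (Fin N) (Fin N) ℂ).IsSymm := w.2
  rw [IsSymm, transpose_sub, transpose_nonsing_inv, transpose_one, this.eq]

theorem cayleyInv_cayley {z : symMat N} (hz : IsUnit (1 + (z : Matrix (Fin N) (Fin N) ℂ))) :
    cayleyInv (cayley z) = z := by
  refine Subtype.ext ?_
  rw [coe_cayleyInv, coe_cayley, nonsing_inv_nonsing_inv _ ((isUnit_iff_isUnit_det _).1 hz),
    add_sub_cancel_left]

theorem cayley_cayleyInv {w : symMat N} (hw : IsUnit (w : Matrix (Fin N) (Fin N) ℂ)) :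
    cayley (cayleyInv w) = w := by
  refine Subtype.ext ?_
  rw [coe_cayley, coe_cayleyInv, add_sub_cancel,
    nonsing_inv_nonsing_inv _ ((isUnit_iff_isUnit_det _).1 hw)]

theorem differentiableAt_cayley {z : symMat N}
    (hz : IsUnit (1 + (z : Matrix (Fin N) (Fin N) ℂ))) : DifferentiableAt ℂ (cayley (N := N)) z := by
  have h1 : DifferentiableAt ℂ (fun z : symMat N => 1 + (z : Matrix (Fin N) (Fin N) ℂ)) z :=
    ((symMat N).subtypeL.differentiableAt).const_add 1
  have h2 := (differentiableAt_matrix_inv hz).comp z h1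
  exact (LinearMap.toContinuousLinearMap (symPart N)).differentiableAt.comp z h2

theorem differentiableAt_cayleyInv {w : symMat N}
    (hw : IsUnit (w : Matrix (Fin N) (Fin N) ℂ)) : DifferentiableAt ℂ (cayleyInv (N := N)) w := by
  have h2 := (differentiableAt_matrix_inv hw).comp w (symMat N).subtypeL.differentiableAt
  exact (LinearMap.toContinuousLinearMap (symPart N)).differentiableAt.comp w (h2.sub_const 1)

theorem norm_cayley_le {z : symMat N} (hz : z ∈ siegel N) : ‖cayley z‖ ≤ 1 := by
  rw [Submodule.coe_norm, coe_cayley, Matrix.norm_le_iff zero_le_one]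
  exact norm_inv_one_add_apply_le z.2 hz

theorem isOpen_isUnit_matrix : IsOpen {A : Matrix (Fin N) (Fin N) ℂ | IsUnit A} := by
  have h : {A : Matrix (Fin N) (Fin N) ℂ | IsUnit A} = {A | A.det ≠ 0} := by
    ext A
    simp [isUnit_iff_isUnit_det]
  rw [h]
  exact isOpen_ne_fun (continuous_id.matrix_det) continuous_const

/-- A domain that is linearly equivalent to a domain in a product of Siegel domains is of bounded
type. -/
theorem isDomainOfBoundedType_of_siegel {V : Type*} [NormedAddCommGroup V] [NormedSpace ℂ V]
    [FiniteDimensional ℂ V] (T : V ≃ₗ[ℂ] (symMat N × symMat N)) {D : Set V}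
    (hD : IsComplexDomain D) (hT : ∀ z ∈ D, T z ∈ siegel N ×ˢ siegel N) :
    IsDomainOfBoundedType D := by
  set e := T.toContinuousLinearEquiv with he
  set f : V → V := fun v => e.symm (cayley (e v).1, cayley (e v).2) with hf
  set k : V → V := fun v => e.symm (cayleyInv (e v).1, cayleyInv (e v).2) with hk
  have hu : ∀ z ∈ siegel N, IsUnit (1 + (z : Matrix (Fin N) (Fin N) ℂ)) := fun z hz =>
    isUnit_one_add_of_posDef z.2 hz
  set O : Set V := {v | IsUnit ((e v).1 : Matrix (Fin N) (Fin N) ℂ) ∧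
    IsUnit ((e v).2 : Matrix (Fin N) (Fin N) ℂ)} with hO
  have hOo : IsOpen O := by
    have h1 : Continuous fun v => ((e v).1 : Matrix (Fin N) (Fin N) ℂ) :=
      continuous_subtype_val.comp (continuous_fst.comp e.continuous)
    have h2 : Continuous fun v => ((e v).2 : Matrix (Fin N) (Fin N) ℂ) :=
      continuous_subtype_val.comp (continuous_snd.comp e.continuous)
    exact (isOpen_isUnit_matrix.preimage h1).inter (isOpen_isUnit_matrix.preimage h2)
  have hT' : ∀ v ∈ D, (e v).1 ∈ siegel N ∧ (e v).2 ∈ siegel N := fun v hv => hT v hv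
  have hkf : ∀ v ∈ D, k (f v) = v := fun v hv => by
    simp only [hf, hk, ContinuousLinearEquiv.apply_symm_apply]
    rw [cayleyInv_cayley (hu _ (hT' v hv).1), cayleyInv_cayley (hu _ (hT' v hv).2), Prod.mk.eta,
      ContinuousLinearEquiv.symm_apply_apply]
  have hfk : ∀ v ∈ O, f (k v) = v := fun v hv => by
    simp only [hf, hk, ContinuousLinearEquiv.apply_symm_apply]
    rw [cayley_cayleyInv hv.1, cayley_cayleyInv hv.2, Prod.mk.eta,
      ContinuousLinearEquiv.symm_apply_apply]
  have hfO : ∀ v ∈ D, f v ∈ O := fun v hv => by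
    simp only [hf, hO, mem_ofPred_eq, ContinuousLinearEquiv.apply_symm_apply, coe_cayley]
    exact ⟨isUnit_nonsing_inv_iff.2 (hu _ (hT' v hv).1),
      isUnit_nonsing_inv_iff.2 (hu _ (hT' v hv).2)⟩
  have hfd : DifferentiableOn ℂ f D := fun v hv => by
    have h1 := (differentiableAt_cayley (hu _ (hT' v hv).1)).comp v
      (differentiableAt_fst.comp v e.differentiableAt)
    have h2 := (differentiableAt_cayley (hu _ (hT' v hv).2)).comp v
      (differentiableAt_snd.comp v e.differentiableAt)
    exact (e.symm.differentiableAt.comp v (h1.prodMk h2)).differentiableWithinAt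
  have hkd : DifferentiableOn ℂ k O := fun v hv => by
    have h1 := (differentiableAt_cayleyInv hv.1).comp v
      (differentiableAt_fst.comp v e.differentiableAt)
    have h2 := (differentiableAt_cayleyInv hv.2).comp v
      (differentiableAt_snd.comp v e.differentiableAt)
    exact (e.symm.differentiableAt.comp v (h1.prodMk h2)).differentiableWithinAt
  -- Openness of the image follows from continuity of the explicit inverse on `O`.
  have himg : f '' D = O ∩ k ⁻¹' D := by
    ext w
    constructor
    · rintro ⟨v, hv, rfl⟩
      exact ⟨hfO v hv, by rw [mem_preimage, hkf v hv]; exact hv⟩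
    · rintro ⟨hw, hwD⟩
      exact ⟨k w, hwD, hfk w hw⟩
  have hfo : IsOpen (f '' D) := by
    rw [himg]
    exact hkd.continuousOn.isOpen_inter_preimage hOo hD.1
  have hinj : InjOn f D := fun v hv v' hv' h => by rw [← hkf v hv, h, hkf v' hv']
  refine ⟨hD, f '' D, ⟨hfo, hD.2.image f hfd.continuousOn⟩, ?_, Equiv.Set.imageOfInjOn f D hinj,
    fun x => ⟨D, hD.1, x.2, f, hfd, fun y _ => rfl⟩,
    fun x => ⟨O, hOo, ?_, k, hkd, fun y _ => ?_⟩⟩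
  · have : ProperSpace (symMat N × symMat N) := FiniteDimensional.proper ℂ _
    refine ((isCompact_closedBall (0 : symMat N × symMat N) 1).image
      e.symm.continuous).isBounded.subset ?_
    rintro _ ⟨v, hv, rfl⟩
    refine ⟨_, ?_, rfl⟩
    rw [mem_closedBall_zero_iff]
    exact max_le (norm_cayley_le (hT' v hv).1) (norm_cayley_le (hT' v hv).2)
  · obtain ⟨_, v, hv, rfl⟩ := x
    exact hfO v hv
  · obtain ⟨x, rfl⟩ := (Equiv.Set.imageOfInjOn f D hinj).surjective y
    rw [Equiv.symm_apply_apply]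
    exact hkf x x.2

end Siegel

end LinearAction

/-! ### Slices and the construction of the domain -/

namespace LinearAction

open Filter Topology NormedSpace Set

namespace FramedRep

variable {𝔸 V : Type*} [NormedRing 𝔸] [NormedAlgebra ℂ 𝔸] [NormedAddCommGroup V]
  [NormedSpace ℂ V] [FiniteDimensional ℂ V] (F : FramedRep 𝔸 V)

/-- The dimension of the slices transversal to the range of a projection. -/
noncomputable def codim (π : 𝔸 →L[ℂ] 𝔸) : ℕ :=
  Module.finrank ℂ (LinearMap.ker ((π : 𝔸 →ₗ[ℂ] 𝔸) ∘ₗ (F.P : V →ₗ[ℂ] 𝔸)))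

theorem exists_isSlice (π : 𝔸 →L[ℂ] 𝔸) {ρ : ℝ} (hρ : 0 < ρ) :
    ∃ (ℓ : EuclideanSpace ℂ (Fin (F.codim π)) →L[ℂ] V)
      (ℓ' : V →L[ℂ] EuclideanSpace ℂ (Fin (F.codim π))), F.IsSlice π ρ ℓ ℓ' := by
  set K := LinearMap.ker ((π : 𝔸 →ₗ[ℂ] 𝔸) ∘ₗ (F.P : V →ₗ[ℂ] 𝔸)) with hK
  have hmemK : ∀ κ : V, κ ∈ K ↔ π (F.P κ) = 0 := fun κ => Iff.rfl
  let ι : EuclideanSpace ℂ (Fin (F.codim π)) ≃ₗ[ℂ] K := LinearEquiv.ofFinrankEq _ _ (by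
    rw [finrank_euclideanSpace_fin]; rfl)
  obtain ⟨q, hq, hqid⟩ := exists_projection K
  let ℓ₀ : EuclideanSpace ℂ (Fin (F.codim π)) →L[ℂ] V :=
    LinearMap.toContinuousLinearMap (K.subtype ∘ₗ (ι : _ →ₗ[ℂ] K))
  let ℓ₁ : V →L[ℂ] EuclideanSpace ℂ (Fin (F.codim π)) :=
    LinearMap.toContinuousLinearMap
      ((ι.symm : K →ₗ[ℂ] _) ∘ₗ LinearMap.codRestrict K (q : V →ₗ[ℂ] V) hq)
  have h₀ : ∀ b, ℓ₀ b = (ι b : V) := fun b => rfl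
  have h₁ : ∀ v, ℓ₁ v = ι.symm ⟨q v, hq v⟩ := fun v => rfl
  -- The added 1 makes the final bound strict and covers the case $\ell_0=0$.
  set s : ℝ := ρ / (‖ℓ₀‖ + 1) with hs
  have hspos : 0 < s := by positivity
  have hs0 : (s : ℂ) ≠ 0 := by exact_mod_cast hspos.ne'
  refine ⟨(s : ℂ) • ℓ₀, (s : ℂ)⁻¹ • ℓ₁, fun b => ?_, fun b => ?_, fun κ hκ => ?_, fun b hb => ?_⟩
  · have : (⟨q (ι b), hq (ι b)⟩ : K) = ι b := Subtype.ext (hqid _ (ι b).2)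
    simp only [FunLike.coe_smul, Pi.smul_apply, map_smul]
    rw [h₀, h₁, this, LinearEquiv.symm_apply_apply, smul_smul, mul_inv_cancel₀ hs0, one_smul]
  · have h := (hmemK _).1 (ι b).2
    simp only [FunLike.coe_smul, Pi.smul_apply, map_smul]
    rw [h₀, h, smul_zero]
  · have : (⟨q κ, hq κ⟩ : K) = ⟨κ, hκ⟩ := Subtype.ext (hqid _ hκ)
    simp only [FunLike.coe_smul, Pi.smul_apply, map_smul]
    rw [h₀, h₁, this, LinearEquiv.apply_symm_apply, smul_smul, inv_mul_cancel₀ hs0, one_smul]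
  · have h1 : ‖((s : ℂ) • ℓ₀) b‖ = s * ‖ℓ₀ b‖ := by
      rw [FunLike.coe_smul, Pi.smul_apply, norm_smul, Complex.norm_real,
        Real.norm_of_nonneg hspos.le]
    rw [h1]
    have h2 := ℓ₀.le_opNorm b
    have h3 : ‖ℓ₀‖ * ‖b‖ ≤ ‖ℓ₀‖ := mul_le_of_le_one_right (norm_nonneg _) hb.le
    calc s * ‖ℓ₀ b‖ < s * (‖ℓ₀‖ + 1) := by
          apply mul_lt_mul_of_pos_left _ hspos
          linarith
      _ = ρ := by rw [hs]; field_simp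

variable [CompleteSpace 𝔸] [FiniteDimensional ℂ 𝔸]

/-- The equivariant realization of the products of the tubes and a ball as domains. -/
theorem exists_domain {Γ : Type*} [Group Γ] [TopologicalSpace Γ] {c : Γ →* 𝔸ˣ}
    (hc : Topology.IsClosedEmbedding c) (hG : IsClosed (c.range : Set 𝔸ˣ))
    (hconn : IsConnected (c.range : Set 𝔸ˣ)) {S : Submodule ℝ 𝔸} (hGS : ∀ g, (c g : 𝔸) ∈ S)
    (hS : ∀ x ∈ S, Complex.I • x ∈ S → x = 0) {W : Set V} (hW : W ∈ 𝓝 F.z₀)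
    (hWinv : ∀ g, ∀ v ∈ W, F.R (c g : 𝔸) v ∈ W) :
    ∃ (k : ℕ) (δ₀ : ℝ), 0 < δ₀ ∧ ∀ δ, 0 < δ → δ < δ₀ →
      ∃ (Ω : Set V) (_ : MulAction Γ Ω), IsComplexDomain Ω ∧ Ω ⊆ W ∧ IsHolomorphicAction Γ Ω ∧
        IsFreeAction Γ Ω ∧ ProperSMul Γ Ω ∧ HasTotallyRealOrbits Γ Ω ∧
        ∃ Φ : (expTube c.range hG δ ×ˢ Metric.ball (0 : EuclideanSpace ℂ (Fin k)) 1 :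
            Set (𝔸 × EuclideanSpace ℂ (Fin k))) ≃ Ω, IsBiholomorphic Φ ∧
          ∀ g x y, y.1 = ((c g : 𝔸) * x.1.1, x.1.2) → Φ y = g • Φ x := by
  obtain ⟨π, hπ, hπid⟩ := exists_projection (complexLie c.range hG)
  obtain ⟨X, ρ₁, hρ₁, hchart⟩ := F.exists_isChart hG hπ hπid
  obtain ⟨δ₁, hδ₁, htube⟩ := isConnected_expTube hG hconn
  -- Only the factors $\exp\zeta$ and $\ell b$ have to be small; the factor from the group is
  -- absorbed by the invariance of `W`.
  have hev : ∀ᶠ q : 𝔸 × V in 𝓝 (1, 0), F.R q.1 (F.z₀ + q.2) ∈ W := by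
    have h1 : Continuous fun q : 𝔸 × V => F.R q.1 (F.z₀ + q.2) :=
      F.continuous_R.comp (continuous_fst.prodMk (continuous_const.add continuous_snd))
    refine h1.continuousAt.eventually_mem ?_
    simpa [F.R_one] using hW
  obtain ⟨ρ₂, hρ₂, hb⟩ := Metric.eventually_nhds_iff_ball.1 hev
  set ρ := min ρ₁ ρ₂ with hρ
  have hρpos : 0 < ρ := lt_min hρ₁ hρ₂
  replace hchart := hchart.mono (min_le_left ρ₁ ρ₂)
  obtain ⟨ℓ, ℓ', hslice⟩ := F.exists_isSlice π hρpos
  refine ⟨F.codim π, min ρ δ₁, lt_min hρpos hδ₁, fun δ hδ hδ₀ => ?_⟩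
  have hδρ : δ ≤ ρ := (hδ₀.trans_le (min_le_left _ _)).le
  set D := expTube c.range hG δ ×ˢ Metric.ball (0 : EuclideanSpace ℂ (Fin (F.codim π))) 1 with hD
  have hinv : ∀ g, ∀ x ∈ F.model ℓ '' D, F.R (c g : 𝔸) x ∈ F.model ℓ '' D := by
    rintro g _ ⟨⟨h, b⟩, ⟨hh, hb⟩, rfl⟩
    exact ⟨((c g : 𝔸) * h, b), ⟨mul_mem_expTube (MonoidHom.mem_range.2 ⟨g, rfl⟩) hh, hb⟩,
      F.model_mul ℓ _ _ _⟩
  have hu : ∀ x ∈ F.model ℓ '' D, IsUnit (F.P x) := by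
    rintro _ ⟨q, hq, rfl⟩
    exact isUnit_P_model hchart hslice hq
  refine ⟨F.model ℓ '' D, F.mulAction c hinv, ⟨isOpen_image_model hchart hslice hδρ, ?_⟩, ?_,
    F.isHolomorphicAction_mulAction hinv, F.isFreeAction_mulAction hinv hu hc.injective,
    F.properSMul_mulAction hinv hu hc, F.hasTotallyRealOrbits_mulAction hinv hu hG hGS hS,
    modelEquiv hchart hslice hδρ, isBiholomorphic_modelEquiv hchart hslice hδρ, ?_⟩
  · exact ((htube δ hδ (hδ₀.trans_le (min_le_right _ _))).prod
      (Metric.isConnected_ball one_pos)).image _ (F.differentiable_model ℓ).continuous.continuousOn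
  · rintro _ ⟨⟨h, b⟩, ⟨⟨_, ⟨g, rfl⟩, ζ, hζ, nζ, dζ, rfl⟩, hb'⟩, rfl⟩
    rw [F.model_mul]
    refine hWinv g _ (hb (exp ζ, ℓ b) ?_)
    rw [mem_ball_iff_norm, Prod.norm_def]
    refine max_lt ((dζ.trans_le hδρ).trans_le (min_le_right _ _)) ?_
    have h1 := hslice.norm_lt b (by simpa using hb')
    simpa using h1.trans_le (min_le_right ρ₁ ρ₂)
  · intro g x y hxy
    refine Subtype.ext ?_
    change F.model ℓ y = F.R (c g : 𝔸) (F.model ℓ x)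
    rw [hxy, F.model_mul]

end FramedRep

/-! ### The representation on pairs of symmetric matrices -/

section Rep

open Matrix

/-- The action `z ↦ J z Jᵀ` on symmetric matrices. -/
noncomputable def symCongr {N : ℕ} (J : Matrix (Fin N) (Fin N) ℂ) : symMat N →ₗ[ℂ] symMat N where
  toFun z := ⟨J * (z : Matrix (Fin N) (Fin N) ℂ) * Jᵀ, by
    have : (z : Matrix (Fin N) (Fin N) ℂ).IsSymm := z.2
    change (J * (z : Matrix (Fin N) (Fin N) ℂ) * Jᵀ)ᵀ = _
    rw [transpose_mul, transpose_mul, transpose_transpose, this.eq, mul_assoc]⟩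
  map_add' z w := Subtype.ext (by simp [mul_add, add_mul])
  map_smul' a z := Subtype.ext (by simp)

theorem coe_symCongr {N : ℕ} (J : Matrix (Fin N) (Fin N) ℂ) (z : symMat N) :
    (symCongr J z : Matrix (Fin N) (Fin N) ℂ) = J * z * Jᵀ := rfl

theorem symCongr_one {N : ℕ} (z : symMat N) : symCongr 1 z = z :=
  Subtype.ext (by rw [coe_symCongr]; simp)

theorem symCongr_mul {N : ℕ} (J K : Matrix (Fin N) (Fin N) ℂ) (z : symMat N) :
    symCongr (J * K) z = symCongr J (symCongr K z) :=
  Subtype.ext (by simp only [coe_symCongr, transpose_mul, mul_assoc])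

section Smooth

variable {E : Type*} [NormedAddCommGroup E] [NormedSpace ℂ E] {N : ℕ}

theorem contDiff_matrix_mul {f g : E → Matrix (Fin N) (Fin N) ℂ} (hf : ContDiff ℂ ω f)
    (hg : ContDiff ℂ ω g) : ContDiff ℂ ω fun x => f x * g x := by
  have hf' : ∀ i j, ContDiff ℂ ω fun x => f x i j := fun i j => contDiff_pi.1 (contDiff_pi.1 hf i) j
  have hg' : ∀ i j, ContDiff ℂ ω fun x => g x i j := fun i j => contDiff_pi.1 (contDiff_pi.1 hg i) j
  refine contDiff_pi.2 fun i => contDiff_pi.2 fun j => ?_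
  simp only [mul_apply]
  exact ContDiff.sum fun k _ => (hf' i k).mul (hg' k j)

theorem contDiff_symCongr {f : E → Matrix (Fin N) (Fin N) ℂ} {g : E → symMat N}
    (hf : ContDiff ℂ ω f) (hg : ContDiff ℂ ω g) : ContDiff ℂ ω fun x => symCongr (f x) (g x) := by
  have h1 : ContDiff ℂ ω fun x => (f x)ᵀ :=
    contDiff_pi.2 fun i => contDiff_pi.2 fun j => contDiff_pi.1 (contDiff_pi.1 hf j) i
  have h2 : ContDiff ℂ ω fun x => (g x : Matrix (Fin N) (Fin N) ℂ) :=
    (symMat N).subtypeL.contDiff.comp hg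
  have h3 := (LinearMap.toContinuousLinearMap (symPart N)).contDiff.comp
    (contDiff_matrix_mul (contDiff_matrix_mul hf h2) h1)
  -- Symmetrization fixes symmetric matrices, so smoothness among all matrices gives smoothness into
  -- the subspace.
  have h4 : (fun x => symCongr (f x) (g x)) =
      fun x => symPart N (f x * (g x : Matrix (Fin N) (Fin N) ℂ) * (f x)ᵀ) := funext fun x =>
    Subtype.ext (symPart_of_isSymm (symCongr (f x) (g x)).2).symm
  rw [h4]
  exact h3

end Smooth

variable {n : ℕ}

/-- The block matrix `b ⊕ 1`. -/
def blockOne {𝕜 : Type*} [Zero 𝕜] [One 𝕜] (b : Matrix (Fin n) (Fin n) 𝕜) :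
    Matrix (Fin (n + n)) (Fin (n + n)) 𝕜 :=
  (fromBlocks b 0 0 1).submatrix finSumFinEquiv.symm finSumFinEquiv.symm

theorem blockOne_one {𝕜 : Type*} [Zero 𝕜] [One 𝕜] :
    blockOne (1 : Matrix (Fin n) (Fin n) 𝕜) = 1 := by
  rw [blockOne, fromBlocks_one, submatrix_one_equiv]

theorem blockOne_mul {𝕜 : Type*} [Semiring 𝕜] (a b : Matrix (Fin n) (Fin n) 𝕜) :
    blockOne (a * b) = blockOne a * blockOne b := by
  rw [blockOne, blockOne, blockOne, submatrix_mul_equiv, fromBlocks_multiply]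
  simp

theorem contDiff_blockOne : ContDiff ℂ ω fun b : FMat ℂ n =>
    blockOne (𝕜 := ℂ) (show Matrix (Fin n) (Fin n) ℂ from b) := by
  have hent : ∀ i j, ContDiff ℂ ω fun b : FMat ℂ n => (show Matrix (Fin n) (Fin n) ℂ from b) i j :=
    fun i j => by
      let e : FMat ℂ n →ₗ[ℂ] ℂ :=
        { toFun := fun b => (show Matrix (Fin n) (Fin n) ℂ from b) i j
          map_add' := fun _ _ => rfl
          map_smul' := fun _ _ => rfl }
      exact (LinearMap.toContinuousLinearMap e).contDiff
  refine contDiff_pi.2 fun i => contDiff_pi.2 fun j => ?_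
  simp only [blockOne, submatrix_apply]
  rcases finSumFinEquiv.symm i with p | p <;> rcases finSumFinEquiv.symm j with q | q
  · exact hent p q
  · exact contDiff_const
  · exact contDiff_const
  · exact contDiff_const

/-- The upper right block of a matrix. -/
def upperRight (n : ℕ) : Matrix (Fin (n + n)) (Fin (n + n)) ℂ →ₗ[ℂ] Matrix (Fin n) (Fin n) ℂ where
  toFun z := (z.submatrix finSumFinEquiv finSumFinEquiv).toBlocks₁₂
  map_add' _ _ := rfl
  map_smul' _ _ := rfl

/-- The reason for doubling the size: congruence is quadratic in $b$ on the upper left block, but on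
the upper right one the second factor is $1$ and plain left multiplication remains. -/
theorem upperRight_blockOne (b : Matrix (Fin n) (Fin n) ℂ)
    (z : Matrix (Fin (n + n)) (Fin (n + n)) ℂ) :
    upperRight n (blockOne b * z * (blockOne b)ᵀ) = b * upperRight n z := by
  have h1 : ∀ A : Matrix (Fin n ⊕ Fin n) (Fin n ⊕ Fin n) ℂ,
      (A.submatrix finSumFinEquiv.symm finSumFinEquiv.symm).submatrix finSumFinEquiv
        finSumFinEquiv = A := fun A => by
    rw [submatrix_submatrix]; simp
  change ((blockOne b * z * (blockOne b)ᵀ).submatrix finSumFinEquiv finSumFinEquiv).toBlocks₁₂ =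
    b * (z.submatrix finSumFinEquiv finSumFinEquiv).toBlocks₁₂
  rw [← submatrix_mul_equiv _ _ _ finSumFinEquiv, ← submatrix_mul_equiv _ _ _ finSumFinEquiv,
    ← transpose_submatrix, blockOne, h1]
  set Z := z.submatrix finSumFinEquiv finSumFinEquiv
  conv_lhs => rw [← fromBlocks_toBlocks Z]
  rw [fromBlocks_multiply, fromBlocks_transpose, fromBlocks_multiply, toBlocks_fromBlocks₁₂]
  simp

/-- The positive definite symmetric matrix with blocks `2, 1, 1, 2`. -/
def basePoint (n : ℕ) : symMat (n + n) :=
  ⟨(fromBlocks 2 1 1 2 : Matrix (Fin n ⊕ Fin n) (Fin n ⊕ Fin n) ℂ).submatrix finSumFinEquiv.symm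
    finSumFinEquiv.symm, by
    change (Matrix.submatrix _ _ _)ᵀ = _
    rw [transpose_submatrix, fromBlocks_transpose]
    simp⟩

theorem upperRight_basePoint : upperRight n (basePoint n) = 1 := by
  change (Matrix.submatrix (Matrix.submatrix _ _ _) _ _).toBlocks₁₂ = _
  rw [submatrix_submatrix]
  simp

/-- The form is $2|u|^2+2u\cdot v+2|v|^2=|u|^2+|v|^2+|u+v|^2$. Diagonal blocks $2$ thus compensate
the off-diagonal $1$ that normalizes $P(z_0)$. -/
theorem siegel_mem_nhds_basePoint : siegel (n + n) ∈ 𝓝 (basePoint n) := by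
  refine siegel_mem_nhds fun x => ?_
  have h1 : (basePoint n : Matrix (Fin (n + n)) (Fin (n + n)) ℂ).map Complex.re =
      (fromBlocks 2 1 1 2 : Matrix (Fin n ⊕ Fin n) (Fin n ⊕ Fin n) ℝ).submatrix finSumFinEquiv.symm
        finSumFinEquiv.symm := by
    change (Matrix.submatrix _ _ _).map _ = _
    have h2 : (2 : Matrix (Fin n) (Fin n) ℂ).map Complex.re = 2 := by
      ext i j
      by_cases h : i = j <;> simp [Matrix.ofNat_apply, h]
    have h3 : (1 : Matrix (Fin n) (Fin n) ℂ).map Complex.re = 1 := by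
      ext i j
      by_cases h : i = j <;> simp [Matrix.one_apply, h]
    rw [← submatrix_map, fromBlocks_map, h2, h3]
  obtain ⟨y, rfl⟩ : ∃ y : Fin n ⊕ Fin n → ℝ, x = y ∘ finSumFinEquiv.symm :=
    ⟨x ∘ finSumFinEquiv, by funext i; simp⟩
  have h2 : ∑ i, (y ∘ finSumFinEquiv.symm) i ^ 2 = ∑ i, y i ^ 2 :=
    Equiv.sum_comp finSumFinEquiv.symm fun i => y i ^ 2
  rw [h1, h2, submatrix_mulVec_equiv, Equiv.symm_symm, Function.comp_assoc,
    Equiv.symm_comp_self, Function.comp_id, comp_equiv_dotProduct_comp_equiv]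
  obtain ⟨u, v, rfl⟩ : ∃ u v, y = Sum.elim u v :=
    ⟨y ∘ Sum.inl, y ∘ Sum.inr, (Sum.elim_comp_inl_inr y).symm⟩
  rw [fromBlocks_mulVec, sumElim_dotProduct_sumElim]
  have h4 : ∀ u : Fin n → ℝ, (2 : Matrix (Fin n) (Fin n) ℝ) *ᵥ u = 2 • u := fun u => by
    rw [← one_add_one_eq_two, add_mulVec, one_mulVec, two_smul]
  simp only [Sum.elim_comp_inl, Sum.elim_comp_inr, h4, one_mulVec, dotProduct,
    Fintype.sum_sum_type, Sum.elim_inl, Sum.elim_inr, ← Finset.sum_add_distrib]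
  refine Finset.sum_le_sum fun i _ => ?_
  simp
  nlinarith [sq_nonneg (u i + v i), sq_nonneg (u i), sq_nonneg (v i)]

/-- For real $J$, taking real parts commutes with $z\mapsto JzJ^T$, and congruence by an invertible
real matrix keeps positive definiteness. -/
theorem symCongr_mem_siegel {g : Matrix (Fin n) (Fin n) ℝ} (hg : IsUnit g) {z : symMat (n + n)}
    (hz : z ∈ siegel (n + n)) :
    symCongr (blockOne (g.map Complex.ofReal)) z ∈ siegel (n + n) := by
  have h1 : blockOne (g.map Complex.ofReal) = (blockOne g).map Complex.ofReal := by
    rw [blockOne, blockOne, ← submatrix_map, fromBlocks_map]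
    simp
  have h2 : ∀ (A B : Matrix (Fin (n + n)) (Fin (n + n)) ℝ)
      (Z : Matrix (Fin (n + n)) (Fin (n + n)) ℂ),
      (A.map Complex.ofReal * Z * B.map Complex.ofReal).map Complex.re =
        A * Z.map Complex.re * B := fun A B Z => by
    ext i j
    simp [mul_apply, Complex.re_sum]
  have h3 : IsUnit (blockOne g) := by
    obtain ⟨u, rfl⟩ := hg
    exact ⟨⟨blockOne u, blockOne (u⁻¹ : (Matrix (Fin n) (Fin n) ℝ)ˣ), by
      rw [← blockOne_mul, Units.mul_inv, blockOne_one], by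
      rw [← blockOne_mul, Units.inv_mul, blockOne_one]⟩, rfl⟩
  change ((symCongr _ z : Matrix (Fin (n + n)) (Fin (n + n)) ℂ).map Complex.re).PosDef
  rw [coe_symCongr, h1, ← transpose_map, h2]
  have h4 := Matrix.PosDef.mul_mul_conjTranspose_same (B := blockOne g) hz
    (vecMul_injective_iff_isUnit.2 h3)
  rwa [conjTranspose_eq_transpose_of_trivial] at h4

/-- The representation of the algebra of matrices on pairs of symmetric matrices of twice the
size. -/
noncomputable def siegelRep {V : Type*} [NormedAddCommGroup V] [NormedSpace ℂ V]
    [FiniteDimensional ℂ V] (T : V ≃ₗ[ℂ] (symMat (n + n) × symMat (n + n))) :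
    FramedRep (FMat ℂ n) V where
  R b := LinearMap.toContinuousLinearMap ((T.symm : _ →ₗ[ℂ] V) ∘ₗ
    ((symCongr (blockOne (𝕜 := ℂ) b)).prodMap (symCongr (blockOne (𝕜 := ℂ) b))) ∘ₗ
      (T : V →ₗ[ℂ] _))
  -- Only the first copy is read; the second carries the same action and just enlarges the slice.
  P := LinearMap.toContinuousLinearMap ((upperRight n : _ →ₗ[ℂ] FMat ℂ n) ∘ₗ
    (symMat (n + n)).subtype ∘ₗ LinearMap.fst ℂ _ _ ∘ₗ (T : V →ₗ[ℂ] _))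
  z₀ := T.symm (basePoint n, basePoint n)
  R_one v := by
    change T.symm (symCongr (blockOne (1 : Matrix (Fin n) (Fin n) ℂ)) (T v).1,
      symCongr (blockOne (1 : Matrix (Fin n) (Fin n) ℂ)) (T v).2) = v
    rw [blockOne_one, symCongr_one, symCongr_one]
    simp
  R_mul a b v := by
    have h : blockOne (𝕜 := ℂ) (a * b) = blockOne (𝕜 := ℂ) a * blockOne (𝕜 := ℂ) b :=
      blockOne_mul (show Matrix (Fin n) (Fin n) ℂ from a) (show Matrix (Fin n) (Fin n) ℂ from b)
    change T.symm (symCongr (blockOne (𝕜 := ℂ) (a * b)) (T v).1,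
      symCongr (blockOne (𝕜 := ℂ) (a * b)) (T v).2) =
      T.symm (symCongr (blockOne (𝕜 := ℂ) a) (T (T.symm (symCongr (blockOne (𝕜 := ℂ) b) (T v).1,
        symCongr (blockOne (𝕜 := ℂ) b) (T v).2))).1,
        symCongr (blockOne (𝕜 := ℂ) a) (T (T.symm (symCongr (blockOne (𝕜 := ℂ) b) (T v).1,
        symCongr (blockOne (𝕜 := ℂ) b) (T v).2))).2)
    rw [T.apply_symm_apply, h, symCongr_mul, symCongr_mul]
  contDiff_R := by
    have hT : ContDiff ℂ ω T := T.toContinuousLinearEquiv.contDiff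
    have hT' : ContDiff ℂ ω T.symm := T.symm.toContinuousLinearEquiv.contDiff
    have h1 : ContDiff ℂ ω fun q : FMat ℂ n × V => blockOne (𝕜 := ℂ) q.1 :=
      contDiff_blockOne.comp contDiff_fst
    have h2 : ContDiff ℂ ω fun q : FMat ℂ n × V => T q.2 := hT.comp contDiff_snd
    exact hT'.comp ((contDiff_symCongr h1 (contDiff_fst.comp h2)).prodMk
      (contDiff_symCongr h1 (contDiff_snd.comp h2)))
  P_R a v := by
    change upperRight n ((T (T.symm (symCongr (blockOne (𝕜 := ℂ) a) (T v).1,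
        symCongr (blockOne (𝕜 := ℂ) a) (T v).2))).1 : Matrix (Fin (n + n)) (Fin (n + n)) ℂ) = _
    rw [T.apply_symm_apply]
    exact upperRight_blockOne (show Matrix (Fin n) (Fin n) ℂ from a) _
  P_z₀ := by
    change upperRight n ((T (T.symm (basePoint n, basePoint n))).1 :
      Matrix (Fin (n + n)) (Fin (n + n)) ℂ) = 1
    rw [T.apply_symm_apply, upperRight_basePoint]

end Rep

end LinearAction

namespace LinearAction

open Filter Topology Set Matrix

/-! ### Change of the ambient space -/

section Transfer

theorem IsSubmanifold.preimage {𝕜 V W : Type*} [RCLike 𝕜] [NormedAddCommGroup V] [NormedSpace 𝕜 V]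
    [NormedAddCommGroup W] [NormedSpace 𝕜 W] {d : ℕ} {M : Set W} (h : IsSubmanifold 𝕜 d M)
    (e : V ≃L[𝕜] W) : IsSubmanifold 𝕜 d (e ⁻¹' M) := by
  intro x hx
  obtain ⟨φ, hφ, h1, h2, L, hL, h3⟩ := h (e x) hx
  refine ⟨(e.toHomeomorph.transOpenPartialHomeomorph φ).transHomeomorph e.symm.toHomeomorph, hφ,
    ?_, ?_, L.map (e.symm : W →ₗ[𝕜] V), ?_, fun y hy => ?_⟩
  · exact e.symm.contDiff.comp_contDiffOn (h1.comp e.contDiff.contDiffOn fun y hy => hy)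
  · exact e.symm.contDiff.comp_contDiffOn (h2.comp e.contDiff.contDiffOn fun y hy => hy)
  · rw [← hL]
    exact LinearEquiv.finrank_map_eq e.symm.toLinearEquiv L
  · refine (h3 _ hy).trans ⟨fun h => ⟨_, h, rfl⟩, ?_⟩
    rintro ⟨z, hz, hzy⟩
    have h4 : z = φ (e y) := e.symm.injective hzy
    exact h4 ▸ hz

theorem IsBiholomorphic.subtypeEquiv_trans {V W U : Type*} [NormedAddCommGroup V] [NormedSpace ℂ V]
    [NormedAddCommGroup W] [NormedSpace ℂ W] [NormedAddCommGroup U] [NormedSpace ℂ U] {S : Set V}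
    {S' : Set W} {D : Set U} {f : S' ≃ D} (hf : IsBiholomorphic f) (E : V ≃L[ℂ] W)
    (hE : ∀ x, x ∈ S ↔ E x ∈ S') :
    IsBiholomorphic ((E.toEquiv.subtypeEquiv hE).trans f) := by
  refine ⟨fun x => ?_, fun x => ?_⟩
  · obtain ⟨U, hU, hx, F, hF, h⟩ := hf.1 ⟨E x, (hE _).1 x.2⟩
    exact ⟨E ⁻¹' U, hU.preimage E.continuous, hx, F ∘ E,
      hF.comp E.differentiable.differentiableOn fun _ h => h,
      fun y hy => h ⟨E y, (hE _).1 y.2⟩ hy⟩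
  · obtain ⟨U, hU, hx, F, hF, h⟩ := hf.2 x
    refine ⟨U, hU, hx, E.symm ∘ F, E.symm.differentiable.comp_differentiableOn hF, fun y hy => ?_⟩
    exact congrArg E.symm (h y hy)

/-- The range consists of the units $u$ with both $u$ and $u^{-1}$ in the range of `φ`: two closed
conditions. -/
theorem isClosedEmbedding_unitsMap {A B : Type*} [Monoid A] [TopologicalSpace A] [Monoid B]
    [TopologicalSpace B] {φ : A →* B} (hφ : IsClosedEmbedding φ) :
    IsClosedEmbedding (Units.map φ) := by
  have hcont : Continuous (Units.map φ) := hφ.continuous.units_map φ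
  refine ⟨⟨?_, Units.map_injective hφ.injective⟩, ?_⟩
  · refine IsInducing.of_comp hcont Units.continuous_embedProduct ?_
    have h1 : IsInducing fun x : Aᵐᵒᵖ => MulOpposite.op (φ x.unop) :=
      MulOpposite.opHomeomorph.isInducing.comp
        (hφ.isInducing.comp MulOpposite.opHomeomorph.symm.isInducing)
    exact (hφ.isInducing.prodMap h1).comp Units.isInducing_embedProduct
  · have h1 : range (Units.map φ) =
        {u : Bˣ | (u : B) ∈ range φ} ∩ {u : Bˣ | ((u⁻¹ : Bˣ) : B) ∈ range φ} := by
      ext u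
      constructor
      · rintro ⟨a, rfl⟩
        exact ⟨⟨a, rfl⟩, ⟨((a⁻¹ : Aˣ) : A), by simp⟩⟩
      · rintro ⟨⟨a, ha⟩, ⟨b, hb⟩⟩
        refine ⟨⟨a, b, hφ.injective ?_, hφ.injective ?_⟩, Units.ext ha⟩
        · rw [map_mul, ha, hb, Units.mul_inv, map_one]
        · rw [map_mul, ha, hb, Units.inv_mul, map_one]
    rw [h1]
    exact (hφ.isClosed_range.preimage Units.continuous_val).inter
      (hφ.isClosed_range.preimage Units.continuous_coe_inv)

end Transfer

/-! ### Real linear groups as groups of complex matrices -/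

section RealGroup

variable {n : ℕ}

/-- The inclusion of the real into the complex matrices. -/
noncomputable def ofRealMat (n : ℕ) : FMat ℝ n →+* FMat ℂ n :=
  (Complex.ofRealHom.mapMatrix : Matrix (Fin n) (Fin n) ℝ →+* Matrix (Fin n) (Fin n) ℂ)

theorem ofRealMat_injective : Function.Injective (ofRealMat n) :=
  Matrix.map_injective Complex.ofReal_injective

/-- The inclusion of the real into the complex matrices as a linear map. -/
noncomputable def ofRealLin (n : ℕ) : FMat ℝ n →ₗ[ℝ] FMat ℂ n where
  toFun := ofRealMat n
  map_add' := map_add _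
  map_smul' t X := by
    change Matrix.map (t • (show Matrix (Fin n) (Fin n) ℝ from X)) Complex.ofReal =
      t • Matrix.map (show Matrix (Fin n) (Fin n) ℝ from X) Complex.ofReal
    refine Matrix.ext fun i j => ?_
    exact (Complex.ofReal_mul t _).trans (Complex.real_smul (x := t)).symm

theorem ofRealMat_smul (t : ℝ) (X : FMat ℝ n) : ofRealMat n (t • X) = t • ofRealMat n X :=
  map_smul (ofRealLin n) t X

theorem isClosedEmbedding_ofRealMat : IsClosedEmbedding (ofRealMat n) :=
  LinearMap.isClosedEmbedding_of_injective (f := ofRealLin n)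
    (LinearMap.ker_eq_bot.2 ofRealMat_injective)

theorem ofRealMat_exp (X : FMat ℝ n) :
    ofRealMat n (NormedSpace.exp X) = NormedSpace.exp (ofRealMat n X) := by
  let : NormedAlgebra ℚ (FMat ℝ n) := NormedAlgebra.restrictScalars ℚ ℝ (FMat ℝ n)
  let : NormedAlgebra ℚ (FMat ℂ n) := NormedAlgebra.restrictScalars ℚ ℝ (FMat ℂ n)
  exact NormedSpace.map_exp (ofRealMat n) isClosedEmbedding_ofRealMat.continuous X

theorem ofRealMat_exp_smul (t : ℝ) (X : FMat ℝ n) :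
    ofRealMat n (NormedSpace.exp (t • X)) = NormedSpace.exp (t • ofRealMat n X) := by
  rw [ofRealMat_exp, ofRealMat_smul]

/-- The real matrices among the complex matrices. -/
noncomputable def realMat (n : ℕ) : Submodule ℝ (FMat ℂ n) := LinearMap.range (ofRealLin n)

theorem eq_zero_of_mem_realMat {x : FMat ℂ n} (hx : x ∈ realMat n)
    (hI : Complex.I • x ∈ realMat n) : x = 0 := by
  obtain ⟨a, rfl⟩ := hx
  obtain ⟨b, hb⟩ := hI
  have h1 : ∀ i j, (show Matrix (Fin n) (Fin n) ℝ from a) i j = 0 := fun i j => by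
    have h2 : (((show Matrix (Fin n) (Fin n) ℝ from b) i j : ℝ) : ℂ) =
        Complex.I * ((show Matrix (Fin n) (Fin n) ℝ from a) i j : ℝ) :=
      congrFun (congrFun hb i) j
    simpa using (congrArg Complex.im h2).symm
  have h3 : a = 0 := Matrix.ext h1
  rw [h3, map_zero]

theorem matNorm_eq_norm (A : FMat ℂ n) : matNorm A = ‖A‖ := by
  refine Eq.trans ?_ (Matrix.frobenius_norm_def (show Matrix (Fin n) (Fin n) ℂ from A)).symm
  simp only [Real.rpow_two, ← Real.sqrt_eq_rpow]
  rfl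

variable (G : Subgroup (Matrix.GeneralLinearGroup (Fin n) ℝ))

/-- The inclusion of a real linear group into the units of the algebra of complex matrices. -/
noncomputable def complexIncl : G →* (FMat ℂ n)ˣ :=
  (Units.map (ofRealMat n : FMat ℝ n →* FMat ℂ n)).comp
    (show G →* (FMat ℝ n)ˣ from G.subtype)

theorem complexIncl_mem_realMat (g : G) : (complexIncl G g : FMat ℂ n) ∈ realMat n :=
  ⟨((g : Matrix.GeneralLinearGroup (Fin n) ℝ) : Matrix (Fin n) (Fin n) ℝ), rfl⟩

variable {G}

theorem isClosedEmbedding_complexIncl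
    (hclosed : IsClosed (G : Set (Matrix.GeneralLinearGroup (Fin n) ℝ))) :
    IsClosedEmbedding (complexIncl G) :=
  (isClosedEmbedding_unitsMap (φ := (ofRealMat n : FMat ℝ n →* FMat ℂ n))
    isClosedEmbedding_ofRealMat).comp hclosed.isClosedEmbedding_subtypeVal

theorem isClosed_range_complexIncl
    (hclosed : IsClosed (G : Set (Matrix.GeneralLinearGroup (Fin n) ℝ))) :
    IsClosed ((complexIncl G).range : Set (FMat ℂ n)ˣ) := by
  rw [MonoidHom.coe_range]
  exact (isClosedEmbedding_complexIncl hclosed).isClosed_range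

theorem isConnected_range_complexIncl
    (hclosed : IsClosed (G : Set (Matrix.GeneralLinearGroup (Fin n) ℝ)))
    (hconn : IsConnected (G : Set (Matrix.GeneralLinearGroup (Fin n) ℝ))) :
    IsConnected ((complexIncl G).range : Set (FMat ℂ n)ˣ) := by
  have := isConnected_iff_connectedSpace.1 hconn
  rw [MonoidHom.coe_range]
  exact isConnected_range (isClosedEmbedding_complexIncl hclosed).continuous

/-- If all $\exp(tx)$ are real matrices, so is their derivative $x$ at $t=0$. -/
theorem mem_lie_range_complexIncl (hG : IsClosed ((complexIncl G).range : Set (FMat ℂ n)ˣ))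
    {x : FMat ℂ n} : x ∈ lie (complexIncl G).range hG ↔ ∃ X ∈ lieAlg G, ofRealMat n X = x := by
  constructor
  · intro hx
    have hmem : ∀ t : ℝ, NormedSpace.exp (t • x) ∈ realMat n := fun t => by
      obtain ⟨g, hg⟩ := hx t
      rw [← val_expUnit, ← hg]
      exact complexIncl_mem_realMat G g
    have hderiv : HasDerivAt (fun t : ℝ => NormedSpace.exp (t • x)) x 0 := by
      have h1 : HasDerivAt (fun t : ℝ => t • x) x 0 := by
        simpa using (hasDerivAt_id (0 : ℝ)).smul_const x
      have h2 := (hasFDerivAt_exp_comp (𝕜 := ℝ) h1.hasFDerivAt (zero_smul ℝ x)).hasDerivAt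
      exact h2.congr_deriv (one_smul ℝ x)
    obtain ⟨X, rfl⟩ := mem_of_hasDerivAt hderiv hmem
    refine ⟨X, fun t => ?_, rfl⟩
    obtain ⟨g, hg⟩ := hx t
    refine ⟨g, g.2, ofRealMat_injective ?_⟩
    refine (congrArg Units.val hg).trans ?_
    exact (ofRealMat_exp_smul t X).symm
  · rintro ⟨X, hX, rfl⟩ t
    obtain ⟨g, hg, he⟩ := hX t
    refine ⟨⟨g, hg⟩, Units.ext ?_⟩
    refine (congrArg (ofRealMat n) he).trans ?_
    exact ofRealMat_exp_smul t X

theorem complexLie_range_complexIncl (hG : IsClosed ((complexIncl G).range : Set (FMat ℂ n)ˣ)) :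
    complexLie (complexIncl G).range hG = (show Submodule ℂ (FMat ℂ n) from complexLieAlg G) :=
  congrArg (Submodule.span ℂ) (Set.ext fun _ => mem_lie_range_complexIncl hG)

theorem mem_complexLie_range_complexIncl
    (hG : IsClosed ((complexIncl G).range : Set (FMat ℂ n)ˣ)) {ζ : FMat ℂ n} :
    ζ ∈ complexLie (complexIncl G).range hG ↔ ζ ∈ complexLieAlg G := by
  rw [complexLie_range_complexIncl]; rfl

theorem complexification_eq_expGroup (hG : IsClosed ((complexIncl G).range : Set (FMat ℂ n)ˣ)) :
    complexification G = expGroup (complexIncl G).range hG := by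
  refine congrArg Subgroup.closure (Set.ext fun p => ?_)
  constructor
  · rintro ⟨ζ, hζ, hp⟩
    exact ⟨ζ, (mem_complexLie_range_complexIncl hG).2 hζ, Units.ext hp⟩
  · rintro ⟨ζ, hζ, hp⟩
    exact ⟨ζ, (mem_complexLie_range_complexIncl hG).1 hζ, congrArg Units.val hp⟩

theorem mem_tube_iff (hG : IsClosed ((complexIncl G).range : Set (FMat ℂ n)ˣ)) {δ : ℝ}
    {h : FMat ℂ n} : h ∈ tube G δ ↔ h ∈ expTube (complexIncl G).range hG δ := by
  constructor
  · rintro ⟨g, hg, p, -, ⟨ζ, hζ, nζ, hp⟩, hδ, hh⟩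
    rw [hp] at hδ hh
    exact ⟨_, ⟨⟨g, hg⟩, rfl⟩, ζ, (mem_complexLie_range_complexIncl hG).2 hζ,
      (matNorm_eq_norm _).symm.trans_lt nζ, (matNorm_eq_norm _).symm.trans_lt hδ, hh⟩
  · rintro ⟨_, ⟨g, rfl⟩, ζ, hζ, nζ, hδ, rfl⟩
    have hζ' := (mem_complexLie_range_complexIncl hG).1 hζ
    exact ⟨g, g.2, (expUnit ζ : (FMat ℂ n)ˣ), Subgroup.subset_closure ⟨ζ, hζ', rfl⟩,
      ⟨ζ, hζ', (matNorm_eq_norm _).trans_lt nζ, rfl⟩, (matNorm_eq_norm _).trans_lt hδ, rfl⟩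

theorem exists_tube_eq_rawTube (hG : IsClosed ((complexIncl G).range : Set (FMat ℂ n)ˣ))
    (hcl : IsClosed (complexification G : Set (Matrix.GeneralLinearGroup (Fin n) ℂ))) :
    ∃ δ₀ > 0, ∀ δ < δ₀, tube G δ = rawTube G δ := by
  have heq := complexification_eq_expGroup hG
  obtain ⟨δ₀, hδ₀, h⟩ := exists_exp_of_mem_expGroup hG (heq ▸ hcl)
  refine ⟨δ₀, hδ₀, fun δ hδ => Set.Subset.antisymm ?_ ?_⟩
  · rintro _ ⟨g, hg, p, hp, -, hpδ, rfl⟩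
    exact ⟨g, hg, p, hp, hpδ, rfl⟩
  · rintro _ ⟨g, hg, p, hp, hpδ, rfl⟩
    obtain ⟨ζ, hζ, nζ, he⟩ := h p (heq ▸ hp)
      (((matNorm_eq_norm _).symm.trans_lt hpδ).trans hδ)
    exact ⟨g, hg, p, hp, ⟨ζ, (mem_complexLie_range_complexIncl hG).1 hζ,
      (matNorm_eq_norm _).trans_lt nζ, congrArg Units.val he⟩, hpδ, rfl⟩

/-- The identity of the space of matrices, from the sup norm to the Frobenius norm. -/
noncomputable def toFMat (n : ℕ) : Matrix (Fin n) (Fin n) ℂ ≃L[ℂ] FMat ℂ n :=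
  LinearEquiv.toContinuousLinearEquiv
    (LinearEquiv.refl ℂ (Matrix (Fin n) (Fin n) ℂ) : Matrix (Fin n) (Fin n) ℂ ≃ₗ[ℂ] FMat ℂ n)

theorem isSubmanifold_tube (hG : IsClosed ((complexIncl G).range : Set (FMat ℂ n)ˣ)) :
    ∃ δ₀ > 0, ∀ δ < δ₀, IsSubmanifold ℂ (Module.finrank ℂ (complexLieAlg G)) (tube G δ) := by
  obtain ⟨δ₀, hδ₀, h⟩ := isSubmanifold_expTube hG
  refine ⟨δ₀, hδ₀, fun δ hδ => ?_⟩
  have h1 := (h δ hδ).preimage (toFMat n)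
  have h2 : toFMat n ⁻¹' expTube (complexIncl G).range hG δ = tube G δ :=
    Set.ext fun x => (mem_tube_iff hG).symm
  have h3 : Module.finrank ℂ (complexLie (complexIncl G).range hG) =
      Module.finrank ℂ (complexLieAlg G) := by
    rw [complexLie_range_complexIncl]; rfl
  rw [h3] at h1
  exact h2 ▸ h1

theorem siegelRep_R_mem {V : Type*} [NormedAddCommGroup V] [NormedSpace ℂ V]
    [FiniteDimensional ℂ V] (T : V ≃ₗ[ℂ] (symMat (n + n) × symMat (n + n))) (g : G) {v : V}
    (hv : T v ∈ siegel (n + n) ×ˢ siegel (n + n)) :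
    T ((siegelRep T).R (complexIncl G g : FMat ℂ n) v) ∈ siegel (n + n) ×ˢ siegel (n + n) := by
  change T (T.symm _) ∈ _
  rw [T.apply_symm_apply]
  exact ⟨symCongr_mem_siegel (g : Matrix.GeneralLinearGroup (Fin n) ℝ).isUnit hv.1,
    symCongr_mem_siegel (g : Matrix.GeneralLinearGroup (Fin n) ℝ).isUnit hv.2⟩

end RealGroup

end LinearAction



theorem proposition3p1 (n : ℕ) (G : Subgroup (Matrix.GeneralLinearGroup (Fin n) ℝ))
    (hclosed : IsClosed (G : Set (Matrix.GeneralLinearGroup (Fin n) ℝ)))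
    (hconn : IsConnected (G : Set (Matrix.GeneralLinearGroup (Fin n) ℝ))) :
    ∃ (N m k : ℕ) (T : EuclideanSpace ℂ (Fin m) ≃ₗ[ℂ] (symMat N × symMat N)) (δ₀ : ℝ), 0 < δ₀ ∧
      ∀ δ : ℝ, 0 < δ → δ < δ₀ →
        (IsClosed (complexification G : Set (Matrix.GeneralLinearGroup (Fin n) ℂ)) →
          tube G δ = rawTube G δ) ∧
        IsSubmanifold ℂ (Module.finrank ℂ (complexLieAlg G)) (tube G δ) ∧
        ∃ (Ω : Set (EuclideanSpace ℂ (Fin m))) (_ : MulAction G Ω),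
          IsDomainOfBoundedType Ω ∧
          (∀ z ∈ Ω, T z ∈ siegel N ×ˢ siegel N) ∧
          IsHolomorphicAction G Ω ∧
          IsFreeAction G Ω ∧
          ProperSMul G Ω ∧
          HasTotallyRealOrbits G Ω ∧
          ∃ Φ : tubeBall G δ k ≃ Ω, IsBiholomorphic Φ ∧
            ∀ (g : G) (x : tubeBall G δ k), Φ (translate G g x) = g • Φ x := by
  have hG := isClosed_range_complexIncl hclosed
  set m := Module.finrank ℂ (symMat (n + n) × symMat (n + n)) with hm
  let T : EuclideanSpace ℂ (Fin m) ≃ₗ[ℂ] (symMat (n + n) × symMat (n + n)) :=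
    LinearEquiv.ofFinrankEq _ _ (by rw [finrank_euclideanSpace_fin])
  have hW : T ⁻¹' (siegel (n + n) ×ˢ siegel (n + n)) ∈ nhds (siegelRep T).z₀ := by
    refine T.toContinuousLinearEquiv.continuous.continuousAt.preimage_mem_nhds ?_
    have h1 : T.toContinuousLinearEquiv (siegelRep T).z₀ = (basePoint n, basePoint n) :=
      T.apply_symm_apply _
    rw [h1]
    exact prod_mem_nhds siegel_mem_nhds_basePoint siegel_mem_nhds_basePoint
  obtain ⟨k, δ₁, hδ₁, hdom⟩ := (siegelRep T).exists_domain (isClosedEmbedding_complexIncl hclosed)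
    hG (isConnected_range_complexIncl hclosed hconn) (complexIncl_mem_realMat G)
    (fun _ => eq_zero_of_mem_realMat) hW (fun g v hv => siegelRep_R_mem T g hv)
  obtain ⟨δ₂, hδ₂, hsub⟩ := isSubmanifold_tube hG
  obtain ⟨δ₃, hδ₃, hraw⟩ : ∃ δ₃ > 0, ∀ δ < δ₃,
      IsClosed (complexification G : Set (Matrix.GeneralLinearGroup (Fin n) ℂ)) →
        tube G δ = rawTube G δ := by
    -- The bound on $\delta$ precedes the closedness hypothesis in the statement; in the other case
    -- its value is arbitrary.
    by_cases hcl : IsClosed (complexification G : Set (Matrix.GeneralLinearGroup (Fin n) ℂ))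
    · obtain ⟨δ₃, hδ₃, h⟩ := exists_tube_eq_rawTube hG hcl
      exact ⟨δ₃, hδ₃, fun δ hδ _ => h δ hδ⟩
    · exact ⟨1, one_pos, fun _ _ h => absurd h hcl⟩
  refine ⟨n + n, m, k, T, min δ₁ (min δ₂ δ₃), lt_min hδ₁ (lt_min hδ₂ hδ₃), fun δ hδ hδ₀ =>
    ⟨hraw δ (hδ₀.trans_le ((min_le_right _ _).trans (min_le_right _ _))),
      hsub δ (hδ₀.trans_le ((min_le_right _ _).trans (min_le_left _ _))), ?_⟩⟩
  obtain ⟨Ω, act, hΩ, hΩW, hhol, hfree, hproper, htr, Φ, hΦ, hequiv⟩ :=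
    hdom δ hδ (hδ₀.trans_le (min_le_left _ _))
  let E := (toFMat n).prodCongr (ContinuousLinearEquiv.refl ℂ (EuclideanSpace ℂ (Fin k)))
  have hE : ∀ x, x ∈ tubeBall G δ k ↔
      E x ∈ expTube (complexIncl G).range hG δ ×ˢ Metric.ball 0 1 := fun x =>
    and_congr (mem_tube_iff hG) Iff.rfl
  exact ⟨Ω, act, isDomainOfBoundedType_of_siegel T hΩ hΩW, hΩW, hhol, hfree, hproper, htr,
    (E.toEquiv.subtypeEquiv hE).trans Φ, hΦ.subtypeEquiv_trans E hE,
    fun g x => hequiv g _ _ rfl⟩
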